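/- Let $k$ be a field and let $\Gamma$ be a nontrivial abelian monoid that has an admissible well order, i.e. a well order $<$ with $\gamma_1<\gamma_2\Rightarrow \gamma+\gamma_1<\gamma+\gamma_2$ (for example a nontrivial free abelian monoid). A bicharacter of $\Gamma$ is a map $\chi:\Gamma\times\Gamma\to k^\times$ that is multiplicative in each variable. Let $R=\bigoplus_{\gamma\in\Gamma}R_\gamma$ be a $\Gamma$-graded braided bialgebra over $k$ with braiding $\tau$ (so $\tau$ is a graded linear automorphism of $R\otimes R$ satisfying the braid equation and commuting with all structure maps, and $\Delta:R\to R\otimes^{\tau}R$ and $\varepsilon:R\to k$ are graded algebra homomorphisms). Assume that $R$ is connected, i.e. $\dim_k R_0=1$, and that $\tau=\tau_\chi$ for some bicharacter $\chi$ of $\Gamma$, i.e. $\tau(u\otimes v)=\chi(\alpha,\beta)\,v\otimes u$ for $u\in R_\alpha$, $v\in R_\beta$. Let $A\supseteq B$ be homogeneous left (resp. right) coideal subalgebras of $R$, i.e. homogeneous subalgebras $K$ with $\Delta(K)\subseteq R\otimes K$ (resp. $\Delta(K)\subseteq K\otimes R$). For a family $\{z_\xi\}_{\xi\in\Xi}$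 in $A$, a map $h:\Xi\to\mathbb{N}\cup\{\infty\}$ and a total order $<$ on $\Xi$, the triple $(\{z_\xi\}_{\xi\in\Xi},h,<)$ is called a system of PBW generators of $A$ over $B$ if $h(\xi)\ge 2$ for all $\xi$ and the monomials $z_{\xi_1}^{r_1}\cdots z_{\xi_m}^{r_m}$ ($m\ge 0$, $\xi_1<\cdots<\xi_m$ in $\Xi$, $1\le r_i<h(\xi_i)$), indexed by the sequences $((\xi_i,r_i))_{i=1}^m$, form a basis of $A$ as a left $B$-module as well as of $A$ as a right $B$-module. Then there exist a family $\{z_\xi\}_{\xi\in\Xi}$ of homogeneous elements of $A$ of nonzero degrees, a map $h:\Xi\to\mathbb{N}\cup\{\infty\}$ and a total order $\vartriangleleft$ on $\Xi$ such that, writing $A^{\trianglelefteq\xi}$ for the subalgebra of $A$ generated by $B$ and $\{z_\eta\mid \eta\trianglelefteq\xi\}$: 1. $(\{z_\xi\}_{\xi\in\Xi},h,<)$ is a system of PBW generators of $A$ over $B$ for each total order $<$ on $\Xi$. 2. For each $\xi\in\Xi$, the monomials $z_{\xi_1}^{r_1}\cdots z_{\xi_m}^{r_m}$ with $m\ge0$,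 $\xi_1\vartriangleleft\cdots\vartriangleleft\xi_m\trianglelefteq\xi$ and $1\le r_i<h(\xi_i)$ form a basis of $A^{\trianglelefteq\xi}$ as a left $B$-module as well as a right $B$-module. 3. For each $\xi\in\Xi$, $A^{\trianglelefteq\xi}$ is a left (resp. right) coideal of $R$; and if $A$ and $B$ are both subcoalgebras of $R$ and $\tau^2=\mathrm{id}_{R\otimes R}$ (i.e. $\chi(\alpha,\beta)\chi(\beta,\alpha)=1$ whenever $R_\alpha\ne0\ne R_\beta$), then each $A^{\trianglelefteq\xi}$ is a subcoalgebra of $R$. 4. For each $\xi\in\Xi$ with $h(\xi)<\infty$, $z_\xi^{h(\xi)}\in B\cup\bigcup_{\delta\vartriangleleft\xi}A^{\trianglelefteq\delta}$. 5. For all $\xi,\eta\in\Xi$ with $\eta\vartriangleleft\xi$, $[z_\xi,z_\eta]_\tau\in\bigcup_{\delta\vartriangleleft\xi}A^{\trianglelefteq\delta}$ (resp. $[z_\xi,z_\eta]_{\tau^{-1}}\in\bigcup_{\delta\vartriangleleft\xi}A^{\trianglelefteq\delta}$), where $[x,y]_\sigma=xy-\mu(\sigma(x\otimes y))$ with $\mu$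 the multiplication of $R$. 6. For each $\xi\in\Xi$ with $h(\xi)<\infty$, the scalar $a_\xi=\chi(\deg z_\xi,\deg z_\xi)$ is a root of unity. If $k$ has characteristic $0$, then $a_\xi$ has order $h(\xi)$, and in particular $a_\xi\ne1$; if $k$ has characteristic $p>0$, then $a_\xi$ has order $h(\xi)/p^s$ for some integer $s\ge0$. -/

import Mathlib

universe u v w

open scoped TensorProduct

namespace BraidedPBW

/-! ### Bicharacters and admissible orders -/

/-- A bicharacter of an abelian monoid `Γ` with values in `kˣ`. -/
structure Bicharacter (k : Type*) [Field k] (Γ : Type*) [AddCommMonoid Γ] where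
  toFun : Γ → Γ → kˣ
  map_add_left : ∀ α β γ, toFun (α + β) γ = toFun α γ * toFun β γ
  map_add_right : ∀ α β γ, toFun α (β + γ) = toFun α β * toFun α γ

instance (k : Type*) [Field k] (Γ : Type*) [AddCommMonoid Γ] :
    CoeFun (Bicharacter k Γ) (fun _ => Γ → Γ → kˣ) :=
  ⟨Bicharacter.toFun⟩

/-- `Γ` has an admissible well order: a well order such that `a < b` implies `γ + a < γ + b`. -/
def HasAdmissibleWellOrder (Γ : Type*) [AddCommMonoid Γ] : Prop :=
  ∃ r : Γ → Γ → Prop, IsWellOrder Γ r ∧ ∀ γ a b, r a b → r (γ + a) (γ + b)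

/-! ### Braidings -/

section Braiding

variable {k V : Type*} [Field k] [AddCommGroup V] [Module k V]

/-- `τ ⊗ id` on `V ⊗ V ⊗ V`. -/
noncomputable def tauLeft (τ : V ⊗[k] V ≃ₗ[k] V ⊗[k] V) :
    (V ⊗[k] V) ⊗[k] V →ₗ[k] (V ⊗[k] V) ⊗[k] V :=
  LinearMap.rTensor V τ.toLinearMap

/-- `id ⊗ τ` on `V ⊗ V ⊗ V`. -/
noncomputable def tauRight (τ : V ⊗[k] V ≃ₗ[k] V ⊗[k] V) :
    (V ⊗[k] V) ⊗[k] V →ₗ[k] (V ⊗[k] V) ⊗[k] V :=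
  (TensorProduct.assoc k V V V).symm.toLinearMap ∘ₗ
    LinearMap.lTensor V τ.toLinearMap ∘ₗ (TensorProduct.assoc k V V V).toLinearMap

/-- The braid equation. -/
def IsBraiding (τ : V ⊗[k] V ≃ₗ[k] V ⊗[k] V) : Prop :=
  tauLeft τ ∘ₗ tauRight τ ∘ₗ tauLeft τ = tauRight τ ∘ₗ tauLeft τ ∘ₗ tauRight τ

/-- `τ_{1,2} = (id ⊗ τ) ∘ (τ ⊗ id)`, moving the first factor past the last two. -/
noncomputable def tauOneTwo (τ : V ⊗[k] V ≃ₗ[k] V ⊗[k] V) :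
    (V ⊗[k] V) ⊗[k] V →ₗ[k] (V ⊗[k] V) ⊗[k] V :=
  tauRight τ ∘ₗ tauLeft τ

/-- `τ_{2,1} = (τ ⊗ id) ∘ (id ⊗ τ)`, moving the last factor past the first two. -/
noncomputable def tauTwoOne (τ : V ⊗[k] V ≃ₗ[k] V ⊗[k] V) :
    (V ⊗[k] V) ⊗[k] V →ₗ[k] (V ⊗[k] V) ⊗[k] V :=
  tauLeft τ ∘ₗ tauRight τ

/-- The subspace `P ⊗ Q` of `V ⊗ V`. -/
noncomputable def tens (P Q : Submodule k V) : Submodule k (V ⊗[k] V) :=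
  LinearMap.range (TensorProduct.mapIncl P Q)

end Braiding

/-! ### Braided algebras, coalgebras and bialgebras, and their graded versions -/

section Bialgebra

variable {k R : Type*} [Field k] [Ring R] [Algebra k R]

/-- The structure maps of the algebra `R` commute with the braiding `τ`. -/
structure IsBraidedAlgebra (τ : R ⊗[k] R ≃ₗ[k] R ⊗[k] R) : Prop where
  braiding : IsBraiding τ
  mul_left : LinearMap.rTensor R (LinearMap.mul' k R) ∘ₗ tauOneTwo τ =
    τ.toLinearMap ∘ₗ LinearMap.lTensor R (LinearMap.mul' k R) ∘ₗ
      (TensorProduct.assoc k R R R).toLinearMap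
  mul_right : LinearMap.lTensor R (LinearMap.mul' k R) ∘ₗ
      (TensorProduct.assoc k R R R).toLinearMap ∘ₗ tauTwoOne τ =
    τ.toLinearMap ∘ₗ LinearMap.rTensor R (LinearMap.mul' k R)
  one_left : ∀ v : R, τ (v ⊗ₜ[k] 1) = 1 ⊗ₜ[k] v
  one_right : ∀ v : R, τ (1 ⊗ₜ[k] v) = v ⊗ₜ[k] 1

/-- The structure maps of the coalgebra `R` commute with the braiding `τ`. -/
structure IsBraidedCoalgebra [Coalgebra k R] (τ : R ⊗[k] R ≃ₗ[k] R ⊗[k] R) : Prop where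
  braiding : IsBraiding τ
  comul_left : LinearMap.rTensor R (Coalgebra.comul (R := k) (A := R)) ∘ₗ τ.toLinearMap =
    tauOneTwo τ ∘ₗ (TensorProduct.assoc k R R R).symm.toLinearMap ∘ₗ
      LinearMap.lTensor R (Coalgebra.comul (R := k) (A := R))
  comul_right : (TensorProduct.assoc k R R R).symm.toLinearMap ∘ₗ
      LinearMap.lTensor R (Coalgebra.comul (R := k) (A := R)) ∘ₗ τ.toLinearMap =
    tauTwoOne τ ∘ₗ LinearMap.rTensor R (Coalgebra.comul (R := k) (A := R))
  counit_left : (TensorProduct.lid k R).toLinearMap ∘ₗ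
      LinearMap.rTensor R (Coalgebra.counit (R := k) (A := R)) ∘ₗ τ.toLinearMap =
    (TensorProduct.rid k R).toLinearMap ∘ₗ
      LinearMap.lTensor R (Coalgebra.counit (R := k) (A := R))
  counit_right : (TensorProduct.rid k R).toLinearMap ∘ₗ
      LinearMap.lTensor R (Coalgebra.counit (R := k) (A := R)) ∘ₗ τ.toLinearMap =
    (TensorProduct.lid k R).toLinearMap ∘ₗ
      LinearMap.rTensor R (Coalgebra.counit (R := k) (A := R))

/-- The multiplication `(μ ⊗ μ) ∘ (id ⊗ τ ⊗ id)` of the algebra `R ⊗^τ R`. -/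
noncomputable def braidedMul (τ : R ⊗[k] R ≃ₗ[k] R ⊗[k] R) :
    (R ⊗[k] R) ⊗[k] (R ⊗[k] R) →ₗ[k] R ⊗[k] R :=
  TensorProduct.map (LinearMap.mul' k R) (LinearMap.mul' k R) ∘ₗ
    (TensorProduct.assoc k R R (R ⊗[k] R)).symm.toLinearMap ∘ₗ
    LinearMap.lTensor R
      ((TensorProduct.assoc k R R R).toLinearMap ∘ₗ
        LinearMap.rTensor R τ.toLinearMap ∘ₗ
        (TensorProduct.assoc k R R R).symm.toLinearMap) ∘ₗ
    (TensorProduct.assoc k R R (R ⊗[k] R)).toLinearMap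

/-- `(R, τ)` is a braided bialgebra: a braided algebra and a braided coalgebra such that
`Δ : R → R ⊗^τ R` and `ε : R → k` are homomorphisms of algebras. -/
structure IsBraidedBialgebra [Coalgebra k R] (τ : R ⊗[k] R ≃ₗ[k] R ⊗[k] R) : Prop where
  braidedAlgebra : IsBraidedAlgebra τ
  braidedCoalgebra : IsBraidedCoalgebra τ
  comul_one : Coalgebra.comul (R := k) (1 : R) = 1 ⊗ₜ[k] 1
  comul_mul : ∀ a b : R, Coalgebra.comul (R := k) (a * b) =
    braidedMul τ (Coalgebra.comul (R := k) a ⊗ₜ[k] Coalgebra.comul (R := k) b)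
  counit_one : Coalgebra.counit (R := k) (1 : R) = 1
  counit_mul : ∀ a b : R, Coalgebra.counit (R := k) (a * b) =
    Coalgebra.counit (R := k) a * Coalgebra.counit (R := k) b

variable {Γ : Type*} [AddCommMonoid Γ] [DecidableEq Γ]

/-- `(R, τ)` with the grading `𝒜` is a `Γ`-graded braided bialgebra. -/
structure IsGradedBraidedBialgebra [Coalgebra k R] (𝒜 : Γ → Submodule k R) [GradedAlgebra 𝒜]
    (τ : R ⊗[k] R ≃ₗ[k] R ⊗[k] R) : Prop where
  braidedBialgebra : IsBraidedBialgebra τ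
  braiding_graded : ∀ α β, (tens (𝒜 α) (𝒜 β)).map τ.toLinearMap = tens (𝒜 β) (𝒜 α)
  comul_graded : ∀ γ, (𝒜 γ).map (Coalgebra.comul (R := k) (A := R)) ≤
    ⨆ p : {p : Γ × Γ // p.1 + p.2 = γ}, tens (𝒜 p.1.1) (𝒜 p.1.2)
  counit_graded : ∀ γ, γ ≠ 0 → ∀ x ∈ 𝒜 γ, Coalgebra.counit (R := k) x = 0

/-- The grading is connected: the component of degree `0` is one-dimensional. -/
def IsConnectedGrading (𝒜 : Γ → Submodule k R) : Prop :=
  Module.finrank k (𝒜 0) = 1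

/-- `τ = τ_χ`, that is, `τ (u ⊗ v) = χ(α, β) • v ⊗ u` for `u`, `v` homogeneous of degrees
`α`, `β`. Since homogeneous elements span `R`, this determines `τ`. -/
def IsInducedBraiding (χ : Bicharacter k Γ) (𝒜 : Γ → Submodule k R)
    (τ : R ⊗[k] R ≃ₗ[k] R ⊗[k] R) : Prop :=
  ∀ α β, ∀ u ∈ 𝒜 α, ∀ v ∈ 𝒜 β, τ (u ⊗ₜ[k] v) = (χ α β : k) • (v ⊗ₜ[k] u)

/-- The `τ`-commutator `[x, y]_τ = (μ - μ ∘ τ) (x ⊗ y)`. -/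
noncomputable def braidedCommutator (τ : R ⊗[k] R ≃ₗ[k] R ⊗[k] R) (x y : R) : R :=
  LinearMap.mul' k R (x ⊗ₜ[k] y) - LinearMap.mul' k R (τ (x ⊗ₜ[k] y))

/-! ### Coideals -/

/-- A label choosing between the left and the right version of the one-sided notions. -/
inductive Side where
  | left
  | right

/-- `Δ(K) ⊆ R ⊗ K` for the left version, `Δ(K) ⊆ K ⊗ R` for the right version. -/
def IsCoideal [Coalgebra k R] : Side → Submodule k R → Prop
  | .left, K => K.map (Coalgebra.comul (R := k) (A := R)) ≤ tens ⊤ K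
  | .right, K => K.map (Coalgebra.comul (R := k) (A := R)) ≤ tens K ⊤

/-- `Δ(K) ⊆ K ⊗ K`. -/
def IsSubcoalgebra [Coalgebra k R] (K : Submodule k R) : Prop :=
  K.map (Coalgebra.comul (R := k) (A := R)) ≤ tens K K

/-- The braiding used in commutators: `τ` for the left version, `τ⁻¹` for the right version. -/
noncomputable def Side.braiding (τ : R ⊗[k] R ≃ₗ[k] R ⊗[k] R) : Side → R ⊗[k] R ≃ₗ[k] R ⊗[k] R
  | .left => τ
  | .right => τ.symm

/-! ### PBW generators -/

/-- The family `f` is a basis of `A` as a left module over the subalgebra `B`. -/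
def IsLeftBasis {M : Type*} (B A : Subalgebra k R) (f : M → R) : Prop :=
  LinearIndependent B f ∧ (Submodule.span B (Set.range f) : Set R) = A

/-- The family `f` is a basis of `A` as a right module over the subalgebra `B`, right `B`-modules
being modules over the opposite algebra of `B`. -/
def IsRightBasis {M : Type*} (B A : Subalgebra k R) (f : M → R) : Prop :=
  LinearIndependent B.op f ∧ (Submodule.span B.op (Set.range f) : Set R) = A

variable {Ξ : Type*}

/-- Exponents of the PBW monomials in the generators with index in `S`, with heights `h`:
finitely supported `r` with support in `S` and `r ξ < h ξ`. -/
def PBWExponent (h : Ξ → ℕ∞) (S : Set Ξ) : Type _ :=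
  {r : Ξ →₀ ℕ // (r.support : Set Ξ) ⊆ S ∧ ∀ ξ ∈ r.support, (r ξ : ℕ∞) < h ξ}

/-- The monomial `z_{ξ₁}^{r₁} ⋯ z_{ξₘ}^{rₘ}` with `ξ₁ < ⋯ < ξₘ` the support of `r` and
`rᵢ = r ξᵢ`. -/
def pbwMonomial (o : LinearOrder Ξ) (z : Ξ → R) (r : Ξ →₀ ℕ) : R :=
  ((r.support.sort (fun a b => o.le a b)).map (fun ξ => z ξ ^ r ξ)).prod

/-- The PBW monomials in the generators `z ξ`, `ξ ∈ S`, multiplied in the order `o`, form a basis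
of `A` as a left `B`-module as well as a right `B`-module. -/
def HasPBWBasis (o : LinearOrder Ξ) (z : Ξ → R) (h : Ξ → ℕ∞) (S : Set Ξ)
    (B A : Subalgebra k R) : Prop :=
  IsLeftBasis B A (fun r : PBWExponent h S => pbwMonomial o z r.1) ∧
    IsRightBasis B A (fun r : PBWExponent h S => pbwMonomial o z r.1)

/-- `(z, h, <)` is a system of PBW generators of `A` over `B`, where `<` is the order `o`. -/
structure IsPBWSystem (o : LinearOrder Ξ) (z : Ξ → R) (h : Ξ → ℕ∞)
    (B A : Subalgebra k R) : Prop where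
  mem : ∀ ξ, z ξ ∈ A
  two_le : ∀ ξ, 2 ≤ h ξ
  basis : HasPBWBasis o z h Set.univ B A

/-- The subalgebra generated over `B` by the `z η` with `η ≤ ξ`. -/
def truncation (o : LinearOrder Ξ) (z : Ξ → R) (B : Subalgebra k R) (ξ : Ξ) : Subalgebra k R :=
  Algebra.adjoin k ((B : Set R) ∪ z '' {η | o.le η ξ})

end Bialgebra

end BraidedPBW

/-! The inclusion `B ≤ A` is refined to a chain of homogeneous coideal subalgebras whose jumps `E <
D` are elementary: `D = E[z]` with `z` homogeneous, and `E` is the kernel of a skew derivation `∂`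
of `D` with `∂ z = 1`.

Skew derivations come from functionals. Let `D = C[z]` with `C` and `D` coideal subalgebras that
agree in degrees below `γ = deg z`, and `z ∉ C`. A functional `φ` concentrated in degree `γ`, zero
on `C`, with `φ z = 1`, is an `ε`-derivation on `D`, so `(id ⊗ φ)Δ`, or a rescaled `(φ ⊗ id)Δ`, is a
skew derivation (`isSkewDer_hitR`, `isSkewDer_hitL`). Its kernel `E` contains `C` and is a coideal
by coassociativity. Since `∂` kills the braided commutators of `z` with `E`, these stay in `E`.
Since `∂` sends `z ^ n` to a quantum integer times `z ^ (n - 1)`, `D` is free over `E` on the powers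
below the height `h`, the least `n` whose quantum integer vanishes, and `z ^ h ∈ E`
(`exists_niceStep`, `exists_mid`). This yields the power relations, the commutator relations and the
orders of the roots of unity. If `τ² = id`, the left and right derivations coincide on `D`, so `E`
is a coideal on both sides.

Globally, `E` may be larger than `C`, and the gap from `C` to `E` needs refining again. The
homogeneous elements are well-ordered by increasing degree, and an interval `(C, D)` is split by the
first such `w` in `D` outside `C` into `(C, E)`, `(E, C[w])`, `(C[w], D)`. The middle piece is
elementary and is never split again. Following the interval around a homogeneous `a`, one reaches an
elementary interval no later than the turn of `a` itself (`exists_settled`). These intervals are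
linearly ordered. Those occupied by elements of one fixed degree are well-ordered, because
descending into `(C, E)` raises the degree of all later splitting elements (`exists_min_of_bound`).

Spanning by PBW monomials is then an induction on the degree and, within a degree, on that
well-order (`IsPBWChain.mem_pbwSpan`); independence compares leading coefficients of the largest
generator (`IsPBWChain.coeff_eq_zero_of_graded`). Moving a power of the largest generator through a
monomial costs only a nonzero scalar and lower powers, so all total orders and both module sides are
treated at once. -/

namespace BraidedPBW

/-! ### Graded algebras -/

section Graded

variable {k R Γ : Type*} [Field k] [Ring R] [Algebra k R] [AddCommMonoid Γ] [DecidableEq Γ]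
  (𝒜 : Γ → Submodule k R) [GradedAlgebra 𝒜]

/-- A subalgebra containing the homogeneous components of its elements. -/
def IsHom (K : Subalgebra k R) : Prop :=
  ∀ γ, ∀ x ∈ K, GradedAlgebra.proj 𝒜 γ x ∈ K

theorem proj_mem (γ : Γ) (x : R) : GradedAlgebra.proj 𝒜 γ x ∈ 𝒜 γ := by
  rw [GradedAlgebra.proj_apply]; exact SetLike.coe_mem _

variable {𝒜}

theorem proj_same {γ : Γ} {x : R} (hx : x ∈ 𝒜 γ) : GradedAlgebra.proj 𝒜 γ x = x := by
  rw [GradedAlgebra.proj_apply]; exact DirectSum.decompose_of_mem_same _ hx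

theorem proj_ne {γ δ : Γ} {x : R} (hx : x ∈ 𝒜 γ) (h : γ ≠ δ) : GradedAlgebra.proj 𝒜 δ x = 0 := by
  rw [GradedAlgebra.proj_apply]; exact DirectSum.decompose_of_mem_ne _ hx h

variable (𝒜) in
theorem exists_sum_proj (x : R) : ∃ s : Finset Γ, ∑ γ ∈ s, GradedAlgebra.proj 𝒜 γ x = x := by
  classical
  exact ⟨DFinsupp.support (DirectSum.decompose 𝒜 x), by
    simpa only [GradedAlgebra.proj_apply] using DirectSum.sum_support_decompose 𝒜 x⟩

theorem mem_of_proj_mem {M : Type*} [SetLike M R] [AddSubmonoidClass M R] (S : M) {x : R}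
    (h : ∀ γ, GradedAlgebra.proj 𝒜 γ x ∈ S) : x ∈ S := by
  obtain ⟨s, hs⟩ := exists_sum_proj 𝒜 x
  rw [← hs]
  exact sum_mem fun γ _ => h γ

theorem eq_zero_of_proj {x : R} (h : ∀ γ, GradedAlgebra.proj 𝒜 γ x = 0) : x = 0 := by
  obtain ⟨s, hs⟩ := exists_sum_proj 𝒜 x
  rw [← hs]
  exact Finset.sum_eq_zero fun γ _ => h γ

theorem linearMap_ext_of_graded {M : Type*} [AddCommGroup M] [Module k M] {f g : R →ₗ[k] M}
    (h : ∀ γ, ∀ x ∈ 𝒜 γ, f x = g x) : f = g := by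
  ext x
  obtain ⟨s, hs⟩ := exists_sum_proj 𝒜 x
  rw [← hs, map_sum, map_sum]
  exact Finset.sum_congr rfl fun γ _ => h γ _ (proj_mem 𝒜 γ x)

theorem IsHom.induction {K : Subalgebra k R} (hK : IsHom 𝒜 K) {p : R → Prop} (h0 : p 0)
    (hadd : ∀ x y, p x → p y → p (x + y)) (h : ∀ γ, ∀ x ∈ K, x ∈ 𝒜 γ → p x) {x : R}
    (hx : x ∈ K) : p x := by
  obtain ⟨s, hs⟩ := exists_sum_proj 𝒜 x
  rw [← hs]
  exact Finset.sum_induction _ p hadd h0 fun γ _ => h γ _ (hK γ x hx) (proj_mem 𝒜 γ x)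

theorem graded_induction {p : R → Prop} (h0 : p 0)
    (hadd : ∀ x y, p x → p y → p (x + y)) (h : ∀ γ, ∀ x ∈ 𝒜 γ, p x) (x : R) : p x := by
  obtain ⟨s, hs⟩ := exists_sum_proj 𝒜 x
  rw [← hs]
  exact Finset.sum_induction _ p hadd h0 fun γ _ => h γ _ (proj_mem 𝒜 γ x)

theorem proj_mul_right [IsCancelAdd Γ] {α β : Γ} (x : R) {y : R} (hy : y ∈ 𝒜 β) :
    GradedAlgebra.proj 𝒜 (α + β) (x * y) = GradedAlgebra.proj 𝒜 α x * y := by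
  refine graded_induction (𝒜 := 𝒜) (p := fun x => GradedAlgebra.proj 𝒜 (α + β) (x * y) =
    GradedAlgebra.proj 𝒜 α x * y) (by simp) (fun u v hu hv => ?_) (fun γ u hu => ?_) x
  · rw [add_mul, map_add, hu, hv, map_add, add_mul]
  · by_cases h : γ = α
    · subst h
      rw [proj_same hu, proj_same (SetLike.mul_mem_graded hu hy)]
    · rw [proj_ne hu h, zero_mul, proj_ne (SetLike.mul_mem_graded hu hy)]
      exact fun e => h (add_right_cancel e)

theorem proj_mul_right_of_ne {β γ : Γ} (x : R) {y : R} (hy : y ∈ 𝒜 β)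
    (h : ∀ α, α + β ≠ γ) : GradedAlgebra.proj 𝒜 γ (x * y) = 0 := by
  refine graded_induction (𝒜 := 𝒜) (p := fun x => GradedAlgebra.proj 𝒜 γ (x * y) = 0)
    (by simp) (fun u v hu hv => ?_) (fun α u hu => ?_) x
  · rw [add_mul, map_add, hu, hv, add_zero]
  · exact proj_ne (SetLike.mul_mem_graded hu hy) (h α)

theorem proj_mul_left [IsCancelAdd Γ] {α β : Γ} {x : R} (hx : x ∈ 𝒜 α) (y : R) :
    GradedAlgebra.proj 𝒜 (β + α) (x * y) = x * GradedAlgebra.proj 𝒜 β y := by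
  refine graded_induction (𝒜 := 𝒜) (p := fun y => GradedAlgebra.proj 𝒜 (β + α) (x * y) =
    x * GradedAlgebra.proj 𝒜 β y) (by simp) (fun u v hu hv => ?_) (fun γ u hu => ?_) y
  · rw [mul_add, map_add, hu, hv, map_add, mul_add]
  · have := SetLike.mul_mem_graded hx hu
    rw [add_comm] at this
    by_cases h : γ = β
    · subst h
      rw [proj_same hu, proj_same this]
    · rw [proj_ne hu h, mul_zero, proj_ne this]
      exact fun e => h (add_right_cancel e)

theorem proj_mul_left_of_ne {α γ : Γ} {x : R} (hx : x ∈ 𝒜 α) (y : R)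
    (h : ∀ β, β + α ≠ γ) : GradedAlgebra.proj 𝒜 γ (x * y) = 0 := by
  refine graded_induction (𝒜 := 𝒜) (p := fun y => GradedAlgebra.proj 𝒜 γ (x * y) = 0)
    (by simp) (fun u v hu hv => ?_) (fun β u hu => ?_) y
  · rw [mul_add, map_add, hu, hv, add_zero]
  · refine proj_ne (SetLike.mul_mem_graded hx hu) ?_
    rw [add_comm]
    exact h β

/-- An algebra generated by homogeneous elements is homogeneous. -/
theorem isHom_adjoin {S : Set R}
    (hS : ∀ x ∈ S, ∀ γ, GradedAlgebra.proj 𝒜 γ x ∈ Algebra.adjoin k S) :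
    IsHom 𝒜 (Algebra.adjoin k S) := by
  intro γ x hx
  induction hx using Algebra.adjoin_induction generalizing γ with
  | mem x hx => exact hS x hx γ
  | algebraMap r =>
    have h1 : algebraMap k R r ∈ 𝒜 0 := SetLike.algebraMap_mem_graded 𝒜 r
    by_cases h : 0 = γ
    · subst h
      rw [proj_same h1]
      exact Subalgebra.algebraMap_mem _ r
    · rw [proj_ne h1 h]
      exact zero_mem _
  | add x y _ _ hx hy => rw [map_add]; exact add_mem (hx γ) (hy γ)
  | mul x y _ _ hx hy =>
    obtain ⟨s, hs⟩ := exists_sum_proj 𝒜 x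
    obtain ⟨t, ht⟩ := exists_sum_proj 𝒜 y
    rw [← hs, ← ht, Finset.sum_mul_sum, map_sum]
    refine sum_mem fun i _ => ?_
    rw [map_sum]
    refine sum_mem fun j _ => ?_
    have hm : GradedAlgebra.proj 𝒜 i x * GradedAlgebra.proj 𝒜 j y ∈ 𝒜 (i + j) :=
      SetLike.mul_mem_graded (proj_mem 𝒜 i x) (proj_mem 𝒜 j y)
    by_cases h : i + j = γ
    · subst h
      rw [proj_same hm]
      exact mul_mem (hx i) (hy j)
    · rw [proj_ne hm h]
      exact zero_mem _

/-- `C[y]`. -/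
def extend (C : Subalgebra k R) (y : R) : Subalgebra k R :=
  Algebra.adjoin k (insert y (C : Set R))

theorem le_extend (C : Subalgebra k R) (y : R) : C ≤ extend C y := fun _ hx =>
  Algebra.subset_adjoin (Set.mem_insert_of_mem _ hx)

theorem self_mem_extend (C : Subalgebra k R) (y : R) : y ∈ extend C y :=
  Algebra.subset_adjoin (Set.mem_insert _ _)

theorem extend_le {C D : Subalgebra k R} {y : R} (h : C ≤ D) (hy : y ∈ D) : extend C y ≤ D :=
  Algebra.adjoin_le (Set.insert_subset hy h)

theorem isHom_extend {C : Subalgebra k R} (hC : IsHom 𝒜 C) {γ : Γ} {y : R} (hy : y ∈ 𝒜 γ) :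
    IsHom 𝒜 (extend C y) := by
  refine isHom_adjoin fun x hx δ => ?_
  rcases hx with rfl | hx
  · by_cases h : γ = δ
    · subst h
      rw [proj_same hy]
      exact self_mem_extend C x
    · rw [proj_ne hy h]
      exact zero_mem _
  · exact le_extend C y (hC δ x hx)

variable (𝒜) in
/-- The linear map multiplying the homogeneous elements of degree `γ` by `c γ`. -/
noncomputable def scale (c : Γ → k) : R →ₗ[k] R :=
  DirectSum.toModule k Γ R (fun γ => c γ • (𝒜 γ).subtype) ∘ₗ
    (DirectSum.decomposeLinearEquiv 𝒜).toLinearMap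

theorem scale_of_mem (c : Γ → k) {γ : Γ} {x : R} (hx : x ∈ 𝒜 γ) : scale 𝒜 c x = c γ • x := by
  rw [scale, LinearMap.comp_apply, LinearEquiv.coe_coe, DirectSum.decomposeLinearEquiv_apply,
    DirectSum.decompose_of_mem _ hx, ← DirectSum.lof_eq_of k, DirectSum.toModule_lof]
  rfl

theorem scale_mul {c : Γ → k} (hc : ∀ α β, c (α + β) = c α * c β) (x y : R) :
    scale 𝒜 c (x * y) = scale 𝒜 c x * scale 𝒜 c y := by
  refine graded_induction (𝒜 := 𝒜) (p := fun x => scale 𝒜 c (x * y) = scale 𝒜 c x * scale 𝒜 c y)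
    (by simp) (fun u v hu hv => ?_) (fun α x hx => ?_) x
  · rw [add_mul, map_add, hu, hv, map_add, add_mul]
  · refine graded_induction (𝒜 := 𝒜)
      (p := fun y => scale 𝒜 c (x * y) = scale 𝒜 c x * scale 𝒜 c y)
      (by simp) (fun u v hu hv => ?_) (fun β y hy => ?_) y
    · rw [mul_add, map_add, hu, hv, map_add, mul_add]
    · rw [scale_of_mem c hx, scale_of_mem c hy, scale_of_mem c (SetLike.mul_mem_graded hx hy), hc,
        smul_mul_smul_comm]

theorem scale_scale {c c' : Γ → k} (h : ∀ α, c α * c' α = 1) (x : R) :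
    scale 𝒜 c (scale 𝒜 c' x) = x := by
  refine graded_induction (𝒜 := 𝒜) (p := fun x => scale 𝒜 c (scale 𝒜 c' x) = x)
    (by simp) (fun u v hu hv => ?_) (fun α x hx => ?_) x
  · rw [map_add, map_add, hu, hv]
  · rw [scale_of_mem c' hx, map_smul, scale_of_mem c hx, smul_smul, mul_comm, h, one_smul]

theorem scale_proj (c : Γ → k) (γ : Γ) (x : R) :
    scale 𝒜 c (GradedAlgebra.proj 𝒜 γ x) = GradedAlgebra.proj 𝒜 γ (scale 𝒜 c x) := by
  refine graded_induction (𝒜 := 𝒜) (p := fun x => scale 𝒜 c (GradedAlgebra.proj 𝒜 γ x) =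
    GradedAlgebra.proj 𝒜 γ (scale 𝒜 c x)) (by simp) (fun u v hu hv => ?_) (fun α x hx => ?_) x
  · simp only [map_add, hu, hv]
  · rw [scale_of_mem c hx, map_smul]
    by_cases h : α = γ
    · subst h
      rw [proj_same hx, scale_of_mem c hx]
    · rw [proj_ne hx h, map_zero, smul_zero]

end Graded

/-! ### Slices of tensors -/

section Slices

variable {k V : Type*} [Field k] [AddCommGroup V] [Module k V]

/-- `f ⊗ id`. -/
noncomputable def sliceL (f : V →ₗ[k] k) : V ⊗[k] V →ₗ[k] V :=
  (TensorProduct.lid k V).toLinearMap ∘ₗ LinearMap.rTensor V f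

/-- `id ⊗ f`. -/
noncomputable def sliceR (f : V →ₗ[k] k) : V ⊗[k] V →ₗ[k] V :=
  (TensorProduct.rid k V).toLinearMap ∘ₗ LinearMap.lTensor V f

@[simp] theorem sliceL_tmul (f : V →ₗ[k] k) (a b : V) : sliceL f (a ⊗ₜ b) = f a • b := by
  simp [sliceL]

@[simp] theorem sliceR_tmul (f : V →ₗ[k] k) (a b : V) : sliceR f (a ⊗ₜ b) = f b • a := by
  simp [sliceR]

theorem tmul_mem_tens {P Q : Submodule k V} {a b : V} (ha : a ∈ P) (hb : b ∈ Q) :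
    a ⊗ₜ[k] b ∈ tens P Q := ⟨⟨a, ha⟩ ⊗ₜ ⟨b, hb⟩, rfl⟩

theorem tens_le {P Q : Submodule k V} {S : Submodule k (V ⊗[k] V)}
    (h : ∀ a ∈ P, ∀ b ∈ Q, a ⊗ₜ[k] b ∈ S) : tens P Q ≤ S := by
  rintro _ ⟨t, rfl⟩
  induction t with
  | zero => simp
  | tmul a b => exact h _ a.2 _ b.2
  | add x y hx hy => rw [map_add]; exact add_mem hx hy

theorem tens_mono {P Q P' Q' : Submodule k V} (hP : P ≤ P') (hQ : Q ≤ Q') :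
    tens P Q ≤ tens P' Q' := tens_le fun _ ha _ hb => tmul_mem_tens (hP ha) (hQ hb)

/-- Expanding `t` in a basis of the left factor, the coefficients are the slices by coordinate
functionals. The criterion turns the coideal condition into stability under the operators `hitL f`,
which passes easily to intersections, unions of chains and kernels. -/
theorem mem_tens_top_left_iff {K : Submodule k V} {t : V ⊗[k] V} :
    t ∈ tens ⊤ K ↔ ∀ f : V →ₗ[k] k, sliceL f t ∈ K := by
  constructor
  · intro ht f
    have : tens ⊤ K ≤ K.comap (sliceL f) := tens_le fun a _ b hb => by
      simpa using K.smul_mem _ hb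
    exact this ht
  · classical
    intro h
    let ℬ := Module.Basis.ofVectorSpace k V
    rw [← (TensorProduct.equivFinsuppOfBasisLeft (N := V) ℬ).symm_apply_apply t,
      TensorProduct.equivFinsuppOfBasisLeft_symm_apply]
    refine sum_mem fun i _ => tmul_mem_tens trivial ?_
    rw [TensorProduct.equivFinsuppOfBasisLeft_apply]
    exact h (ℬ.coord i)

theorem mem_tens_top_right_iff {K : Submodule k V} {t : V ⊗[k] V} :
    t ∈ tens K ⊤ ↔ ∀ f : V →ₗ[k] k, sliceR f t ∈ K := by
  have h1 : ∀ t : V ⊗[k] V, ∀ f : V →ₗ[k] k,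
      sliceL f (TensorProduct.comm k V V t) = sliceR f t := fun t f => by
    induction t with
    | zero => simp
    | tmul a b => simp
    | add x y hx hy => simp only [map_add, hx, hy]
  have h2 : ∀ P Q : Submodule k V, tens P Q ≤ (tens Q P).comap (TensorProduct.comm k V V).toLinearMap :=
    fun P Q => tens_le fun a ha b hb => tmul_mem_tens hb ha
  constructor
  · intro ht f
    rw [← h1]
    exact mem_tens_top_left_iff.1 (h2 _ _ ht) f
  · intro h
    have := h2 _ _ (mem_tens_top_left_iff.2 fun f => (h1 t f).symm ▸ h f)
    simpa using this

/-- With `q` a projection onto `K`, both `id ⊗ q` and `q ⊗ id` fix `t`; hence so does `q ⊗ q`, whose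
image is `K ⊗ K`. -/
theorem mem_tens_of_mem {K : Submodule k V} {t : V ⊗[k] V} (h1 : t ∈ tens ⊤ K)
    (h2 : t ∈ tens K ⊤) : t ∈ tens K K := by
  obtain ⟨p, hp⟩ := K.exists_isCompl
  let q : V →ₗ[k] V := K.subtype ∘ₗ K.projectionOnto p hp
  have hq : ∀ x ∈ K, q x = x := fun x hx => by
    have := Submodule.projectionOnto_apply_left hp ⟨x, hx⟩
    simp [q, this]
  have hq' : ∀ x, q x ∈ K := fun x => (K.projectionOnto p hp x).2
  have e1 : tens ⊤ K ≤ LinearMap.eqLocus (LinearMap.lTensor V q) LinearMap.id :=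
    tens_le fun a _ b hb => by simp [LinearMap.mem_eqLocus, hq b hb]
  have e2 : tens K ⊤ ≤ LinearMap.eqLocus (LinearMap.rTensor V q) LinearMap.id :=
    tens_le fun a ha b _ => by simp [LinearMap.mem_eqLocus, hq a ha]
  have e3 : LinearMap.lTensor V q (LinearMap.rTensor V q t) = t := by
    have a1 := e1 h1
    have a2 := e2 h2
    rw [LinearMap.mem_eqLocus] at a1 a2
    rw [a2]
    exact a1
  have e4 : ∀ t : V ⊗[k] V, LinearMap.lTensor V q (LinearMap.rTensor V q t) ∈ tens K K := by
    intro t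
    induction t with
    | zero => simp
    | tmul a b => exact tmul_mem_tens (hq' a) (hq' b)
    | add x y hx hy => rw [map_add, map_add]; exact add_mem hx hy
  exact e3 ▸ e4 t

end Slices

/-! ### Bicharacters -/

namespace Bicharacter

variable {k Γ : Type*} [Field k] [AddCommMonoid Γ] (χ : Bicharacter k Γ)

theorem map_zero_left (β : Γ) : χ 0 β = 1 := by
  have := χ.map_add_left 0 0 β
  rw [add_zero] at this
  exact left_eq_mul.1 this

theorem map_zero_right (β : Γ) : χ β 0 = 1 := by
  have := χ.map_add_right β 0 0
  rw [add_zero] at this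
  exact left_eq_mul.1 this

end Bicharacter

/-- The bicharacter of the braiding used in commutators. -/
def Side.bichar {k Γ : Type*} [Field k] [AddCommMonoid Γ] (χ : Bicharacter k Γ) :
    Side → Bicharacter k Γ
  | .left => χ
  | .right =>
    { toFun := fun α β => (χ β α)⁻¹
      map_add_left := fun α β γ => by rw [χ.map_add_right, mul_inv]
      map_add_right := fun α β γ => by rw [χ.map_add_left, mul_inv] }

/-! ### Slices of the comultiplication -/

section Coalgebra

variable {k R : Type*} [Field k] [Ring R] [Algebra k R] [Coalgebra k R]

open Coalgebra in
/-- `(f ⊗ id) ∘ Δ`. -/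
noncomputable def hitL (f : R →ₗ[k] k) : R →ₗ[k] R := sliceL f ∘ₗ comul

open Coalgebra in
/-- `(id ⊗ f) ∘ Δ`. -/
noncomputable def hitR (f : R →ₗ[k] k) : R →ₗ[k] R := sliceR f ∘ₗ comul

open Coalgebra

@[simp] theorem hitL_counit (x : R) : hitL (counit (R := k)) x = x := by
  simp [hitL, sliceL]

@[simp] theorem hitR_counit (x : R) : hitR (counit (R := k)) x = x := by
  simp [hitR, sliceR]

/-- This is coassociativity: both sides apply `f` and `g` to the outer legs of the iterated
comultiplication. It makes the kernel of `hitR g` stable under every `hitL f`, and conversely. -/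
theorem hitL_hitR (f g : R →ₗ[k] k) (x : R) : hitL f (hitR g x) = hitR g (hitL f x) := by
  let G : (R ⊗[k] R) ⊗[k] R →ₗ[k] R := sliceL f ∘ₗ
    (TensorProduct.rid k (R ⊗[k] R)).toLinearMap ∘ₗ LinearMap.lTensor (R ⊗[k] R) g
  let G' : R ⊗[k] (R ⊗[k] R) →ₗ[k] R := sliceR g ∘ₗ
    (TensorProduct.lid k (R ⊗[k] R)).toLinearMap ∘ₗ LinearMap.rTensor (R ⊗[k] R) f
  have hG : G = G' ∘ₗ (TensorProduct.assoc k R R R).toLinearMap := by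
    ext a b c
    simp [G, G', smul_smul, mul_comm]
  have h1 : sliceL f ∘ₗ comul ∘ₗ sliceR g = G ∘ₗ LinearMap.rTensor R (comul (R := k)) := by
    ext a b
    simp [G]
  have h2 : sliceR g ∘ₗ comul ∘ₗ sliceL f = G' ∘ₗ LinearMap.lTensor R (comul (R := k)) := by
    ext a b
    simp [G']
  have h3 := LinearMap.congr_fun h1 (comul x)
  have h4 := LinearMap.congr_fun h2 (comul x)
  have h5 := Coalgebra.coassoc_apply (R := k) x
  rw [hG] at h3
  simp only [LinearMap.comp_apply, LinearEquiv.coe_coe] at h3 h4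
  rw [h5] at h3
  exact h3.trans h4.symm

theorem counit_hitR (f : R →ₗ[k] k) (x : R) : counit (R := k) (hitR f x) = f x := by
  have h : ∀ t : R ⊗[k] R, counit (R := k) (sliceR f t) = f (sliceL counit t) := fun t => by
    induction t with
    | zero => simp
    | tmul a b => simp [mul_comm]
    | add x y hx hy => simp only [map_add, hx, hy]
  have := h (comul x)
  exact this.trans (congrArg f (hitL_counit x))

theorem counit_hitL (f : R →ₗ[k] k) (x : R) : counit (R := k) (hitL f x) = f x := by
  have h : ∀ t : R ⊗[k] R, counit (R := k) (sliceL f t) = f (sliceR counit t) := fun t => by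
    induction t with
    | zero => simp
    | tmul a b => simp [mul_comm]
    | add x y hx hy => simp only [map_add, hx, hy]
  have := h (comul x)
  exact this.trans (congrArg f (hitR_counit x))

theorem isCoideal_left_iff {K : Submodule k R} :
    IsCoideal .left K ↔ ∀ x ∈ K, ∀ f : R →ₗ[k] k, hitL f x ∈ K := by
  rw [IsCoideal, Submodule.map_le_iff_le_comap]
  exact forall₂_congr fun x _ => mem_tens_top_left_iff

theorem isCoideal_right_iff {K : Submodule k R} :
    IsCoideal .right K ↔ ∀ x ∈ K, ∀ f : R →ₗ[k] k, hitR f x ∈ K := by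
  rw [IsCoideal, Submodule.map_le_iff_le_comap]
  exact forall₂_congr fun x _ => mem_tens_top_right_iff

theorem isSubcoalgebra_iff {K : Submodule k R} :
    IsSubcoalgebra K ↔ IsCoideal .left K ∧ IsCoideal .right K := by
  constructor
  · exact fun h => ⟨h.trans (tens_mono le_top le_rfl), h.trans (tens_mono le_rfl le_top)⟩
  · intro h x hx
    exact mem_tens_of_mem (h.1 hx) (h.2 hx)

end Coalgebra

/-! ### Braided bialgebras with a braiding induced by a bicharacter -/

section Bialgebra

open Coalgebra

variable {k R Γ : Type*} [Field k] [Ring R] [Algebra k R] [Coalgebra k R] [AddCommMonoid Γ]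
  [DecidableEq Γ] {𝒜 : Γ → Submodule k R} [GradedAlgebra 𝒜] {τ : R ⊗[k] R ≃ₗ[k] R ⊗[k] R}
  {χ : Bicharacter k Γ}

omit [Coalgebra k R] [DecidableEq Γ] [GradedAlgebra 𝒜] in
theorem braidedMul_tmul (hχ : IsInducedBraiding χ 𝒜 τ) {α β : Γ} (a : R) {b a' : R} (b' : R)
    (hb : b ∈ 𝒜 β) (ha' : a' ∈ 𝒜 α) :
    braidedMul τ ((a ⊗ₜ b) ⊗ₜ (a' ⊗ₜ b')) = (χ β α : k) • ((a * a') ⊗ₜ (b * b')) := by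
  simp [braidedMul, hχ β α b hb a' ha', TensorProduct.smul_tmul', TensorProduct.tmul_smul]

omit [Coalgebra k R] in
/-- To prove a statement about `s * t` in `R ⊗^τ R` with `s ∈ P ⊗ Q`, `t ∈ P' ⊗ Q'`, where `Q` and
`P'` are homogeneous, one may assume that `s` and `t` are tensors of homogeneous elements. -/
theorem tens_bilinear_ext {M : Type*} [AddCommGroup M] [Module k M] {P Q P' Q' : Submodule k R}
    (hQ : ∀ γ, ∀ x ∈ Q, GradedAlgebra.proj 𝒜 γ x ∈ Q)
    (hP' : ∀ γ, ∀ x ∈ P', GradedAlgebra.proj 𝒜 γ x ∈ P')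
    (F : (R ⊗[k] R) →ₗ[k] (R ⊗[k] R) →ₗ[k] M) (S : Submodule k M)
    (h : ∀ α β, ∀ a ∈ P, ∀ b ∈ Q, b ∈ 𝒜 β → ∀ a' ∈ P', a' ∈ 𝒜 α → ∀ b' ∈ Q',
      F (a ⊗ₜ b) (a' ⊗ₜ b') ∈ S) {s t : R ⊗[k] R} (hs : s ∈ tens P Q) (ht : t ∈ tens P' Q') :
    F s t ∈ S := by
  have h1 : tens P Q ≤ S.comap (F.flip t) := tens_le fun a ha b hb => by
    have h2 : tens P' Q' ≤ S.comap (F (a ⊗ₜ b)) := tens_le fun a' ha' b' hb' => by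
      obtain ⟨s, hs⟩ := exists_sum_proj 𝒜 b
      obtain ⟨t, ht⟩ := exists_sum_proj 𝒜 a'
      rw [Submodule.mem_comap, ← hs, ← ht, TensorProduct.tmul_sum, TensorProduct.sum_tmul]
      simp only [map_sum, LinearMap.sum_apply]
      exact sum_mem fun i _ => sum_mem fun j _ =>
        h _ _ a ha _ (hQ _ b hb) (proj_mem 𝒜 _ b) _ (hP' _ a' ha') (proj_mem 𝒜 _ a') b' hb'
    exact h2 ht
  exact h1 hs

/-- The braiding only flips homogeneous tensors and rescales them, so `R ⊗ K` is closed under the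
braided multiplication as soon as `K` is a homogeneous subalgebra. It is therefore enough to test
the generators. -/
theorem isCoideal_left_adjoin (hR : IsBraidedBialgebra τ) (hχ : IsInducedBraiding χ 𝒜 τ)
    {S : Set R} (hhom : IsHom 𝒜 (Algebra.adjoin k S))
    (hS : ∀ x ∈ S, comul (R := k) x ∈ tens ⊤ (Subalgebra.toSubmodule (Algebra.adjoin k S))) :
    IsCoideal .left (Subalgebra.toSubmodule (Algebra.adjoin k S)) := by
  rw [IsCoideal, Submodule.map_le_iff_le_comap]
  intro x hx
  rw [Submodule.mem_comap]
  rw [Subalgebra.mem_toSubmodule] at hx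
  have h1 : comul (R := k) (1 : R) ∈ tens ⊤ (Subalgebra.toSubmodule (Algebra.adjoin k S)) := by
    rw [hR.comul_one]
    exact tmul_mem_tens Submodule.mem_top (one_mem (Algebra.adjoin k S))
  induction hx using Algebra.adjoin_induction with
  | mem x hx => exact hS x hx
  | algebraMap r =>
    rw [Algebra.algebraMap_eq_smul_one, map_smul]
    exact Submodule.smul_mem _ _ h1
  | add x y _ _ hx hy => rw [map_add]; exact add_mem hx hy
  | mul x y _ _ hx hy =>
    rw [hR.comul_mul]
    refine tens_bilinear_ext (𝒜 := 𝒜) (P := ⊤)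
      (Q := Subalgebra.toSubmodule (Algebra.adjoin k S)) (P' := ⊤)
      (Q' := Subalgebra.toSubmodule (Algebra.adjoin k S)) hhom (fun _ _ _ => Submodule.mem_top)
      ((TensorProduct.mk k _ _).compr₂ (braidedMul τ)) _ ?_ hx hy
    intro α β a _ b hb hbβ a' _ ha' b' hb'
    rw [LinearMap.compr₂_apply, TensorProduct.mk_apply, braidedMul_tmul hχ a b' hbβ ha']
    exact Submodule.smul_mem _ _ (tmul_mem_tens Submodule.mem_top (mul_mem (S := Subalgebra k R) hb hb'))

theorem isCoideal_right_adjoin (hR : IsBraidedBialgebra τ) (hχ : IsInducedBraiding χ 𝒜 τ)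
    {S : Set R} (hhom : IsHom 𝒜 (Algebra.adjoin k S))
    (hS : ∀ x ∈ S, comul (R := k) x ∈ tens (Subalgebra.toSubmodule (Algebra.adjoin k S)) ⊤) :
    IsCoideal .right (Subalgebra.toSubmodule (Algebra.adjoin k S)) := by
  rw [IsCoideal, Submodule.map_le_iff_le_comap]
  intro x hx
  rw [Submodule.mem_comap]
  rw [Subalgebra.mem_toSubmodule] at hx
  have h1 : comul (R := k) (1 : R) ∈ tens (Subalgebra.toSubmodule (Algebra.adjoin k S)) ⊤ := by
    rw [hR.comul_one]
    exact tmul_mem_tens (one_mem (Algebra.adjoin k S)) Submodule.mem_top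
  induction hx using Algebra.adjoin_induction with
  | mem x hx => exact hS x hx
  | algebraMap r =>
    rw [Algebra.algebraMap_eq_smul_one, map_smul]
    exact Submodule.smul_mem _ _ h1
  | add x y _ _ hx hy => rw [map_add]; exact add_mem hx hy
  | mul x y _ _ hx hy =>
    rw [hR.comul_mul]
    refine tens_bilinear_ext (𝒜 := 𝒜) (P := Subalgebra.toSubmodule (Algebra.adjoin k S))
      (Q := ⊤) (P' := Subalgebra.toSubmodule (Algebra.adjoin k S)) (Q' := ⊤)
      (fun _ _ _ => Submodule.mem_top) hhom
      ((TensorProduct.mk k _ _).compr₂ (braidedMul τ)) _ ?_ hx hy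
    intro α β a ha b _ hbβ a' ha' haα b' _
    rw [LinearMap.compr₂_apply, TensorProduct.mk_apply, braidedMul_tmul hχ a b' hbβ haα]
    exact Submodule.smul_mem _ _ (tmul_mem_tens (mul_mem (S := Subalgebra k R) ha ha') Submodule.mem_top)

theorem eq_counit_smul_one (hR : IsBraidedBialgebra τ) (hconn : IsConnectedGrading 𝒜) {a : R}
    (ha : a ∈ 𝒜 0) : a = counit (R := k) a • (1 : R) := by
  have h1 : (1 : R) ∈ 𝒜 0 := SetLike.one_mem_graded 𝒜
  have hne : (⟨1, h1⟩ : 𝒜 0) ≠ 0 := by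
    intro h
    have h2 : (1 : R) = 0 := congrArg Subtype.val h
    have := hR.counit_one
    rw [h2, map_zero] at this
    exact zero_ne_one this
  obtain ⟨c, hc⟩ := (finrank_eq_one_iff_of_nonzero' _ hne).1 hconn ⟨a, ha⟩
  have hc' : c • (1 : R) = a := congrArg Subtype.val hc
  rw [← hc', map_smul, hR.counit_one, smul_eq_mul, mul_one]

theorem comul_mem_of_graded (hR : IsGradedBraidedBialgebra 𝒜 τ) {M : Submodule k (R ⊗[k] R)}
    {γ : Γ} (h : ∀ α β, α + β = γ → ∀ a ∈ 𝒜 α, ∀ b ∈ 𝒜 β, a ⊗ₜ[k] b ∈ M) {x : R} (hx : x ∈ 𝒜 γ) :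
    comul (R := k) x ∈ M := by
  have h1 := hR.comul_graded γ (Submodule.mem_map_of_mem hx)
  refine (iSup_le ?_ : (⨆ p : {p : Γ × Γ // p.1 + p.2 = γ}, tens (𝒜 p.1.1) (𝒜 p.1.2)) ≤ M) h1
  exact fun p => tens_le fun a ha b hb => h _ _ p.2 a ha b hb

/-- The hypothesis on `δ` leaves only the component of `Δ x` in `R₀ ⊗ R_δ`. As `R₀` is spanned by
`1`, there `f` equals `f 1` times the counit, and slicing with the counit returns `x`. -/
theorem proj_hitL (hR : IsGradedBraidedBialgebra 𝒜 τ) (hconn : IsConnectedGrading 𝒜)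
    (f : R →ₗ[k] k) {γ δ : Γ} {x : R} (hx : x ∈ 𝒜 γ) (hδ : ∀ α, α + δ = γ → α = 0) :
    GradedAlgebra.proj 𝒜 δ (hitL f x) = f 1 • GradedAlgebra.proj 𝒜 δ x := by
  have := comul_mem_of_graded hR (M := LinearMap.eqLocus (GradedAlgebra.proj 𝒜 δ ∘ₗ sliceL f)
    (f 1 • (GradedAlgebra.proj 𝒜 δ ∘ₗ sliceL counit))) (fun α β h a ha b hb => ?_) hx
  · rw [LinearMap.mem_eqLocus] at this
    exact this.trans (by
      rw [LinearMap.smul_apply, LinearMap.comp_apply]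
      exact congrArg (fun y => f 1 • GradedAlgebra.proj 𝒜 δ y) (hitL_counit x))
  · simp only [LinearMap.mem_eqLocus, LinearMap.comp_apply, sliceL_tmul, LinearMap.smul_apply,
      map_smul]
    by_cases h' : β = δ
    · subst h'
      obtain rfl := hδ α h
      have := eq_counit_smul_one hR.braidedBialgebra hconn ha
      rw [this, map_smul, map_smul, hR.braidedBialgebra.counit_one]
      simp only [smul_smul, smul_eq_mul, mul_one]
      rw [mul_comm]
    · rw [proj_ne hb h', smul_zero, smul_zero, smul_zero]

theorem proj_hitR (hR : IsGradedBraidedBialgebra 𝒜 τ) (hconn : IsConnectedGrading 𝒜)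
    (f : R →ₗ[k] k) {γ δ : Γ} {x : R} (hx : x ∈ 𝒜 γ) (hδ : ∀ α, α + δ = γ → α = 0) :
    GradedAlgebra.proj 𝒜 δ (hitR f x) = f 1 • GradedAlgebra.proj 𝒜 δ x := by
  have := comul_mem_of_graded hR (M := LinearMap.eqLocus (GradedAlgebra.proj 𝒜 δ ∘ₗ sliceR f)
    (f 1 • (GradedAlgebra.proj 𝒜 δ ∘ₗ sliceR counit))) (fun α β h a ha b hb => ?_) hx
  · rw [LinearMap.mem_eqLocus] at this
    exact this.trans (by
      rw [LinearMap.smul_apply, LinearMap.comp_apply]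
      exact congrArg (fun y => f 1 • GradedAlgebra.proj 𝒜 δ y) (hitR_counit x))
  · simp only [LinearMap.mem_eqLocus, LinearMap.comp_apply, sliceR_tmul, LinearMap.smul_apply,
      map_smul]
    by_cases h' : α = δ
    · subst h'
      rw [add_comm] at h
      obtain rfl := hδ β h
      have := eq_counit_smul_one hR.braidedBialgebra hconn hb
      rw [this, map_smul, map_smul, hR.braidedBialgebra.counit_one]
      simp only [smul_smul, smul_eq_mul, mul_one]
      rw [mul_comm]
    · rw [proj_ne ha h', smul_zero, smul_zero, smul_zero]

end Bialgebra

/-! ### Skew derivations -/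

/-- The condition on the height `n` of a generator whose degree has self-braiding `a`. -/
def HeightCondition {k : Type*} [Field k] (a : kˣ) (n : ℕ) : Prop :=
  IsOfFinOrder a ∧ (CharZero k → orderOf a = n ∧ a ≠ 1) ∧
    ∀ p : ℕ, p.Prime → CharP k p → ∃ e : ℕ, orderOf a * p ^ e = n

/-- The height of a generator is the least `n ≥ 2` with `1 + a + ⋯ + a ^ (n - 1) = 0`. -/
theorem exists_height {k : Type*} [Field k] (a : kˣ) : ∃ h : ℕ∞, 2 ≤ h ∧
    (∀ n : ℕ, (n : ℕ∞) < h → 1 ≤ n → ∑ i ∈ Finset.range n, (a : k) ^ i ≠ 0) ∧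
    ∀ n : ℕ, h = n → ∑ i ∈ Finset.range n, (a : k) ^ i = 0 ∧ HeightCondition a n := by
  classical
  -- The height is the least positive `n` whose quantum integer vanishes, and `⊤` if there is none.
  -- It is at least `2` because the sum for `n = 1` is `1`.
  by_cases H : ∃ n : ℕ, 1 ≤ n ∧ ∑ i ∈ Finset.range n, (a : k) ^ i = 0
  · obtain ⟨h1, h0⟩ := Nat.find_spec H
    have hmin : ∀ m, 1 ≤ m → ∑ i ∈ Finset.range m, (a : k) ^ i = 0 → Nat.find H ≤ m :=
      fun m h1 h2 => Nat.find_min' H ⟨h1, h2⟩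
    generalize Nat.find H = n at h1 h0 hmin
    have hn2 : 2 ≤ n := by
      by_contra hlt
      obtain rfl : n = 1 := by omega
      simp at h0
    refine ⟨n, by exact_mod_cast hn2, fun m hm h1m h0m => ?_, fun m hm => ?_⟩
    · have := hmin m h1m h0m
      have : m < n := by exact_mod_cast hm
      omega
    · obtain rfl : n = m := by exact_mod_cast hm
      refine ⟨h0, ?_⟩
      have hpow : a ^ n = 1 := by
        have := mul_geom_sum (a : k) n
        rw [h0, mul_zero] at this
        ext
        push_cast
        exact (sub_eq_zero.1 this.symm)
      have hfin : IsOfFinOrder a := isOfFinOrder_iff_pow_eq_one.2 ⟨n, by omega, hpow⟩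
      have hne : a ≠ 1 → orderOf a = n := by
        intro ha
        refine le_antisymm (orderOf_le_of_pow_eq_one (by omega) hpow) ?_
        refine hmin _ (orderOf_pos_iff.2 hfin) ?_
        have := mul_geom_sum (a : k) (orderOf a)
        have h2 : (a : k) ^ orderOf a = 1 := by
          rw [← Units.val_pow_eq_pow_val, pow_orderOf_eq_one, Units.val_one]
        rw [h2, sub_self, mul_eq_zero] at this
        exact this.resolve_left (sub_ne_zero.2 fun h => ha (Units.ext h))
      refine ⟨hfin, fun hc => ?_, fun p hp hc => ?_⟩
      · have ha : a ≠ 1 := by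
          rintro rfl
          simp only [Units.val_one, one_pow, Finset.sum_const, Finset.card_range, nsmul_eq_mul,
            mul_one, Nat.cast_eq_zero] at h0
          omega
        exact ⟨hne ha, ha⟩
      -- For `a = 1` the sum is `n` itself, so the height is `p` and the exponent is `1`. Otherwise
      -- the geometric sum first vanishes at the order of `a`, and the exponent is `0`.
      · by_cases ha : a = 1
        · subst ha
          refine ⟨1, ?_⟩
          simp only [Units.val_one, one_pow, Finset.sum_const, Finset.card_range, nsmul_eq_mul,
            mul_one] at h0 hmin
          rw [orderOf_one, one_mul, pow_one]
          refine le_antisymm (Nat.le_of_dvd (by omega) ((CharP.cast_eq_zero_iff k p n).1 h0)) ?_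
          exact hmin p hp.one_lt.le (CharP.cast_eq_zero k p)
        · exact ⟨0, by rw [pow_zero, mul_one, hne ha]⟩
  · push Not at H
    exact ⟨⊤, le_top, fun n _ h1 => H n h1, fun n hn => absurd hn.symm (ENat.natCast_ne_top n)⟩

section SkewDerivation

variable {k R Γ : Type*} [Field k] [Ring R] [Algebra k R] [AddCommMonoid Γ] [DecidableEq Γ]

/-- The span of the `u * z ^ i` with `u ∈ E` and `i < n`. -/
def powSpan (E : Subalgebra k R) (z : R) (n : ℕ) : Submodule k R :=
  Submodule.span k {x | ∃ u ∈ E, ∃ i < n, x = u * z ^ i}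

theorem mul_pow_mem_powSpan {E : Subalgebra k R} {z u : R} {i n : ℕ} (hu : u ∈ E) (hi : i < n) :
    u * z ^ i ∈ powSpan E z n := Submodule.subset_span ⟨u, hu, i, hi, rfl⟩

theorem powSpan_mono (E : Subalgebra k R) (z : R) {m n : ℕ} (h : m ≤ n) :
    powSpan E z m ≤ powSpan E z n := by
  refine Submodule.span_le.2 ?_
  rintro _ ⟨u, hu, i, hi, rfl⟩
  exact mul_pow_mem_powSpan hu (hi.trans_le h)

theorem mul_mem_powSpan {E : Subalgebra k R} {z u x : R} {n : ℕ} (hu : u ∈ E)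
    (hx : x ∈ powSpan E z n) : u * x ∈ powSpan E z n := by
  have : powSpan E z n ≤ (powSpan E z n).comap (LinearMap.mulLeft k u) := by
    refine Submodule.span_le.2 ?_
    rintro _ ⟨v, hv, i, hi, rfl⟩
    change u * (v * z ^ i) ∈ powSpan E z n
    rw [← mul_assoc]
    exact mul_pow_mem_powSpan (mul_mem hu hv) hi
  exact this hx

theorem powSpan_zero (E : Subalgebra k R) (z : R) : powSpan E z 0 = ⊥ := by
  rw [powSpan, Submodule.span_eq_bot]
  rintro _ ⟨u, _, i, hi, _⟩
  exact absurd hi (Nat.not_lt_zero i)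

theorem exists_of_mem_powSpan_succ {E : Subalgebra k R} {z x : R} {n : ℕ}
    (hx : x ∈ powSpan E z (n + 1)) : ∃ u ∈ E, x - u * z ^ n ∈ powSpan E z n := by
  refine Submodule.span_induction ?_ ⟨0, zero_mem _, by simp⟩ ?_ ?_ hx
  · rintro _ ⟨u, hu, i, hi, rfl⟩
    rcases (Nat.lt_succ_iff.1 hi).eq_or_lt with rfl | h
    · exact ⟨u, hu, by simp⟩
    · exact ⟨0, zero_mem _, by simpa using mul_pow_mem_powSpan hu h⟩
  · rintro x y _ _ ⟨u, hu, hxu⟩ ⟨v, hv, hyv⟩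
    refine ⟨u + v, add_mem hu hv, ?_⟩
    rw [add_mul, add_sub_add_comm]
    exact add_mem hxu hyv
  · rintro c x _ ⟨u, hu, hxu⟩
    refine ⟨c • u, E.smul_mem hu c, ?_⟩
    rw [smul_mul_assoc, ← smul_sub]
    exact Submodule.smul_mem _ c hxu

variable (𝒜 : Γ → Submodule k R) (ψ : Bicharacter k Γ)

/-- `D` is obtained from `E` by adjoining a homogeneous generator `z` of degree `γ` and
height `h` that normalizes `E`, and is free over `E` on the powers `z ^ i`, `i < h`. -/
structure NiceStep (E D : Subalgebra k R) (z : R) (γ : Γ) (h : ℕ∞) : Prop where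
  mem_deg : z ∈ 𝒜 γ
  deg_ne : γ ≠ 0
  eq_extend : D = extend E z
  comm : ∀ β, ∀ e ∈ E, e ∈ 𝒜 β → z * e - (ψ γ β : k) • (e * z) ∈ E
  two_le : 2 ≤ h
  pow_mem : ∀ n : ℕ, h = n → z ^ n ∈ E
  eq_zero : ∀ n : ℕ, (n : ℕ∞) < h → ∀ u ∈ E, u * z ^ n ∈ powSpan E z n → u = 0
  height : ∀ n : ℕ, h = n → HeightCondition (ψ γ γ) n

variable [GradedAlgebra 𝒜]

/-- `∂` is a skew derivation of degree `-γ` on the subalgebra `D`. -/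
structure IsSkewDer (D : Subalgebra k R) (γ : Γ) (d : R →ₗ[k] R) : Prop where
  mul : ∀ x ∈ D, ∀ y ∈ D, d (x * y) = d x * scale 𝒜 (fun β => (ψ γ β : k)) y + x * d y
  graded : ∀ α β, α ≠ β + γ → ∀ x ∈ 𝒜 α, GradedAlgebra.proj 𝒜 β (d x) = 0

namespace IsSkewDer

variable {𝒜 ψ} {D : Subalgebra k R} {γ : Γ} {d : R →ₗ[k] R} (hd : IsSkewDer 𝒜 ψ D γ d)
include hd

theorem map_one : d 1 = 0 := by
  have h := hd.mul 1 (one_mem D) 1 (one_mem D)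
  rw [scale_of_mem _ (SetLike.one_mem_graded 𝒜 : (1 : R) ∈ 𝒜 0), ψ.map_zero_right] at h
  simpa using h

theorem proj_comm [IsCancelAdd Γ] (β : Γ) (x : R) :
    GradedAlgebra.proj 𝒜 β (d x) = d (GradedAlgebra.proj 𝒜 (β + γ) x) := by
  refine graded_induction (𝒜 := 𝒜) (p := fun x => GradedAlgebra.proj 𝒜 β (d x) =
    d (GradedAlgebra.proj 𝒜 (β + γ) x)) (by simp) (fun u v hu hv => ?_) (fun α x hx => ?_) x
  · simp only [map_add, hu, hv]
  · by_cases h : α = β + γ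
    · subst h
      rw [proj_same hx]
      refine proj_same (mem_of_proj_mem (𝒜 := 𝒜) (𝒜 β) fun δ => ?_)
      by_cases hδ : β = δ
      · subst hδ; exact proj_mem 𝒜 _ _
      · rw [hd.graded _ δ (fun e => hδ (add_right_cancel e)) x hx]
        exact zero_mem _
    · rw [hd.graded α β h x hx, proj_ne hx h, map_zero]

/-- The constants of a skew derivation form a homogeneous subalgebra. -/
theorem exists_ker [IsCancelAdd Γ] (hD : IsHom 𝒜 D) :
    ∃ E : Subalgebra k R, IsHom 𝒜 E ∧ ∀ x, x ∈ E ↔ x ∈ D ∧ d x = 0 := by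
  refine ⟨{ carrier := {x | x ∈ D ∧ d x = 0}
            mul_mem' := fun {x y} hx hy => ⟨mul_mem hx.1 hy.1, ?_⟩
            add_mem' := fun {x y} hx hy => ⟨add_mem hx.1 hy.1, by rw [map_add, hx.2, hy.2, add_zero]⟩
            algebraMap_mem' := fun r => ⟨D.algebraMap_mem r, ?_⟩ }, ?_, fun x => Iff.rfl⟩
  · rw [hd.mul x hx.1 y hy.1, hx.2, hy.2, zero_mul, mul_zero, add_zero]
  · rw [Algebra.algebraMap_eq_smul_one, map_smul, hd.map_one, smul_zero]
  · intro δ x hx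
    refine ⟨hD δ x hx.1, ?_⟩
    have hx2 : d x = 0 := hx.2
    -- Subtraction is not available in `Γ`: a degree that is not of the form `β + γ` is killed
    -- outright, since `d` lowers degrees by `γ`.
    by_cases h : ∃ β, δ = β + γ
    · obtain ⟨β, rfl⟩ := h
      rw [← hd.proj_comm, hx2, map_zero]
    · push Not at h
      exact eq_zero_of_proj (𝒜 := 𝒜) fun β => hd.graded δ β (h β) _ (proj_mem 𝒜 δ x)

/-- Skew derivations on `C[z]` that kill `C` and map `z` to `1` coincide. -/
theorem eq_of_extend {d' : R →ₗ[k] R} (hd' : IsSkewDer 𝒜 ψ D γ d') {C : Subalgebra k R} {z : R}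
    (hD : D = extend C z) (hC : ∀ x ∈ C, d x = 0) (hC' : ∀ x ∈ C, d' x = 0) (hz : d z = 1)
    (hz' : d' z = 1) {x : R} (hx : x ∈ D) : d x = d' x := by
  rw [hD, extend] at hx
  induction hx using Algebra.adjoin_induction with
  | mem x hx =>
    rcases hx with rfl | hx
    · rw [hz, hz']
    · rw [hC x hx, hC' x hx]
  | algebraMap r =>
    rw [Algebra.algebraMap_eq_smul_one, map_smul, map_smul, hd.map_one, hd'.map_one]
  | add x y _ _ hx hy => rw [map_add, map_add, hx, hy]
  | mul x y h1 h2 hx hy =>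
    have h1' : x ∈ D := by rw [hD]; exact h1
    have h2' : y ∈ D := by rw [hD]; exact h2
    rw [hd.mul x h1' y h2', hd'.mul x h1' y h2', hx, hy]

/-- The twist multiplies `z` by `ψ γ γ`, so the Leibniz rule produces a quantum integer in place of
the usual factor `n + 1`. -/
theorem map_pow {z : R} (hzD : z ∈ D) (hz : z ∈ 𝒜 γ) (hz1 : d z = 1) (n : ℕ) :
    d (z ^ (n + 1)) = (∑ i ∈ Finset.range (n + 1), (ψ γ γ : k) ^ i) • z ^ n := by
  induction n with
  | zero => simp [hz1]
  | succ n ih =>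
    rw [pow_succ, hd.mul _ (pow_mem hzD _) _ hzD, ih, hz1, scale_of_mem _ hz, mul_one,
      smul_mul_smul_comm, ← pow_succ, geom_sum_succ (n := n + 1), add_smul, one_smul,
      mul_comm]

/-- For `e ∈ E` of degree `β` one gets `d (z * e) = ψ γ β • e` and `d (e * z) = e`, so the braided
commutator lies in the kernel `E`. The power `z ^ h` is killed because its quantum integer vanishes,
and freeness follows by differentiating a relation. -/
theorem exists_niceStep [IsCancelAdd Γ] {C E : Subalgebra k R} {z : R}
    (hE : ∀ x, x ∈ E ↔ x ∈ D ∧ d x = 0) (hD : D = extend C z) (hC : ∀ x ∈ C, d x = 0)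
    (hz : z ∈ 𝒜 γ) (hz1 : d z = 1) (hγ : γ ≠ 0) : ∃ h, NiceStep 𝒜 ψ E D z γ h := by
  obtain ⟨h, h2, hne, hh⟩ := exists_height (ψ γ γ)
  have hzD : z ∈ D := hD ▸ self_mem_extend C z
  have hCD : C ≤ D := hD ▸ le_extend C z
  have hCE : C ≤ E := fun x hx => (hE x).2 ⟨hCD hx, hC x hx⟩
  have hED : E ≤ D := fun x hx => ((hE x).1 hx).1
  have hdE : ∀ n, ∀ u ∈ E, d (u * z ^ (n + 1)) =
      (∑ i ∈ Finset.range (n + 1), (ψ γ γ : k) ^ i) • (u * z ^ n) := fun n u hu => by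
    rw [hd.mul u (hED hu) _ (pow_mem hzD _), ((hE u).1 hu).2, zero_mul, zero_add,
      hd.map_pow hzD hz hz1, mul_smul_comm]
  have hdspan : ∀ n, ∀ x ∈ powSpan E z (n + 1), d x ∈ powSpan E z n := by
    intro n
    have : powSpan E z (n + 1) ≤ (powSpan E z n).comap d := by
      refine Submodule.span_le.2 ?_
      rintro _ ⟨u, hu, i, hi, rfl⟩
      change d (u * z ^ i) ∈ powSpan E z n
      rcases i with _ | i
      · rw [pow_zero, mul_one, ((hE u).1 hu).2]
        exact zero_mem _
      · rw [hdE i u hu]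
        exact Submodule.smul_mem _ _ (mul_pow_mem_powSpan hu (by omega))
    exact this
  refine ⟨h, hz, hγ, le_antisymm ?_ ?_, ?_, h2, ?_, ?_, fun n hn => (hh n hn).2⟩
  · rw [hD]
    exact extend_le (hCE.trans (le_extend E z)) (self_mem_extend E z)
  · exact extend_le hED hzD
  · intro β e he heβ
    refine (hE _).2 ⟨sub_mem (mul_mem hzD (hED he)) (D.smul_mem (mul_mem (hED he) hzD) _), ?_⟩
    rw [map_sub, map_smul, hd.mul z hzD e (hED he), hd.mul e (hED he) z hzD, hz1,
      ((hE e).1 he).2, scale_of_mem _ heβ]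
    simp
  · intro n hn
    refine (hE _).2 ⟨pow_mem hzD n, ?_⟩
    rcases n with _ | n
    · rw [pow_zero, hd.map_one]
    · rw [hd.map_pow hzD hz hz1, (hh _ hn).1, zero_smul]
  · intro n
    induction n with
    | zero =>
      intro _ u _ hu
      rwa [powSpan_zero, Submodule.mem_bot, pow_zero, mul_one] at hu
    | succ n ih =>
      intro hn u hu hx
      -- Differentiating lowers the relation by one power and multiplies the leading coefficient by
      -- a quantum integer, which is nonzero below the height.
      have h1 := hdspan n _ hx
      rw [hdE n u hu] at h1
      have h3 := hne (n + 1) hn (by omega)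
      have h4 := (Submodule.smul_mem_iff _ h3).1 h1
      exact ih (lt_trans (by exact_mod_cast Nat.lt_succ_self n) hn) u hu h4

end IsSkewDer

end SkewDerivation

/-! ### Adjoining one homogeneous element, and skew derivations from functionals -/

section Extensions

open Coalgebra

variable {k R Γ : Type*} [Field k] [Ring R] [Algebra k R] [Coalgebra k R] [AddCommMonoid Γ]
  [LinearOrder Γ] {𝒜 : Γ → Submodule k R} [GradedAlgebra 𝒜]
  {τ : R ⊗[k] R ≃ₗ[k] R ⊗[k] R} {χ : Bicharacter k Γ}

variable (𝒜) in
/-- The homogeneous elements of `D` of degree less than `γ` lie in `C`. -/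
def AgreeBelow (C D : Subalgebra k R) (γ : Γ) : Prop :=
  ∀ δ < γ, ∀ x ∈ D, x ∈ 𝒜 δ → x ∈ C

theorem lt_of_add_eq [IsOrderedCancelAddMonoid Γ] (hpos : ∀ γ : Γ, 0 ≤ γ) {α β γ : Γ}
    (h : α + β = γ) (hα : α ≠ 0) : β < γ := by
  rw [← h]
  exact lt_add_of_pos_left β (lt_of_le_of_ne (hpos α) hα.symm)

section Coideals

variable [IsOrderedCancelAddMonoid Γ] (hpos : ∀ γ : Γ, 0 ≤ γ)
  (hR : IsGradedBraidedBialgebra 𝒜 τ) (hconn : IsConnectedGrading 𝒜)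
  {C D : Subalgebra k R} (hD : IsHom 𝒜 D) {γ : Γ} (hCD : AgreeBelow 𝒜 C D γ)
include hpos hR hconn hD hCD

/-- Components of degree below `γ` lie in `D` and hence in `C`. In any other degree only the part of
`Δ y` with left leg in `R₀` contributes, and it cancels. Thus every slice of `y` is a multiple of
`y` modulo `C`, which is why `C[y]` is again a coideal. -/
theorem hitL_sub_mem {y : R} (hy : y ∈ 𝒜 γ) (hyD : y ∈ D) (f : R →ₗ[k] k) (hf : hitL f y ∈ D) :
    hitL f y - f 1 • y ∈ C := by
  refine mem_of_proj_mem (𝒜 := 𝒜) C fun δ => ?_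
  by_cases h : δ < γ
  · exact hCD δ h _ (hD δ _ (sub_mem hf (D.smul_mem hyD _))) (proj_mem 𝒜 δ _)
  · rw [map_sub, map_smul, proj_hitL hR hconn f hy, sub_self]
    · exact zero_mem _
    · intro α hα
      by_contra h'
      exact h (lt_of_add_eq hpos hα h')

theorem hitR_sub_mem {y : R} (hy : y ∈ 𝒜 γ) (hyD : y ∈ D) (f : R →ₗ[k] k) (hf : hitR f y ∈ D) :
    hitR f y - f 1 • y ∈ C := by
  refine mem_of_proj_mem (𝒜 := 𝒜) C fun δ => ?_
  by_cases h : δ < γ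
  · exact hCD δ h _ (hD δ _ (sub_mem hf (D.smul_mem hyD _))) (proj_mem 𝒜 δ _)
  · rw [map_sub, map_smul, proj_hitR hR hconn f hy, sub_self]
    · exact zero_mem _
    · intro α hα
      by_contra h'
      exact h (lt_of_add_eq hpos hα h')

variable (hC : IsHom 𝒜 C) (hχ : IsInducedBraiding χ 𝒜 τ)
include hC hχ

theorem isCoideal_left_extend (hCl : IsCoideal .left (Subalgebra.toSubmodule C))
    (hDl : IsCoideal .left (Subalgebra.toSubmodule D)) {y : R} (hy : y ∈ 𝒜 γ) (hyD : y ∈ D) :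
    IsCoideal .left (Subalgebra.toSubmodule (extend C y)) := by
  refine isCoideal_left_adjoin hR.braidedBialgebra hχ (isHom_extend hC hy) fun x hx => ?_
  rw [mem_tens_top_left_iff]
  intro f
  change hitL f x ∈ extend C y
  rcases hx with rfl | hx
  · rw [← sub_add_cancel (hitL f x) (f 1 • x)]
    exact add_mem (le_extend C x (hitL_sub_mem hpos hR hconn hD hCD hy hyD f
      (isCoideal_left_iff.1 hDl x hyD f))) (Subalgebra.smul_mem _ (self_mem_extend C x) _)
  · exact le_extend C y (isCoideal_left_iff.1 hCl x hx f)

theorem isCoideal_right_extend (hCl : IsCoideal .right (Subalgebra.toSubmodule C))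
    (hDl : IsCoideal .right (Subalgebra.toSubmodule D)) {y : R} (hy : y ∈ 𝒜 γ) (hyD : y ∈ D) :
    IsCoideal .right (Subalgebra.toSubmodule (extend C y)) := by
  refine isCoideal_right_adjoin hR.braidedBialgebra hχ (isHom_extend hC hy) fun x hx => ?_
  rw [mem_tens_top_right_iff]
  intro f
  change hitR f x ∈ extend C y
  rcases hx with rfl | hx
  · rw [← sub_add_cancel (hitR f x) (f 1 • x)]
    exact add_mem (le_extend C x (hitR_sub_mem hpos hR hconn hD hCD hy hyD f
      (isCoideal_right_iff.1 hDl x hyD f))) (Subalgebra.smul_mem _ (self_mem_extend C x) _)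
  · exact le_extend C y (isCoideal_right_iff.1 hCl x hx f)

end Coideals

/-! ### Skew derivations from functionals -/

section Functionals

/-- If both factors have nonzero degree and the degrees add up to `γ`, then each factor has degree
below `γ` and so lies in `C`; `φ` then kills the product, and the counit kills both factors. Factors
of degree `0` are scalars. -/
theorem derivation_on (hR : IsGradedBraidedBialgebra 𝒜 τ) (hconn : IsConnectedGrading 𝒜)
    [IsOrderedCancelAddMonoid Γ] (hpos : ∀ γ : Γ, 0 ≤ γ)
    {C D : Subalgebra k R} (hD : IsHom 𝒜 D) {γ : Γ} (hγ : γ ≠ 0) (hCD : AgreeBelow 𝒜 C D γ)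
    {φ : R →ₗ[k] k} (hφC : ∀ x ∈ C, φ x = 0) (hφ : ∀ α, α ≠ γ → ∀ x ∈ 𝒜 α, φ x = 0)
    {x y : R} (hx : x ∈ D) (hy : y ∈ D) :
    φ (x * y) = φ x * counit (R := k) y + counit (R := k) x * φ y := by
  refine hD.induction (p := fun x => φ (x * y) = φ x * counit (R := k) y +
    counit (R := k) x * φ y) (by simp) (fun u v hu hv => ?_) (fun α x hx hα => ?_) hx
  · simp only [add_mul, map_add, hu, hv]; ring
  refine hD.induction (p := fun y => φ (x * y) = φ x * counit (R := k) y +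
    counit (R := k) x * φ y) (by simp) (fun u v hu hv => ?_) (fun β y hy hβ => ?_) hy
  · simp only [mul_add, map_add, hu, hv]; ring
  by_cases h0 : α = 0
  · subst h0
    have h1 := hφ 0 hγ.symm x hα
    nth_rewrite 1 [eq_counit_smul_one hR.braidedBialgebra hconn hα]
    rw [h1, smul_mul_assoc, one_mul, map_smul, smul_eq_mul]
    ring
  by_cases h0' : β = 0
  · subst h0'
    have h1 := hφ 0 hγ.symm y hβ
    nth_rewrite 1 [eq_counit_smul_one hR.braidedBialgebra hconn hβ]
    rw [h1, mul_smul_comm, mul_one, map_smul, smul_eq_mul]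
    ring
  rw [hR.counit_graded α h0 x hα, hR.counit_graded β h0' y hβ, mul_zero, zero_mul, add_zero]
  by_cases h : α + β = γ
  · refine hφC _ (mul_mem (hCD α ?_ x hx hα) (hCD β (lt_of_add_eq hpos h h0) y hy hβ))
    rw [add_comm] at h
    exact lt_of_add_eq hpos h h0'
  · exact hφ _ h _ (SetLike.mul_mem_graded hα hβ)

variable {D : Subalgebra k R} {γ : Γ} {φ : R →ₗ[k] k}

/-- Apply `id ⊗ φ` to `Δ x * Δ y`. The right legs lie in `D`, where `φ` is an `ε`-derivation, and
the only twist that survives comes from moving a right leg of `x` of degree `γ` past a left leg of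
`y`. -/
theorem isSkewDer_hitR (hR : IsGradedBraidedBialgebra 𝒜 τ) (hχ : IsInducedBraiding χ 𝒜 τ)
    (hD : IsHom 𝒜 D) (hDl : IsCoideal .left (Subalgebra.toSubmodule D))
    (hφD : ∀ x ∈ D, ∀ y ∈ D, φ (x * y) = φ x * counit (R := k) y + counit (R := k) x * φ y)
    (hφ : ∀ α, α ≠ γ → ∀ x ∈ 𝒜 α, φ x = 0) : IsSkewDer 𝒜 χ D γ (hitR φ) := by
  constructor
  · intro x hx y hy
    -- `F` is the defect of the Leibniz rule as a bilinear map in `Δ x` and `Δ y`, so that it can be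
    -- tested on tensors of homogeneous elements.
    let F : (R ⊗[k] R) →ₗ[k] (R ⊗[k] R) →ₗ[k] R :=
      (TensorProduct.mk k _ _).compr₂ (sliceR φ ∘ₗ braidedMul τ) -
      (LinearMap.mul k R).compl₁₂ (sliceR φ)
        (scale 𝒜 (fun β => (χ γ β : k)) ∘ₗ sliceR (counit (R := k))) -
      (LinearMap.mul k R).compl₁₂ (sliceR (counit (R := k))) (sliceR φ)
    have key : F (comul x) (comul y) ∈ (⊥ : Submodule k R) := by
      refine tens_bilinear_ext (𝒜 := 𝒜) (P := ⊤) (Q := Subalgebra.toSubmodule D) (P' := ⊤)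
        (Q' := Subalgebra.toSubmodule D) hD (fun _ _ _ => Submodule.mem_top) F _ ?_
        (hDl (Submodule.mem_map_of_mem hx)) (hDl (Submodule.mem_map_of_mem hy))
      intro α β a _ b hb hbβ a' _ ha' b' hb'
      simp only [F, LinearMap.sub_apply, LinearMap.compr₂_apply, TensorProduct.mk_apply,
        LinearMap.comp_apply, LinearMap.compl₁₂_apply, sliceR_tmul, LinearMap.mul_apply',
        braidedMul_tmul hχ a b' hbβ ha']
      simp only [map_smul, sliceR_tmul, scale_of_mem _ ha', Submodule.mem_bot,
        hφD b hb b' hb', smul_mul_smul_comm, smul_smul, ← sub_smul]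
      have h1 : (χ β α : k) * φ b = φ b * χ γ α := by
        by_cases h : β = γ
        · rw [h, mul_comm]
        · rw [hφ β h b hbβ, mul_zero, zero_mul]
      have h2 : (χ β α : k) * counit (R := k) b = counit (R := k) b := by
        by_cases h : β = 0
        · rw [h, χ.map_zero_left, Units.val_one, one_mul]
        · rw [hR.counit_graded β h b hbβ, mul_zero]
      convert zero_smul k (a * a') using 2
      linear_combination (counit (R := k) b') * h1 + φ b' * h2
    simp only [F, LinearMap.sub_apply, LinearMap.compr₂_apply, TensorProduct.mk_apply,
        LinearMap.comp_apply, LinearMap.compl₁₂_apply, LinearMap.mul_apply', Submodule.mem_bot,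
        ← hR.braidedBialgebra.comul_mul] at key
    have e1 := hitR_counit (k := k) x
    have e2 := hitR_counit (k := k) y
    simp only [hitR, LinearMap.comp_apply] at e1 e2 ⊢
    rw [e1, e2, sub_sub, sub_eq_zero] at key
    exact key
  · intro α β hne x hx
    refine comul_mem_of_graded hR (M := LinearMap.ker (GradedAlgebra.proj 𝒜 β ∘ₗ sliceR φ))
      (fun α' β' h a ha b hb => ?_) hx
    rw [LinearMap.mem_ker, LinearMap.comp_apply, sliceR_tmul, map_smul]
    by_cases h1 : β' = γ
    · rw [proj_ne ha (fun e => hne (by rw [← h, h1, e])), smul_zero]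
    · rw [hφ _ h1 b hb, zero_smul]

/-- By itself `hitL φ` satisfies a Leibniz rule twisted on the left, by the automorphism scaling
degree `β` with `χ β γ`. Composing with the inverse automorphism moves the twist to the right factor
and inverts it, which accounts for `Side.right.bichar χ`. -/
theorem isSkewDer_hitL (hR : IsGradedBraidedBialgebra 𝒜 τ) (hχ : IsInducedBraiding χ 𝒜 τ)
    (hD : IsHom 𝒜 D) (hDl : IsCoideal .right (Subalgebra.toSubmodule D))
    (hφD : ∀ x ∈ D, ∀ y ∈ D, φ (x * y) = φ x * counit (R := k) y + counit (R := k) x * φ y)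
    (hφ : ∀ α, α ≠ γ → ∀ x ∈ 𝒜 α, φ x = 0) :
    IsSkewDer 𝒜 (Side.right.bichar χ) D γ
      (scale 𝒜 (fun β => (((χ β γ)⁻¹ : kˣ) : k)) ∘ₗ hitL φ) := by
  constructor
  · intro x hx y hy
    let F : (R ⊗[k] R) →ₗ[k] (R ⊗[k] R) →ₗ[k] R :=
      (TensorProduct.mk k _ _).compr₂ (sliceL φ ∘ₗ braidedMul τ) -
      (LinearMap.mul k R).compl₁₂ (sliceL φ) (sliceL (counit (R := k))) -
      (LinearMap.mul k R).compl₁₂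
        (scale 𝒜 (fun β => (χ β γ : k)) ∘ₗ sliceL (counit (R := k))) (sliceL φ)
    have key : F (comul x) (comul y) ∈ (⊥ : Submodule k R) := by
      refine tens_bilinear_ext (𝒜 := 𝒜) (P := Subalgebra.toSubmodule D) (Q := ⊤)
        (P' := Subalgebra.toSubmodule D) (Q' := ⊤) (fun _ _ _ => Submodule.mem_top) hD F _ ?_
        (hDl (Submodule.mem_map_of_mem hx)) (hDl (Submodule.mem_map_of_mem hy))
      intro α β a ha b _ hbβ a' ha' haα b' _
      simp only [F, LinearMap.sub_apply, LinearMap.compr₂_apply, TensorProduct.mk_apply,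
        LinearMap.comp_apply, LinearMap.compl₁₂_apply, sliceL_tmul, LinearMap.mul_apply',
        braidedMul_tmul hχ a b' hbβ haα]
      simp only [map_smul, sliceL_tmul, scale_of_mem _ hbβ, Submodule.mem_bot,
        hφD a ha a' ha', smul_mul_smul_comm, smul_smul, ← sub_smul]
      have h1 : (χ β α : k) * φ a' = φ a' * χ β γ := by
        by_cases h : α = γ
        · rw [h, mul_comm]
        · rw [hφ α h a' haα, mul_zero, zero_mul]
      have h2 : (χ β α : k) * counit (R := k) a' = counit (R := k) a' := by
        by_cases h : α = 0
        · rw [h, χ.map_zero_right, Units.val_one, one_mul]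
        · rw [hR.counit_graded α h a' haα, mul_zero]
      convert zero_smul k (b * b') using 2
      linear_combination (counit (R := k) a) * h1 + φ a * h2
    simp only [F, LinearMap.sub_apply, LinearMap.compr₂_apply, TensorProduct.mk_apply,
        LinearMap.comp_apply, LinearMap.compl₁₂_apply, LinearMap.mul_apply', Submodule.mem_bot,
        ← hR.braidedBialgebra.comul_mul] at key
    have e1 := hitL_counit (k := k) x
    have e2 := hitL_counit (k := k) y
    simp only [hitL, LinearMap.comp_apply] at e1 e2 ⊢
    rw [e1, e2, sub_sub, sub_eq_zero] at key
    rw [key, map_add, scale_mul, scale_mul, scale_scale]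
    · rfl
    · exact fun α => by rw [← Units.val_mul, inv_mul_cancel, Units.val_one]
    all_goals
      intro α β
      rw [χ.map_add_left, mul_inv, Units.val_mul]
  · intro α β hne x hx
    rw [LinearMap.comp_apply, ← scale_proj]
    have : GradedAlgebra.proj 𝒜 β (hitL φ x) = 0 := by
      refine comul_mem_of_graded hR (M := LinearMap.ker (GradedAlgebra.proj 𝒜 β ∘ₗ sliceL φ))
        (fun α' β' h a ha b hb => ?_) hx
      rw [LinearMap.mem_ker, LinearMap.comp_apply, sliceL_tmul, map_smul]
      by_cases h1 : α' = γ
      · rw [proj_ne hb (fun e => hne (by rw [← h, h1, e, add_comm])), smul_zero]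
      · rw [hφ _ h1 a ha, zero_smul]
    rw [this, map_zero]

/-- Since `d` lowers degrees by `γ`, the element `d z` lies in `R₀` and is determined by its counit.
-/
theorem IsSkewDer.eq_one_of_counit [IsOrderedCancelAddMonoid Γ] {ψ : Bicharacter k Γ}
    (hR : IsGradedBraidedBialgebra 𝒜 τ)
    (hconn : IsConnectedGrading 𝒜) {d : R →ₗ[k] R} (hd : IsSkewDer 𝒜 ψ D γ d) {z : R}
    (hz : z ∈ 𝒜 γ) (h1 : counit (R := k) (d z) = 1) : d z = 1 := by
  have : d z ∈ 𝒜 0 := mem_of_proj_mem (𝒜 := 𝒜) _ fun β => by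
    by_cases h : β = 0
    · subst h; exact proj_mem 𝒜 _ _
    · rw [hd.graded γ β (fun e => h (by rwa [right_eq_add] at e)) z hz]
      exact zero_mem _
  rw [eq_counit_smul_one hR.braidedBialgebra hconn this, h1, one_smul]

end Functionals

end Extensions

/-! ### Coideal subalgebras, and the elementary step at the top of `C[z]` -/

section Good

open Coalgebra

variable {k R Γ : Type*} [Field k] [Ring R] [Algebra k R] [Coalgebra k R] [AddCommMonoid Γ]
  [LinearOrder Γ] (𝒜 : Γ → Submodule k R) [GradedAlgebra 𝒜]

/-- Homogeneous subalgebras that are left coideals if `pL` holds and right coideals if `pR`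
holds. -/
structure IsGood (pL pR : Prop) (K : Subalgebra k R) : Prop where
  hom : IsHom 𝒜 K
  left : pL → IsCoideal .left (Subalgebra.toSubmodule K)
  right : pR → IsCoideal .right (Subalgebra.toSubmodule K)

variable {𝒜} {pL pR : Prop}

theorem isGood_sInf {S : Set (Subalgebra k R)} (hS : ∀ K ∈ S, IsGood 𝒜 pL pR K) :
    IsGood 𝒜 pL pR (sInf S) := by
  refine ⟨fun γ x hx => ?_, fun h => isCoideal_left_iff.2 fun x hx f => ?_,
    fun h => isCoideal_right_iff.2 fun x hx f => ?_⟩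
  · rw [Algebra.mem_sInf] at hx ⊢
    exact fun K hK => (hS K hK).hom γ x (hx K hK)
  · rw [Subalgebra.mem_toSubmodule, Algebra.mem_sInf] at hx ⊢
    exact fun K hK => isCoideal_left_iff.1 ((hS K hK).left h) x (hx K hK) f
  · rw [Subalgebra.mem_toSubmodule, Algebra.mem_sInf] at hx ⊢
    exact fun K hK => isCoideal_right_iff.1 ((hS K hK).right h) x (hx K hK) f

omit [Coalgebra k R] in
theorem mem_sSup_of_isChain {S : Set (Subalgebra k R)} (hne : S.Nonempty)
    (hS : IsChain (· ≤ ·) S) {x : R} : x ∈ sSup S ↔ ∃ K ∈ S, x ∈ K := by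
  rw [sSup_eq_iSup', ← SetLike.mem_coe]
  have : Nonempty S := hne.to_subtype
  rw [Subalgebra.coe_iSup_of_directed hS.directedOn.directed_val]
  simp

theorem isGood_sSup {S : Set (Subalgebra k R)} (hne : S.Nonempty) (hc : IsChain (· ≤ ·) S)
    (hS : ∀ K ∈ S, IsGood 𝒜 pL pR K) : IsGood 𝒜 pL pR (sSup S) := by
  refine ⟨fun γ x hx => ?_, fun h => isCoideal_left_iff.2 fun x hx f => ?_,
    fun h => isCoideal_right_iff.2 fun x hx f => ?_⟩
  · rw [mem_sSup_of_isChain hne hc] at hx ⊢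
    obtain ⟨K, hK, hx⟩ := hx
    exact ⟨K, hK, (hS K hK).hom γ x hx⟩
  · rw [Subalgebra.mem_toSubmodule, mem_sSup_of_isChain hne hc] at hx ⊢
    obtain ⟨K, hK, hx⟩ := hx
    exact ⟨K, hK, isCoideal_left_iff.1 ((hS K hK).left h) x hx f⟩
  · rw [Subalgebra.mem_toSubmodule, mem_sSup_of_isChain hne hc] at hx ⊢
    obtain ⟨K, hK, hx⟩ := hx
    exact ⟨K, hK, isCoideal_right_iff.1 ((hS K hK).right h) x hx f⟩

variable [IsOrderedCancelAddMonoid Γ] (hpos : ∀ γ : Γ, 0 ≤ γ)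
  {τ : R ⊗[k] R ≃ₗ[k] R ⊗[k] R} {χ : Bicharacter k Γ}
  (hR : IsGradedBraidedBialgebra 𝒜 τ) (hconn : IsConnectedGrading 𝒜)
  {C D : Subalgebra k R} {γ : Γ}
include hpos hR hconn

section Adjoin

variable {w : R} {δ : Γ}

/-- Every element of `C[w]` is, up to `C` and the multiples of `w`, a sum of homogeneous elements
whose degrees are `deg w` plus a nonzero degree. -/
theorem exists_sub_mem_of_mem_extend (hw : w ∈ 𝒜 δ) {x : R} (hx : x ∈ extend C w) :
    ∃ c ∈ C, x - c ∈ Submodule.span k {w} ⊔ ⨆ β : {β : Γ // β ≠ 0}, 𝒜 (δ + β) := by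
  set J : Submodule k R := Submodule.span k {w} ⊔ ⨆ β : {β : Γ // β ≠ 0}, 𝒜 (δ + β) with hJ
  have hwJ : w ∈ J := Submodule.mem_sup_left (Submodule.mem_span_singleton_self w)
  have hβJ : ∀ β, β ≠ 0 → 𝒜 (δ + β) ≤ J := fun β hβ =>
    (le_iSup (fun β : {β : Γ // β ≠ 0} => 𝒜 (δ + β)) ⟨β, hβ⟩).trans le_sup_right
  have hne : ∀ α β : Γ, α ≠ 0 → α + β ≠ 0 := fun α β hα h => hα
    (le_antisymm (h ▸ le_add_of_nonneg_right (hpos β)) (hpos α))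
  -- `J` is a two-sided ideal: factors of degree `0` are scalars, and all others push `w` into
  -- degrees strictly beyond `δ`. So products of elements of `C + J` stay in `C + J`.
  have hl : ∀ r : R, ∀ j ∈ J, r * j ∈ J := by
    intro r
    have : J ≤ J.comap (LinearMap.mulLeft k r) := by
      refine graded_induction (𝒜 := 𝒜) (p := fun r => J ≤ J.comap (LinearMap.mulLeft k r))
        (fun j _ => by simp) (fun u v hu hv j hj => ?_) (fun α u hu => ?_) r
      · have h1 : u * j ∈ J := hu hj
        have h2 : v * j ∈ J := hv hj
        simpa [add_mul] using add_mem h1 h2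
      · by_cases h : α = 0
        · subst h
          intro j hj
          rw [eq_counit_smul_one hR.braidedBialgebra hconn hu]
          simpa using J.smul_mem _ hj
        · rw [hJ, ← hJ, sup_le_iff]
          constructor
          · rw [Submodule.span_singleton_le_iff_mem]
            refine hβJ α h ?_
            rw [add_comm]
            exact SetLike.mul_mem_graded hu hw
          · refine iSup_le fun β y hy => ?_
            refine hβJ (α + β) (hne _ _ h) ?_
            rw [add_left_comm]
            exact SetLike.mul_mem_graded hu hy
    exact fun j hj => this hj
  have hr : ∀ r : R, ∀ j ∈ J, j * r ∈ J := by
    intro r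
    have : J ≤ J.comap (LinearMap.mulRight k r) := by
      refine graded_induction (𝒜 := 𝒜) (p := fun r => J ≤ J.comap (LinearMap.mulRight k r))
        (fun j _ => by simp) (fun u v hu hv j hj => ?_) (fun α u hu => ?_) r
      · have h1 : j * u ∈ J := hu hj
        have h2 : j * v ∈ J := hv hj
        simpa [mul_add] using add_mem h1 h2
      · by_cases h : α = 0
        · subst h
          intro j hj
          rw [eq_counit_smul_one hR.braidedBialgebra hconn hu]
          simpa using J.smul_mem _ hj
        · rw [hJ, ← hJ, sup_le_iff]
          constructor
          · rw [Submodule.span_singleton_le_iff_mem]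
            exact hβJ α h (SetLike.mul_mem_graded hw hu)
          · refine iSup_le fun β y hy => ?_
            refine hβJ (α + β) (hne _ _ h) ?_
            rw [add_comm α, ← add_assoc]
            exact SetLike.mul_mem_graded hy hu
    exact fun j hj => this hj
  rw [extend] at hx
  induction hx using Algebra.adjoin_induction with
  | mem x hx =>
    rcases hx with rfl | hx
    · exact ⟨0, zero_mem _, by simpa using hwJ⟩
    · exact ⟨x, hx, by simp⟩
  | algebraMap r => exact ⟨algebraMap k R r, C.algebraMap_mem r, by simp⟩
  | add x y _ _ hx hy =>
    obtain ⟨c, hc, hx⟩ := hx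
    obtain ⟨c', hc', hy⟩ := hy
    exact ⟨c + c', add_mem hc hc', by rw [add_sub_add_comm]; exact add_mem hx hy⟩
  | mul x y _ _ hx hy =>
    obtain ⟨c, hc, hx⟩ := hx
    obtain ⟨c', hc', hy⟩ := hy
    refine ⟨c * c', mul_mem hc hc', ?_⟩
    have : x * y - c * c' = (x - c) * y + c * (y - c') := by noncomm_ring
    rw [this]
    exact add_mem (hr _ _ hx) (hl _ _ hy)

theorem mem_of_mem_extend_of_ne (hC : IsHom 𝒜 C) (hw : w ∈ 𝒜 δ) {x : R} (hx : x ∈ extend C w)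
    (hxγ : x ∈ 𝒜 γ) (hγ : ∀ β, δ + β ≠ γ) : x ∈ C := by
  obtain ⟨c, hc, h⟩ := exists_sub_mem_of_mem_extend hpos hR hconn hw hx
  have h1 : GradedAlgebra.proj 𝒜 γ (x - c) = 0 := by
    refine (sup_le ?_ (iSup_le ?_) : _ ≤ LinearMap.ker (GradedAlgebra.proj 𝒜 γ)) h
    · rw [Submodule.span_singleton_le_iff_mem]
      exact proj_ne hw (by simpa using hγ 0)
    · exact fun β y hy => proj_ne hy (hγ β)
  rw [map_sub, proj_same hxγ, sub_eq_zero] at h1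
  rw [h1]
  exact hC γ c hc

/-- By connectedness, in the degree of `w` itself `C[w]` is only `C` plus the line through `w`. This
is what later forces the degrees of splitting elements to increase. -/
theorem exists_smul_sub_mem (hC : IsHom 𝒜 C) (hw : w ∈ 𝒜 δ) {x : R} (hx : x ∈ extend C w)
    (hxγ : x ∈ 𝒜 δ) : ∃ a : k, x - a • w ∈ C := by
  obtain ⟨c, hc, h⟩ := exists_sub_mem_of_mem_extend hpos hR hconn hw hx
  have h1 : GradedAlgebra.proj 𝒜 δ (x - c) ∈ Submodule.span k {w} := by
    refine (sup_le ?_ (iSup_le ?_) : _ ≤ (Submodule.span k {w}).comap (GradedAlgebra.proj 𝒜 δ)) h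
    · rw [Submodule.span_singleton_le_iff_mem, Submodule.mem_comap, proj_same hw]
      exact Submodule.mem_span_singleton_self w
    · intro β y hy
      rw [Submodule.mem_comap, proj_ne hy]
      · exact zero_mem _
      · intro h
        exact β.2 (by simpa using h)
  obtain ⟨a, ha⟩ := Submodule.mem_span_singleton.1 h1
  rw [map_sub, proj_same hxγ] at ha
  refine ⟨a, ?_⟩
  rw [ha, sub_sub_cancel]
  exact hC δ c hc

end Adjoin

variable (hχ : IsInducedBraiding χ 𝒜 τ)
include hχ

theorem isGood_extend (hC : IsGood 𝒜 pL pR C) (hD : IsGood 𝒜 pL pR D) (hCD : AgreeBelow 𝒜 C D γ)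
    {y : R} (hy : y ∈ 𝒜 γ) (hyD : y ∈ D) : IsGood 𝒜 pL pR (extend C y) :=
  ⟨isHom_extend hC.hom hy,
    fun h => isCoideal_left_extend hpos hR hconn hD.hom hCD hC.hom hχ (hC.left h) (hD.left h) hy hyD,
    fun h => isCoideal_right_extend hpos hR hconn hD.hom hCD hC.hom hχ (hC.right h) (hD.right h)
      hy hyD⟩

omit [Coalgebra k R] [IsOrderedCancelAddMonoid Γ] hpos hR hconn in
/-- If `τ² = id` then `χ` is symmetric on the degrees that occur. -/
theorem scale_eq_scale (hτ : ∀ t, τ (τ t) = t) {z : R} (hz : z ∈ 𝒜 γ) (hz0 : z ≠ 0) (y : R) :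
    scale 𝒜 (fun β => (χ γ β : k)) y = scale 𝒜 (fun β => (((χ β γ)⁻¹ : kˣ) : k)) y := by
  refine LinearMap.congr_fun (linearMap_ext_of_graded (𝒜 := 𝒜) fun β x hx => ?_) y
  rw [scale_of_mem _ hx, scale_of_mem _ hx]
  by_cases hx0 : x = 0
  · rw [hx0, smul_zero, smul_zero]
  have h1 := hτ (z ⊗ₜ x)
  rw [hχ γ β z hz x hx, map_smul, hχ β γ x hx z hz, smul_smul] at h1
  have h2 : z ⊗ₜ[k] x ≠ 0 := by
    intro h
    obtain ⟨f, hf, -⟩ := Submodule.exists_le_ker_of_notMem (K := k) (p := ⊥) (v := z)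
      (fun h => hz0 ((Submodule.mem_bot k).1 h))
    have := congrArg (sliceL f) h
    rw [sliceL_tmul, map_zero, smul_eq_zero] at this
    exact this.elim hf hx0
  have h3 : ((χ γ β : k) * χ β γ - 1) • (z ⊗ₜ[k] x) = 0 := by
    rw [sub_smul, h1, one_smul, sub_self]
  have h4 : (χ γ β : k) * χ β γ = 1 := sub_eq_zero.1 ((smul_eq_zero.1 h3).resolve_right h2)
  rw [Units.val_inv_eq_inv_val, eq_inv_of_mul_eq_one_left h4]

/-- `E` is the kernel on `D` of the skew derivation attached to a functional that separates `z` from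
`C` in degree `γ`. It need not equal `C`. -/
theorem exists_mid (s : Side) (hs : match s with | .left => pL | .right => pR)
    (hτ : pL → pR → ∀ t, τ (τ t) = t) {z : R} (hC : IsGood 𝒜 pL pR C) (hD : IsGood 𝒜 pL pR D)
    (hDC : D = extend C z) (hz : z ∈ 𝒜 γ) (hzC : z ∉ C) (hCD : AgreeBelow 𝒜 C D γ) :
    ∃ E, IsGood 𝒜 pL pR E ∧ C ≤ E ∧ E ≤ D ∧ z ∉ E ∧ ∃ h, NiceStep 𝒜 (s.bichar χ) E D z γ h := by
  have hzD : z ∈ D := hDC ▸ self_mem_extend C z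
  have hCD' : C ≤ D := hDC ▸ le_extend C z
  have hγ : γ ≠ 0 := by
    rintro rfl
    apply hzC
    rw [eq_counit_smul_one hR.braidedBialgebra hconn hz]
    exact C.smul_mem (one_mem C) _
  obtain ⟨f, hfz, hfC⟩ := Submodule.exists_le_ker_of_notMem
    (p := Subalgebra.toSubmodule C) (v := z) hzC
  -- Composing with the projection concentrates `φ` in degree `γ`; it still vanishes on `C` because
  -- `C` is homogeneous.
  let φ : R →ₗ[k] k := ((f z)⁻¹ • f) ∘ₗ GradedAlgebra.proj 𝒜 γ
  have hφz : φ z = 1 := by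
    simp [φ, proj_same hz, inv_mul_cancel₀ hfz]
  have hφC : ∀ x ∈ C, φ x = 0 := fun x hx => by
    have : f (GradedAlgebra.proj 𝒜 γ x) = 0 := hfC (hC.hom γ x hx)
    simp only [φ, LinearMap.comp_apply, LinearMap.smul_apply, this, smul_zero]
  have hφ : ∀ α, α ≠ γ → ∀ x ∈ 𝒜 α, φ x = 0 := fun α hα x hx => by
    simp only [φ, LinearMap.comp_apply, proj_ne hx hα, map_zero]
  have hφD : ∀ x ∈ D, ∀ y ∈ D, φ (x * y) = φ x * counit (R := k) y + counit (R := k) x * φ y :=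
    fun x hx y hy => derivation_on hR hconn hpos hD.hom hγ hCD hφC hφ hx hy
  let dL : R →ₗ[k] R := hitR φ
  let c : Γ → k := fun β => (((χ β γ)⁻¹ : kˣ) : k)
  let dR : R →ₗ[k] R := scale 𝒜 c ∘ₗ hitL φ
  have hdR0 : ∀ x, dR x = 0 ↔ hitL φ x = 0 := fun x => by
    constructor
    · intro h
      have := scale_scale (𝒜 := 𝒜) (c := fun β => (χ β γ : k)) (c' := c)
        (fun α => by simp [c]) (hitL φ x)
      rw [← this]
      change scale 𝒜 _ (dR x) = 0
      rw [h, map_zero]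
    · intro h
      simp only [dR, LinearMap.comp_apply, h, map_zero]
  have hL : pL → IsSkewDer 𝒜 χ D γ dL := fun h =>
    isSkewDer_hitR hR hχ hD.hom (hD.left h) hφD hφ
  have hRt : pR → IsSkewDer 𝒜 (Side.right.bichar χ) D γ dR := fun h =>
    isSkewDer_hitL hR hχ hD.hom (hD.right h) hφD hφ
  have hLz : pL → dL z = 1 := fun h => (hL h).eq_one_of_counit hR hconn hz
    ((counit_hitR φ z).trans hφz)
  have hRz : pR → dR z = 1 := fun h => by
    refine (hRt h).eq_one_of_counit hR hconn hz ?_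
    have h2 : ∀ y, counit (R := k) (scale 𝒜 c y) = counit y := by
      refine LinearMap.congr_fun (f := counit ∘ₗ scale 𝒜 c)
        (linearMap_ext_of_graded (𝒜 := 𝒜) fun β x hx => ?_)
      rw [LinearMap.comp_apply, scale_of_mem _ hx, map_smul]
      by_cases h0 : β = 0
      · subst h0; simp [c, χ.map_zero_left]
      · rw [hR.counit_graded β h0 x hx, smul_zero]
    exact (h2 _).trans ((counit_hitL φ z).trans hφz)
  have hLC : pL → ∀ x ∈ C, dL x = 0 := fun h x hx => by
    have h1 : tens ⊤ (Subalgebra.toSubmodule C) ≤ LinearMap.ker (sliceR φ) :=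
      tens_le fun a _ b hb => by simp [hφC b hb]
    exact h1 (hC.left h (Submodule.mem_map_of_mem hx))
  have hRC : pR → ∀ x ∈ C, dR x = 0 := fun h x hx => by
    have h1 : tens (Subalgebra.toSubmodule C) ⊤ ≤ LinearMap.ker (sliceL φ) :=
      tens_le fun a ha b _ => by simp [hφC a ha]
    exact (hdR0 x).2 (h1 (hC.right h (Submodule.mem_map_of_mem hx)))
  -- Both derivations kill `C` and send `z` to `1`. With `τ² = id` they also have the same twist, so
  -- they coincide on `C[z]` and their kernels are coideals on both sides.
  have hLR : pL → pR → ∀ x ∈ D, dL x = dR x := fun h h' x hx => by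
    have hz0 : z ≠ 0 := fun e => hzC (e ▸ zero_mem C)
    have h2 : IsSkewDer 𝒜 χ D γ dR := by
      refine ⟨fun x hx y hy => ?_, (hRt h').graded⟩
      rw [(hRt h').mul x hx y hy, scale_eq_scale hχ (hτ h h') hz hz0]
      rfl
    exact (hL h).eq_of_extend h2 hDC (hLC h) (hRC h') (hLz h) (hRz h') hx
  have hleft : ∀ E : Subalgebra k R, (∀ x, x ∈ E ↔ x ∈ D ∧ dL x = 0) → pL →
      IsCoideal .left (Subalgebra.toSubmodule E) := fun E hE h => by
    refine isCoideal_left_iff.2 fun x hx f => (hE _).2 ⟨?_, ?_⟩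
    · exact isCoideal_left_iff.1 (hD.left h) x ((hE x).1 hx).1 f
    · have : hitR φ x = 0 := ((hE x).1 hx).2
      change hitR φ (hitL f x) = 0
      rw [← hitL_hitR, this, map_zero]
  have hright : ∀ E : Subalgebra k R, (∀ x, x ∈ E ↔ x ∈ D ∧ dR x = 0) → pR →
      IsCoideal .right (Subalgebra.toSubmodule E) := fun E hE h => by
    refine isCoideal_right_iff.2 fun x hx f => (hE _).2 ⟨?_, ?_⟩
    · exact isCoideal_right_iff.1 (hD.right h) x ((hE x).1 hx).1 f
    · have : hitL φ x = 0 := (hdR0 x).1 ((hE x).1 hx).2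
      rw [hdR0, hitL_hitR, this, map_zero]
  have hzE : ∀ d : R →ₗ[k] R, d z = 1 → ¬ d z = 0 := fun d h h' => by
    apply hzC
    have h10 : (1 : R) = 0 := h.symm.trans h'
    have : z = 0 := by rw [← mul_one z, h10, mul_zero]
    rw [this]
    exact zero_mem C
  cases s with
  | left =>
    obtain ⟨E, hEhom, hE⟩ := (hL hs).exists_ker hD.hom
    refine ⟨E, ⟨hEhom, hleft E hE, fun h => hright E (fun x => ?_) h⟩,
      fun x hx => (hE x).2 ⟨hCD' hx, hLC hs x hx⟩, fun x hx => ((hE x).1 hx).1,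
      fun h => hzE dL (hLz hs) ((hE z).1 h).2,
      (hL hs).exists_niceStep hE hDC (hLC hs) hz (hLz hs) hγ⟩
    rw [hE]
    exact and_congr_right fun hx => by rw [hLR hs h x hx]
  | right =>
    obtain ⟨E, hEhom, hE⟩ := (hRt hs).exists_ker hD.hom
    refine ⟨E, ⟨hEhom, fun h => hleft E (fun x => ?_) h, hright E hE⟩,
      fun x hx => (hE x).2 ⟨hCD' hx, hRC hs x hx⟩, fun x hx => ((hE x).1 hx).1,
      fun h => hzE dR (hRz hs) ((hE z).1 h).2,
      (hRt hs).exists_niceStep hE hDC (hRC hs) hz (hRz hs) hγ⟩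
    rw [hE]
    exact and_congr_right fun hx => by rw [hLR h hs x hx]

end Good

/-! ### Refining an inclusion of subalgebras to a chain of nice steps -/

section Chain

variable {k R Γ ι : Type*} [Field k] [Ring R] [Algebra k R] [AddCommMonoid Γ]
  [LinearOrder Γ] [LinearOrder ι]

/-- The closure properties of a class `P` of homogeneous subalgebras that make it possible to
refine inclusions in `P`. The homogeneous elements are enumerated by `w`, by increasing degrees. -/
structure IsRefinable (𝒜 : Γ → Submodule k R) [GradedAlgebra 𝒜] (ψ : Bicharacter k Γ)
    (P : Subalgebra k R → Prop) (wd : ι → Γ) (w : ι → R) : Prop where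
  mem : ∀ i, w i ∈ 𝒜 (wd i)
  lt_of_lt : ∀ i j, wd i < wd j → i < j
  exists_eq : ∀ γ, ∀ x ∈ 𝒜 γ, ∃ i, wd i = γ ∧ w i = x
  hom : ∀ K, P K → IsHom 𝒜 K
  sInf : ∀ S : Set (Subalgebra k R), (∀ K ∈ S, P K) → P (sInf S)
  sSup : ∀ S : Set (Subalgebra k R), S.Nonempty → IsChain (· ≤ ·) S → (∀ K ∈ S, P K) → P (sSup S)
  extend : ∀ C D i, P C → P D → AgreeBelow 𝒜 C D (wd i) → w i ∈ D → P (extend C (w i))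
  mid : ∀ C i, P C → P (BraidedPBW.extend C (w i)) → w i ∉ C →
    AgreeBelow 𝒜 C (BraidedPBW.extend C (w i)) (wd i) →
    ∃ E, P E ∧ C ≤ E ∧ E ≤ BraidedPBW.extend C (w i) ∧ w i ∉ E ∧
      ∃ h, NiceStep 𝒜 ψ E (BraidedPBW.extend C (w i)) (w i) (wd i) h
  mem_of_ne : ∀ C i γ, IsHom 𝒜 C → ∀ x ∈ BraidedPBW.extend C (w i), x ∈ 𝒜 γ →
    (∀ β, wd i + β ≠ γ) → x ∈ C
  smul_sub_mem : ∀ C i, IsHom 𝒜 C → ∀ x ∈ BraidedPBW.extend C (w i), x ∈ 𝒜 (wd i) →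
    ∃ a : k, x - a • w i ∈ C

variable (𝒜 : Γ → Submodule k R) [GradedAlgebra 𝒜] (ψ : Bicharacter k Γ)
  (P : Subalgebra k R → Prop) (wd : ι → Γ) (w : ι → R)

/-- A subalgebra `E` such that `C[w i]` is obtained from `E` by a nice step. -/
noncomputable def midAlg (C : Subalgebra k R) (i : ι) : Subalgebra k R :=
  Classical.epsilon fun E => P E ∧ C ≤ E ∧ E ≤ extend C (w i) ∧ w i ∉ E ∧
    ∃ h, NiceStep 𝒜 ψ E (extend C (w i)) (w i) (wd i) h

omit [LinearOrder Γ] in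
/-- The element `w i` is the first one that separates the two ends of the interval `N`. -/
def Active (N : Subalgebra k R × Subalgebra k R) (i : ι) : Prop :=
  w i ∈ N.2 ∧ w i ∉ N.1 ∧ ∀ j < i, w j ∈ N.2 → w j ∈ N.1

open Classical in
/-- Split the interval `N = (C, D)` into `(C, E)`, `(E, C[w i])` and `(C[w i], D)` if `w i` is
active, and choose the part containing `a`. -/
noncomputable def stepInterval (a : R) (i : ι) (N : Subalgebra k R × Subalgebra k R) :
    Subalgebra k R × Subalgebra k R :=
  if Active w N i then
    if a ∈ midAlg 𝒜 ψ P wd w N.1 i then (N.1, midAlg 𝒜 ψ P wd w N.1 i)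
    else if a ∈ extend N.1 (w i) then (midAlg 𝒜 ψ P wd w N.1 i, extend N.1 (w i))
    else (extend N.1 (w i), N.2)
  else N

/-- The intersection of a family of intervals, starting from `(B, A)`. -/
def bounds (A B : Subalgebra k R) (S : Set (Subalgebra k R × Subalgebra k R)) :
    Subalgebra k R × Subalgebra k R :=
  (sSup (insert B (Prod.fst '' S)), sInf (insert A (Prod.snd '' S)))

variable [WellFoundedLT ι] (A B : Subalgebra k R)

/-- The intervals around `a` in the successive refinements of `(B, A)`. -/
noncomputable def path (a : R) : ι → Subalgebra k R × Subalgebra k R :=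
  (wellFounded_lt (α := ι)).fix fun i prev =>
    stepInterval 𝒜 ψ P wd w a i (bounds A B {N | ∃ j, ∃ h : j < i, prev j h = N})

/-- The interval around `a` before the refinement with `w i`. -/
noncomputable def node (a : R) (i : ι) : Subalgebra k R × Subalgebra k R :=
  bounds A B (path 𝒜 ψ P wd w A B a '' Set.Iio i)

omit [LinearOrder Γ] [GradedAlgebra 𝒜] in
theorem path_eq (a : R) (i : ι) :
    path 𝒜 ψ P wd w A B a i = stepInterval 𝒜 ψ P wd w a i (node 𝒜 ψ P wd w A B a i) := by
  rw [path, WellFounded.fix_eq]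
  congr 2
  ext N
  simp only [Set.mem_ofPred_eq, Set.mem_image, Set.mem_Iio, exists_prop]
  rfl

/-- The limit of the intervals around `a`. -/
noncomputable def final (a : R) : Subalgebra k R × Subalgebra k R :=
  bounds A B (Set.range (path 𝒜 ψ P wd w A B a))

/-- `N` is an interval in `P` around `a`. -/
structure IsInterval (a : R) (N : Subalgebra k R × Subalgebra k R) : Prop where
  fst : P N.1
  snd : P N.2
  le : N.1 ≤ N.2
  mem : a ∈ N.2
  not_mem : a ∉ N.1
  ge_bot : B ≤ N.1
  le_top : N.2 ≤ A

/-- `N` is contained in `M`. -/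
def Refines (N M : Subalgebra k R × Subalgebra k R) : Prop := M.1 ≤ N.1 ∧ N.2 ≤ M.2

/-- The interval `N` is a nice step with generator `w i`. -/
def SettledAt (N : Subalgebra k R × Subalgebra k R) (i : ι) : Prop :=
  w i ∉ N.1 ∧ ∃ h, NiceStep 𝒜 ψ N.1 N.2 (w i) (wd i) h

variable {𝒜 ψ P wd w A B} (hP : IsRefinable 𝒜 ψ P wd w)

omit [LinearOrder Γ] [GradedAlgebra 𝒜] in
theorem node_congr {a b : R} {i : ι}
    (h : ∀ j < i, path 𝒜 ψ P wd w A B a j = path 𝒜 ψ P wd w A B b j) :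
    node 𝒜 ψ P wd w A B a i = node 𝒜 ψ P wd w A B b i := by
  rw [node, node, Set.image_congr (s := Set.Iio i) fun j hj => h j hj]

-- The element `w i` still separates the two ends, so no later index can be the first to do so: a
-- settled interval is never split again.
omit [LinearOrder Γ] [GradedAlgebra 𝒜] [WellFoundedLT ι] in
theorem SettledAt.not_active {N : Subalgebra k R × Subalgebra k R} {i j : ι}
    (h : SettledAt 𝒜 ψ wd w N i) (hij : i < j) : ¬ Active w N j := by
  intro ha
  obtain ⟨h1, _, h2⟩ := h
  refine h1 (ha.2.2 i hij ?_)
  rw [h2.eq_extend]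
  exact self_mem_extend _ _

include hP

-- Every homogeneous element of smaller degree is enumerated before `w i`, so it cannot separate the
-- ends.
omit [WellFoundedLT ι] in
theorem Active.agreeBelow {N : Subalgebra k R × Subalgebra k R} {i : ι} (ha : Active w N i) :
    AgreeBelow 𝒜 N.1 N.2 (wd i) := by
  intro δ hδ x hx hxδ
  obtain ⟨j, rfl, rfl⟩ := hP.exists_eq δ x hxδ
  exact ha.2.2 j (hP.lt_of_lt j i hδ) hx

omit [WellFoundedLT ι] in
theorem midAlg_spec {N : Subalgebra k R × Subalgebra k R} {i : ι} (ha : Active w N i)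
    (h1 : P N.1) (h2 : P N.2) (h12 : N.1 ≤ N.2) :
    P (extend N.1 (w i)) ∧ extend N.1 (w i) ≤ N.2 ∧ P (midAlg 𝒜 ψ P wd w N.1 i) ∧
      N.1 ≤ midAlg 𝒜 ψ P wd w N.1 i ∧ midAlg 𝒜 ψ P wd w N.1 i ≤ extend N.1 (w i) ∧
      w i ∉ midAlg 𝒜 ψ P wd w N.1 i ∧
      ∃ h, NiceStep 𝒜 ψ (midAlg 𝒜 ψ P wd w N.1 i) (extend N.1 (w i)) (w i) (wd i) h := by
  have h3 := ha.agreeBelow hP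
  have h4 := hP.extend N.1 N.2 i h1 h2 h3 ha.1
  have h5 : extend N.1 (w i) ≤ N.2 := extend_le h12 ha.1
  exact ⟨h4, h5, Classical.epsilon_spec
    (hP.mid N.1 i h1 h4 ha.2.1 fun δ hδ x hx => h3 δ hδ x (h5 hx))⟩

omit [WellFoundedLT ι] in
theorem step_spec {a : R} {N : Subalgebra k R × Subalgebra k R} (i : ι)
    (h : IsInterval P A B a N) : IsInterval P A B a (stepInterval 𝒜 ψ P wd w a i N) ∧
      Refines (stepInterval 𝒜 ψ P wd w a i N) N := by
  classical
  rw [stepInterval]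
  by_cases h1 : Active w N i
  swap
  · rw [if_neg h1]
    exact ⟨h, le_rfl, le_rfl⟩
  obtain ⟨p1, p2, p3, p4, p5, -⟩ := midAlg_spec hP h1 h.fst h.snd h.le
  rw [if_pos h1]
  split_ifs with h2 h3
  · exact ⟨⟨h.fst, p3, p4, h2, h.not_mem, h.ge_bot, (p5.trans p2).trans h.le_top⟩, le_rfl,
      p5.trans p2⟩
  · exact ⟨⟨p3, p1, p5, h3, h2, h.ge_bot.trans p4, p2.trans h.le_top⟩, p4, p2⟩
  · exact ⟨⟨p1, h.snd, p2, h.mem, h3, h.ge_bot.trans (p4.trans p5), h.le_top⟩, p4.trans p5, le_rfl⟩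

variable (hA : P A) (hB : P B) (hBA : B ≤ A)
include hA hB hBA

omit [WellFoundedLT ι] in
theorem bounds_spec {a : R} (haA : a ∈ A) (haB : a ∉ B) {p : ι → Subalgebra k R × Subalgebra k R}
    {T : Set ι} (hp : ∀ i ∈ T, IsInterval P A B a (p i))
    (hr : ∀ i ∈ T, ∀ j ∈ T, j < i → Refines (p i) (p j)) :
    IsInterval P A B a (bounds A B (p '' T)) ∧ ∀ i ∈ T, Refines (bounds A B (p '' T)) (p i) := by
  have hne : (insert B (Prod.fst '' (p '' T))).Nonempty := ⟨B, Set.mem_insert _ _⟩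
  have hcomp : ∀ i ∈ T, ∀ j ∈ T, Refines (p i) (p j) ∨ Refines (p j) (p i) := by
    intro i hi j hj
    rcases lt_trichotomy i j with h | rfl | h
    · exact Or.inr (hr j hj i hi h)
    · exact Or.inl ⟨le_rfl, le_rfl⟩
    · exact Or.inl (hr i hi j hj h)
  have hch : IsChain (· ≤ ·) (insert B (Prod.fst '' (p '' T))) := by
    refine IsChain.insert ?_ ?_
    · rintro _ ⟨_, ⟨i, hi, rfl⟩, rfl⟩ _ ⟨_, ⟨j, hj, rfl⟩, rfl⟩ -
      exact (hcomp i hi j hj).symm.imp (fun h => h.1) fun h => h.1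
    · rintro _ ⟨_, ⟨i, hi, rfl⟩, rfl⟩ -
      exact Or.inl (hp i hi).ge_bot
  refine ⟨⟨hP.sSup _ hne hch ?_, hP.sInf _ ?_, sSup_le ?_, ?_, ?_,
    le_sSup (Set.mem_insert _ _), sInf_le (Set.mem_insert _ _)⟩, fun i hi => ⟨?_, ?_⟩⟩
  · rintro _ (rfl | ⟨_, ⟨i, hi, rfl⟩, rfl⟩)
    exacts [hB, (hp i hi).fst]
  · rintro _ (rfl | ⟨_, ⟨i, hi, rfl⟩, rfl⟩)
    exacts [hA, (hp i hi).snd]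
  · rintro _ (rfl | ⟨_, ⟨i, hi, rfl⟩, rfl⟩) <;> refine le_sInf ?_ <;>
      rintro _ (rfl | ⟨_, ⟨j, hj, rfl⟩, rfl⟩)
    · exact hBA
    · exact (hp j hj).ge_bot.trans (hp j hj).le
    · exact (hp i hi).le.trans (hp i hi).le_top
    · rcases hcomp i hi j hj with h | h
      · exact (hp i hi).le.trans h.2
      · exact h.1.trans (hp j hj).le
  · rw [bounds, Algebra.mem_sInf]
    rintro _ (rfl | ⟨_, ⟨i, hi, rfl⟩, rfl⟩)
    exacts [haA, (hp i hi).mem]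
  · rw [bounds, mem_sSup_of_isChain hne hch]
    rintro ⟨_, rfl | ⟨_, ⟨i, hi, rfl⟩, rfl⟩, h⟩
    exacts [haB h, (hp i hi).not_mem h]
  · exact le_sSup (Set.mem_insert_of_mem _ ⟨_, ⟨i, hi, rfl⟩, rfl⟩)
  · exact sInf_le (Set.mem_insert_of_mem _ ⟨_, ⟨i, hi, rfl⟩, rfl⟩)

omit [LinearOrder ι] [WellFoundedLT ι] hP hA hB hBA in
theorem bounds_eq {p : ι → Subalgebra k R × Subalgebra k R} {T : Set ι} {i : ι} (hi : i ∈ T)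
    (hB : B ≤ (p i).1) (hA : (p i).2 ≤ A) (hr : ∀ j ∈ T, Refines (p i) (p j)) :
    bounds A B (p '' T) = p i := by
  refine Prod.ext (le_antisymm (sSup_le ?_) ?_) (le_antisymm ?_ (le_sInf ?_))
  · rintro _ (rfl | ⟨_, ⟨j, hj, rfl⟩, rfl⟩)
    exacts [hB, (hr j hj).1]
  · exact le_sSup (Set.mem_insert_of_mem _ ⟨_, ⟨i, hi, rfl⟩, rfl⟩)
  · exact sInf_le (Set.mem_insert_of_mem _ ⟨_, ⟨i, hi, rfl⟩, rfl⟩)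
  · rintro _ (rfl | ⟨_, ⟨j, hj, rfl⟩, rfl⟩)
    exacts [hA, (hr j hj).2]

section Path

variable {a : R} (haA : a ∈ A) (haB : a ∉ B)
include haA haB

theorem path_spec (i : ι) : IsInterval P A B a (path 𝒜 ψ P wd w A B a i) ∧
    ∀ j < i, Refines (path 𝒜 ψ P wd w A B a i) (path 𝒜 ψ P wd w A B a j) := by
  induction i using WellFoundedLT.induction with
  | ind i ih =>
    obtain ⟨h1, h2⟩ := bounds_spec hP hA hB hBA haA haB (p := path 𝒜 ψ P wd w A B a)
      (T := Set.Iio i) (fun j hj => (ih j hj).1) (fun j hj l hl hlj => (ih j hj).2 l hlj)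
    obtain ⟨h3, h4⟩ := step_spec hP i h1
    rw [path_eq]
    exact ⟨h3, fun j hj => ⟨(h2 j hj).1.trans h4.1, h4.2.trans (h2 j hj).2⟩⟩

theorem node_spec (i : ι) : IsInterval P A B a (node 𝒜 ψ P wd w A B a i) ∧
    ∀ j < i, Refines (node 𝒜 ψ P wd w A B a i) (path 𝒜 ψ P wd w A B a j) :=
  bounds_spec hP hA hB hBA haA haB (p := path 𝒜 ψ P wd w A B a)
      (T := Set.Iio i) (fun j _ => (path_spec hP hA hB hBA haA haB j).1)
      (fun j _ l _ hlj => (path_spec hP hA hB hBA haA haB j).2 l hlj)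

theorem final_spec : IsInterval P A B a (final 𝒜 ψ P wd w A B a) ∧
    ∀ i, Refines (final 𝒜 ψ P wd w A B a) (path 𝒜 ψ P wd w A B a i) := by
  have := bounds_spec hP hA hB hBA haA haB (p := path 𝒜 ψ P wd w A B a)
      (T := Set.univ) (fun j _ => (path_spec hP hA hB hBA haA haB j).1)
      (fun j _ l _ hlj => (path_spec hP hA hB hBA haA haB j).2 l hlj)
  rw [Set.image_univ] at this
  exact ⟨this.1, fun i => this.2 i trivial⟩

theorem path_eq_of_settled {i j : ι} (hji : j ≤ i)
    (hs : SettledAt 𝒜 ψ wd w (path 𝒜 ψ P wd w A B a i) j) {l : ι} (hl : i < l) :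
    node 𝒜 ψ P wd w A B a l = path 𝒜 ψ P wd w A B a i ∧
      path 𝒜 ψ P wd w A B a l = path 𝒜 ψ P wd w A B a i := by
  induction l using WellFoundedLT.induction with
  | ind l ih =>
    have hps := path_spec hP hA hB hBA haA haB
    have h1 : node 𝒜 ψ P wd w A B a l = path 𝒜 ψ P wd w A B a i := by
      refine bounds_eq (p := path 𝒜 ψ P wd w A B a) (Set.mem_Iio.2 hl) (hps i).1.ge_bot
        (hps i).1.le_top fun m hm => ?_
      rcases lt_trichotomy m i with h | rfl | h
      · exact (hps i).2 m h
      · exact ⟨le_rfl, le_rfl⟩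
      · rw [(ih m hm h).2]
        exact ⟨le_rfl, le_rfl⟩
    refine ⟨h1, ?_⟩
    rw [path_eq, h1, stepInterval, if_neg (hs.not_active (hji.trans_lt hl))]

/-- The invariant of the refinement: as long as the interval is not settled, none of the elements
treated so far separates its ends. The lower piece qualifies because `w i` is not in its top, the
upper piece because `w i` is in its bottom. -/
theorem settled_or (i : ι) : (∃ j ≤ i, SettledAt 𝒜 ψ wd w (path 𝒜 ψ P wd w A B a i) j) ∨
    ∀ j ≤ i, w j ∈ (path 𝒜 ψ P wd w A B a i).2 → w j ∈ (path 𝒜 ψ P wd w A B a i).1 := by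
  classical
  induction i using WellFoundedLT.induction with
  | ind i ih =>
    by_cases hs : ∃ l < i, ∃ j ≤ l, SettledAt 𝒜 ψ wd w (path 𝒜 ψ P wd w A B a l) j
    · obtain ⟨l, hl, j, hj, hs⟩ := hs
      refine Or.inl ⟨j, hj.trans hl.le, ?_⟩
      rw [(path_eq_of_settled hP hA hB hBA haA haB hj hs hl).2]
      exact hs
    · obtain ⟨hn1, hn2⟩ := node_spec hP hA hB hBA haA haB i
      have hclean : ∀ j < i, w j ∈ (node 𝒜 ψ P wd w A B a i).2 →
          w j ∈ (node 𝒜 ψ P wd w A B a i).1 := by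
        intro j hj hw
        refine (hn2 j hj).1 (((ih j hj).resolve_left fun ⟨l, h1, h2⟩ => hs ⟨j, hj, l, h1, h2⟩) j
          le_rfl ((hn2 j hj).2 hw))
      rw [path_eq, stepInterval]
      by_cases h1 : Active w (node 𝒜 ψ P wd w A B a i) i
      swap
      · rw [if_neg h1]
        refine Or.inr fun j hj hw => ?_
        rcases hj.eq_or_lt with rfl | hj
        · by_contra hw'
          exact h1 ⟨hw, hw', hclean⟩
        · exact hclean j hj hw
      obtain ⟨p1, p2, p3, p4, p5, p6, p7⟩ := midAlg_spec hP h1 hn1.fst hn1.snd hn1.le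
      rw [if_pos h1]
      split_ifs with h2 h3
      · refine Or.inr fun j hj hw => ?_
        rcases hj.eq_or_lt with rfl | hj
        · exact absurd hw p6
        · exact hclean j hj (p2 (p5 hw))
      · exact Or.inl ⟨i, le_rfl, p6, p7⟩
      · refine Or.inr fun j hj hw => ?_
        rcases hj.eq_or_lt with rfl | hj
        · exact self_mem_extend _ _
        · exact le_extend _ _ (hclean j hj hw)

/-- The element `a` always separates the ends of its own interval and occurs as some `w i`; by the
invariant the interval is settled by stage `i`. -/
theorem exists_settled {γ : Γ} (ha : a ∈ 𝒜 γ) :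
    ∃ i, ∃ j ≤ i, SettledAt 𝒜 ψ wd w (path 𝒜 ψ P wd w A B a i) j ∧
      final 𝒜 ψ P wd w A B a = path 𝒜 ψ P wd w A B a i := by
  obtain ⟨i, -, rfl⟩ := hP.exists_eq γ a ha
  have hps := path_spec hP hA hB hBA haA haB
  obtain ⟨j, hj, hs⟩ := (settled_or hP hA hB hBA haA haB i).resolve_right fun h =>
    (hps i).1.not_mem (h i le_rfl (hps i).1.mem)
  refine ⟨i, j, hj, hs, ?_⟩
  rw [final, ← Set.image_univ]
  refine bounds_eq (Set.mem_univ i) (hps i).1.ge_bot (hps i).1.le_top fun m _ => ?_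
  rcases lt_trichotomy m i with h | rfl | h
  · exact (hps i).2 m h
  · exact ⟨le_rfl, le_rfl⟩
  · rw [(path_eq_of_settled hP hA hB hBA haA haB hj hs h).2]
    exact ⟨le_rfl, le_rfl⟩

end Path

end Chain

/-! ### The order of the final intervals and its well-foundedness in each degree -/

section Comparison

variable {k R Γ ι : Type*} [Field k] [Ring R] [Algebra k R] [AddCommMonoid Γ]
  [LinearOrder Γ] [LinearOrder ι] [WellFoundedLT ι]

/-- The paths of `a` and `b` separate at `i`, and `a` is on the lower side. -/
def Separates (𝒜 : Γ → Submodule k R) [GradedAlgebra 𝒜] (ψ : Bicharacter k Γ)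
    (P : Subalgebra k R → Prop) (wd : ι → Γ) (w : ι → R) (A B : Subalgebra k R) (a b : R)
    (i : ι) : Prop :=
  (∀ j < i, path 𝒜 ψ P wd w A B a j = path 𝒜 ψ P wd w A B b j) ∧
    Active w (node 𝒜 ψ P wd w A B a i) i ∧
    ((a ∈ midAlg 𝒜 ψ P wd w (node 𝒜 ψ P wd w A B a i).1 i ∧
        b ∉ midAlg 𝒜 ψ P wd w (node 𝒜 ψ P wd w A B a i).1 i) ∨
      (a ∈ extend (node 𝒜 ψ P wd w A B a i).1 (w i) ∧
        b ∉ extend (node 𝒜 ψ P wd w A B a i).1 (w i)))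

variable {𝒜 : Γ → Submodule k R} [GradedAlgebra 𝒜] {ψ : Bicharacter k Γ}
  {P : Subalgebra k R → Prop} {wd : ι → Γ} {w : ι → R} {A B : Subalgebra k R}

/-- At the first stage where the paths differ the nodes still agree, so both elements face the same
splitting and fall into different pieces of it. -/
theorem path_eq_or_separates (a b : R) :
    path 𝒜 ψ P wd w A B a = path 𝒜 ψ P wd w A B b ∨
      ∃ i, Separates 𝒜 ψ P wd w A B a b i ∨ Separates 𝒜 ψ P wd w A B b a i := by
  classical
  by_cases h : ∃ i, path 𝒜 ψ P wd w A B a i ≠ path 𝒜 ψ P wd w A B b i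
  · obtain ⟨i, hi, hmin⟩ := (wellFounded_lt (α := ι)).has_min
      {i | path 𝒜 ψ P wd w A B a i ≠ path 𝒜 ψ P wd w A B b i} h
    have heq : ∀ j < i, path 𝒜 ψ P wd w A B a j = path 𝒜 ψ P wd w A B b j := fun j hj => by
      by_contra hne
      exact hmin j hne hj
    have hnode := node_congr heq
    refine Or.inr ⟨i, ?_⟩
    rw [Set.mem_ofPred_eq, path_eq, path_eq, ← hnode] at hi
    have hact : Active w (node 𝒜 ψ P wd w A B a i) i := by
      by_contra hna
      rw [stepInterval, stepInterval, if_neg hna, if_neg hna] at hi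
      exact hi rfl
    rw [stepInterval, stepInterval, if_pos hact, if_pos hact] at hi
    simp only [Separates, ← hnode]
    by_cases h1 : a ∈ midAlg 𝒜 ψ P wd w (node 𝒜 ψ P wd w A B a i).1 i <;>
    by_cases h2 : b ∈ midAlg 𝒜 ψ P wd w (node 𝒜 ψ P wd w A B a i).1 i
    · simp [h1, h2] at hi
    · exact Or.inl ⟨heq, hact, Or.inl ⟨h1, h2⟩⟩
    · exact Or.inr ⟨fun j hj => (heq j hj).symm, hact, Or.inl ⟨h2, h1⟩⟩
    · by_cases h3 : a ∈ extend (node 𝒜 ψ P wd w A B a i).1 (w i) <;>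
      by_cases h4 : b ∈ extend (node 𝒜 ψ P wd w A B a i).1 (w i)
      · simp [h1, h2, h3, h4] at hi
      · exact Or.inl ⟨heq, hact, Or.inr ⟨h3, h4⟩⟩
      · exact Or.inr ⟨fun j hj => (heq j hj).symm, hact, Or.inr ⟨h4, h3⟩⟩
      · simp [h1, h2, h3, h4] at hi
  · push Not at h
    exact Or.inl (funext h)

omit [LinearOrder Γ] [GradedAlgebra 𝒜] in
theorem final_congr {a b : R} (h : path 𝒜 ψ P wd w A B a = path 𝒜 ψ P wd w A B b) :
    final 𝒜 ψ P wd w A B a = final 𝒜 ψ P wd w A B b := by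
  rw [final, final, h]

variable (hP : IsRefinable 𝒜 ψ P wd w) (hA : P A) (hB : P B) (hBA : B ≤ A)
include hP hA hB hBA

/-- The possibilities for the element on the lower side of a separation. -/
theorem Separates.cases {a b : R} (haA : a ∈ A) (haB : a ∉ B) {i : ι}
    (h : Separates 𝒜 ψ P wd w A B a b i) :
    (a ∈ midAlg 𝒜 ψ P wd w (node 𝒜 ψ P wd w A B a i).1 i ∧
      path 𝒜 ψ P wd w A B a i = ((node 𝒜 ψ P wd w A B a i).1,
        midAlg 𝒜 ψ P wd w (node 𝒜 ψ P wd w A B a i).1 i) ∧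
      b ∉ midAlg 𝒜 ψ P wd w (node 𝒜 ψ P wd w A B a i).1 i) ∨
    (a ∉ midAlg 𝒜 ψ P wd w (node 𝒜 ψ P wd w A B a i).1 i ∧
      a ∈ extend (node 𝒜 ψ P wd w A B a i).1 (w i) ∧
      path 𝒜 ψ P wd w A B a i = (midAlg 𝒜 ψ P wd w (node 𝒜 ψ P wd w A B a i).1 i,
        extend (node 𝒜 ψ P wd w A B a i).1 (w i)) ∧
      b ∉ extend (node 𝒜 ψ P wd w A B a i).1 (w i)) := by
  obtain ⟨hn, -⟩ := node_spec hP hA hB hBA haA haB i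
  obtain ⟨-, hact, h⟩ := h
  obtain ⟨p1, p2, p3, p4, p5, p6, p7⟩ := midAlg_spec hP hact hn.fst hn.snd hn.le
  rw [path_eq, stepInterval, if_pos hact]
  by_cases h1 : a ∈ midAlg 𝒜 ψ P wd w (node 𝒜 ψ P wd w A B a i).1 i
  · refine Or.inl ⟨h1, by rw [if_pos h1], ?_⟩
    exact h.elim (fun h => h.2) fun h hb => h.2 (p5 hb)
  · obtain ⟨h2, h3⟩ := h.resolve_left fun h => h1 h.1
    exact Or.inr ⟨h1, h2, by rw [if_neg h1, if_pos h2], h3⟩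

theorem Separates.final_le {a b : R} (haA : a ∈ A) (haB : a ∉ B) (hbA : b ∈ A) (hbB : b ∉ B)
    {i : ι} (h : Separates 𝒜 ψ P wd w A B a b i) :
    (final 𝒜 ψ P wd w A B a).2 ≤ (final 𝒜 ψ P wd w A B b).1 := by
  classical
  refine ((final_spec hP hA hB hBA haA haB).2 i).2.trans
    (le_trans ?_ ((final_spec hP hA hB hBA hbA hbB).2 i).1)
  obtain ⟨hn, -⟩ := node_spec hP hA hB hBA haA haB i
  have hact := h.2.1
  obtain ⟨p1, p2, p3, p4, p5, p6, p7⟩ := midAlg_spec hP hact hn.fst hn.snd hn.le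
  have hb : path 𝒜 ψ P wd w A B b i = stepInterval 𝒜 ψ P wd w b i (node 𝒜 ψ P wd w A B a i) := by
    rw [path_eq, node_congr h.1]
  rw [hb, stepInterval, if_pos hact]
  rcases h.cases hP hA hB hBA haA haB with ⟨-, h2, h3⟩ | ⟨-, -, h2, h3⟩
  · rw [h2, if_neg h3]
    split_ifs
    exacts [le_rfl, p5]
  · rw [h2, if_neg (fun hb => h3 (p5 hb)), if_neg h3]

/-- The lower element lies in the algebra obtained by adjoining `w i` to the bottom of the node, but
not in that bottom; adjoining `w i` affects only degrees of the form `wd i + β`. -/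
theorem Separates.exists_add_eq {a b : R} (haA : a ∈ A) (haB : a ∉ B) {i : ι}
    (h : Separates 𝒜 ψ P wd w A B a b i) {γ : Γ} (ha : a ∈ 𝒜 γ) : ∃ β, wd i + β = γ := by
  obtain ⟨hn, -⟩ := node_spec hP hA hB hBA haA haB i
  obtain ⟨p1, p2, p3, p4, p5, p6, p7⟩ := midAlg_spec hP h.2.1 hn.fst hn.snd hn.le
  by_contra hne
  push Not at hne
  refine hn.not_mem (hP.mem_of_ne _ i γ (hP.hom _ hn.fst) a ?_ ha hne)
  rcases h.cases hP hA hB hBA haA haB with ⟨h1, -⟩ | ⟨-, h1, -⟩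
  exacts [p5 h1, h1]

/-- Below the generator `w i`, no element of the same degree is active any more. -/
theorem wd_lt_of_mid {a : R} (haA : a ∈ A) (haB : a ∉ B) {i l : ι}
    (hact : Active w (node 𝒜 ψ P wd w A B a i) i)
    (hpath : path 𝒜 ψ P wd w A B a i = ((node 𝒜 ψ P wd w A B a i).1,
        midAlg 𝒜 ψ P wd w (node 𝒜 ψ P wd w A B a i).1 i))
    (hil : i < l) (hl : Active w (node 𝒜 ψ P wd w A B a l) l) : wd i < wd l := by
  obtain ⟨hn, -⟩ := node_spec hP hA hB hBA haA haB i
  obtain ⟨p1, p2, p3, p4, p5, p6, p7⟩ := midAlg_spec hP hact hn.fst hn.snd hn.le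
  obtain ⟨-, hl2⟩ := node_spec hP hA hB hBA haA haB l
  obtain ⟨hr1, hr2⟩ := hl2 i hil
  rw [hpath] at hr1 hr2
  refine lt_of_le_of_ne (not_lt.1 fun h => (hP.lt_of_lt l i h).not_gt hil) fun h => hl.2.1 (hr1 ?_)
  have h1 := hr2 hl.1
  -- If `w l` had the degree of `w i`, it would be `c • w i` modulo the bottom of the node. A
  -- nonzero `c` would put `w i` into the middle algebra, and `c = 0` would put `w l` into the
  -- bottom.
  obtain ⟨c, hc⟩ := hP.smul_sub_mem _ i (hP.hom _ hn.fst) (w l) (p5 h1) (h ▸ hP.mem l)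
  by_cases hc0 : c = 0
  · rw [hc0, zero_smul, sub_zero] at hc
    exact hc
  · refine absurd ?_ p6
    have h2 : c • w i ∈ midAlg 𝒜 ψ P wd w (node 𝒜 ψ P wd w A B a i).1 i := by
      have := sub_mem h1 (p4 hc)
      rwa [sub_sub_cancel] at this
    have := Subalgebra.smul_mem _ h2 c⁻¹
    rwa [smul_smul, inv_mul_cancel₀ hc0, one_smul] at this

/-- Induction on a bound for the room `β` left between `wd i` and `γ` at a separation. At the first
separation inside `S` only the pieces from the middle algebra downwards or the elementary piece can
hold a minimum. Later separations below the middle algebra happen at larger degrees and so leave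
less room. -/
theorem exists_min_of_bound [WellFoundedLT Γ] [IsOrderedCancelAddMonoid Γ] {γ : Γ} (β₀ : Γ)
    (S : Set R) (hne : S.Nonempty) (hS : ∀ a ∈ S, a ∈ A ∧ a ∉ B ∧ a ∈ 𝒜 γ)
    (hbd : ∀ a ∈ S, ∀ b ∈ S, ∀ i, Separates 𝒜 ψ P wd w A B a b i → ∃ β < β₀, wd i + β = γ) :
    ∃ a ∈ S, ∀ b ∈ S, ∀ i, ¬ Separates 𝒜 ψ P wd w A B b a i := by
  induction β₀ using WellFoundedLT.induction generalizing S with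
  | ind β₀ ih =>
    by_cases hsep : ∃ i, ∃ a ∈ S, ∃ b ∈ S, Separates 𝒜 ψ P wd w A B a b i
    swap
    · push Not at hsep
      obtain ⟨a, ha⟩ := hne
      exact ⟨a, ha, fun b hb i => hsep i b hb a ha⟩
    obtain ⟨i, ⟨a₀, ha₀, b₀, hb₀, h0⟩, hmin⟩ := (wellFounded_lt (α := ι)).has_min
      {i | ∃ a ∈ S, ∃ b ∈ S, Separates 𝒜 ψ P wd w A B a b i} hsep
    have hmin' : ∀ c ∈ S, ∀ d ∈ S, ∀ l, Separates 𝒜 ψ P wd w A B c d l → i ≤ l :=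
      fun c hc d hd l h => not_lt.1 (hmin l ⟨c, hc, d, hd, h⟩)
    have hsame : ∀ c ∈ S, ∀ j < i, path 𝒜 ψ P wd w A B c j = path 𝒜 ψ P wd w A B a₀ j := by
      intro c hc j hj
      rcases path_eq_or_separates (𝒜 := 𝒜) (ψ := ψ) (P := P) (wd := wd) (w := w) (A := A) (B := B)
        c a₀ with h | ⟨l, h | h⟩
      · rw [h]
      · exact h.1 j (hj.trans_le (hmin' c hc a₀ ha₀ l h))
      · exact (h.1 j (hj.trans_le (hmin' a₀ ha₀ c hc l h))).symm
    have hnode : ∀ c ∈ S, node 𝒜 ψ P wd w A B c i = node 𝒜 ψ P wd w A B a₀ i :=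
      fun c hc => node_congr (hsame c hc)
    have hact := h0.2.1
    obtain ⟨β, hβ, hβγ⟩ := hbd a₀ ha₀ b₀ hb₀ i h0
    obtain ⟨hn, -⟩ := node_spec hP hA hB hBA (hS a₀ ha₀).1 (hS a₀ ha₀).2.1 i
    obtain ⟨p1, p2, p3, p4, p5, p6, p7⟩ := midAlg_spec hP hact hn.fst hn.snd hn.le
    let E := midAlg 𝒜 ψ P wd w (node 𝒜 ψ P wd w A B a₀ i).1 i
    have hpathE : ∀ c ∈ S, c ∈ E → path 𝒜 ψ P wd w A B c i =
        ((node 𝒜 ψ P wd w A B a₀ i).1, E) := fun c hc hcE => by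
      rw [path_eq, hnode c hc, stepInterval, if_pos hact, if_pos hcE]
    -- The elements of `S` in `E` lie below the rest of `S`, so a minimum is sought among them, with
    -- `β` as the new bound.
    by_cases hE : ∃ c ∈ S, c ∈ E
    · obtain ⟨a, ⟨haS, haE⟩, ha⟩ := ih β hβ {c | c ∈ S ∧ c ∈ E} hE (fun c hc => hS c hc.1) (by
        rintro c ⟨hc, hcE⟩ d ⟨hd, hdE⟩ l hl
        have hil : i < l := by
          refine lt_of_le_of_ne (hmin' c hc d hd l hl) ?_
          rintro rfl
          have h := hl.2.2
          rw [hnode c hc] at h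
          exact h.elim (fun h => h.2 hdE) fun h => h.2 (p5 hdE)
        have hwd : wd i < wd l := by
          refine wd_lt_of_mid hP hA hB hBA (hS c hc).1 (hS c hc).2.1 ?_ ?_ hil hl.2.1
          · rw [hnode c hc]; exact hact
          · rw [hnode c hc]; exact hpathE c hc hcE
        obtain ⟨β', -, hβ'⟩ := hbd c hc d hd l hl
        refine ⟨β', ?_, hβ'⟩
        by_contra hlt
        have h1 : wd i + β < wd l + β' := add_lt_add_of_lt_of_le hwd (not_lt.1 hlt)
        rw [hβγ, hβ'] at h1
        exact lt_irrefl _ h1)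
      refine ⟨a, haS, fun b hb l hl => ?_⟩
      by_cases hbE : b ∈ E
      · exact ha b ⟨hb, hbE⟩ l hl
      rcases (hmin' b hb a haS l hl).eq_or_lt with rfl | hil
      · have h := hl.2.2
        rw [hnode b hb] at h
        exact h.elim (fun h => h.2 haE) fun h => h.2 (p5 haE)
      · refine hbE ?_
        have h1 := (path_spec hP hA hB hBA (hS b hb).1 (hS b hb).2.1 i).1.mem
        rwa [hl.1 i hil, hpathE a haS haE] at h1
    -- Now `a₀` lies in the elementary middle piece. Its interval is final, and no element of `S`
    -- lies lower.
    · push Not at hE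
      have hD : a₀ ∈ extend (node 𝒜 ψ P wd w A B a₀ i).1 (w i) := by
        rcases h0.2.2 with h | h
        exacts [absurd h.1 (hE a₀ ha₀), h.1]
      have hset : SettledAt 𝒜 ψ wd w (path 𝒜 ψ P wd w A B a₀ i) i := by
        rw [path_eq, stepInterval, if_pos hact, if_neg (hE a₀ ha₀), if_pos hD]
        exact ⟨p6, p7⟩
      refine ⟨a₀, ha₀, fun b hb l hl => ?_⟩
      rcases (hmin' b hb a₀ ha₀ l hl).eq_or_lt with rfl | hil
      · have h := hl.2.2
        rw [hnode b hb] at h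
        exact h.elim (fun h => hE b hb h.1) fun h => h.2 hD
      · have h1 := path_eq_of_settled hP hA hB hBA (hS a₀ ha₀).1 (hS a₀ ha₀).2.1 le_rfl hset hil
        have h2 := hl.2.1
        rw [node_congr hl.1, h1.1] at h2
        exact hset.not_active hil h2

/-- The inclusion `B ≤ A` can be refined to a chain of nice steps `U a ≤ T a`, one around each
homogeneous element `a` of `A` outside `B`, which is well-founded in each degree. -/
theorem exists_chain [WellFoundedLT Γ] [IsOrderedCancelAddMonoid Γ] (hpos : ∀ γ : Γ, 0 ≤ γ)
    (hzero : ∀ x ∈ 𝒜 0, x ∈ B) :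
    ∃ U T : R → Subalgebra k R,
      (∀ γ, ∀ a ∈ 𝒜 γ, a ∈ A → a ∉ B → P (U a) ∧ P (T a) ∧ B ≤ U a ∧ T a ≤ A ∧ a ∈ T a ∧ a ∉ U a ∧
        ∃ z d h, NiceStep 𝒜 ψ (U a) (T a) z d h) ∧
      (∀ a b, a ∈ A → a ∉ B → b ∈ A → b ∉ B →
        (U a = U b ∧ T a = T b) ∨ T a ≤ U b ∨ T b ≤ U a) ∧
      ∀ γ, ∀ S : Set R, S.Nonempty → (∀ a ∈ S, a ∈ A ∧ a ∉ B ∧ a ∈ 𝒜 γ) →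
        ∃ a ∈ S, ∀ b ∈ S, ¬ T b ≤ U a := by
  refine ⟨fun a => (final 𝒜 ψ P wd w A B a).1, fun a => (final 𝒜 ψ P wd w A B a).2, ?_, ?_, ?_⟩
  · intro γ a ha haA haB
    obtain ⟨h1, -⟩ := final_spec hP hA hB hBA haA haB
    obtain ⟨i, j, -, ⟨-, h2⟩, h3⟩ := exists_settled hP hA hB hBA haA haB ha
    rw [← h3] at h2
    exact ⟨h1.fst, h1.snd, h1.ge_bot, h1.le_top, h1.mem, h1.not_mem, _, _, h2⟩
  · intro a b haA haB hbA hbB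
    rcases path_eq_or_separates (𝒜 := 𝒜) (ψ := ψ) (P := P) (wd := wd) (w := w) (A := A) (B := B)
        a b with h | ⟨l, h | h⟩
    · have := final_congr h
      simp only [this, true_and, true_or]
    · exact Or.inr (Or.inl (h.final_le hP hA hB hBA haA haB hbA hbB))
    · exact Or.inr (Or.inr (h.final_le hP hA hB hBA hbA hbB haA haB))
  · intro γ S hne hS
    obtain ⟨a, ha, hmin⟩ := exists_min_of_bound hP hA hB hBA (γ := γ) (γ + γ) S hne hS (by
      intro a ha b hb i h
      obtain ⟨β, hβ⟩ := h.exists_add_eq hP hA hB hBA (hS a ha).1 (hS a ha).2.1 (hS a ha).2.2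
      have h0 : γ ≠ 0 := by
        rintro rfl
        exact (hS a ha).2.1 (hzero a (hS a ha).2.2)
      -- The starting bound `γ + γ` works because `wd i + β = γ` gives `β ≤ γ`, and `γ ≠ 0`.
      refine ⟨β, lt_of_le_of_lt ?_ (lt_add_of_pos_left γ (lt_of_le_of_ne (hpos γ) h0.symm)), hβ⟩
      rw [← hβ]
      exact le_add_of_nonneg_left (hpos _))
    refine ⟨a, ha, fun b hb hle => ?_⟩
    obtain ⟨haA, haB, -⟩ := hS a ha
    obtain ⟨hbA, hbB, -⟩ := hS b hb
    have hfa := (final_spec hP hA hB hBA haA haB).1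
    have hfb := (final_spec hP hA hB hBA hbA hbB).1
    refine hfb.not_mem ?_
    rcases path_eq_or_separates (𝒜 := 𝒜) (ψ := ψ) (P := P) (wd := wd) (w := w) (A := A) (B := B)
        a b with h | ⟨l, h | h⟩
    · have : b ∈ (final 𝒜 ψ P wd w A B a).1 := hle hfb.mem
      rwa [final_congr h] at this
    · exact h.final_le hP hA hB hBA haA haB hbA hbB (hfa.le (hle hfb.mem))
    · exact absurd h (hmin b hb l)

end Comparison

/-! ### PBW monomials -/

section Monomials

variable {R Ξ : Type*} [Ring R]

/-- The place of `z ξ` inside the ordered product is isolated for an arbitrary order `o`, which need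
not make `ξ` the largest index. The two lists do not depend on the exponent `n`. -/
theorem exists_pbwMonomial_eq (o : LinearOrder Ξ) (z : Ξ → R) {r : Ξ →₀ ℕ} {ξ : Ξ} (hr : r ξ = 0) :
    ∃ l₁ l₂ : List Ξ, (∀ η ∈ l₁, η ∈ r.support) ∧ (∀ η ∈ l₂, η ∈ r.support) ∧
      pbwMonomial o z r = (l₁.map fun η => z η ^ r η).prod * (l₂.map fun η => z η ^ r η).prod ∧
      ∀ n, pbwMonomial o z (r + Finsupp.single ξ n) =
        (l₁.map fun η => z η ^ r η).prod * z ξ ^ n * (l₂.map fun η => z η ^ r η).prod := by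
  classical
  have hξ : ξ ∉ r.support := by simpa using hr
  obtain ⟨l₁, l₂, hl⟩ := List.append_of_mem
    ((Finset.mem_sort (fun a b => o.le a b)).2 (Finset.mem_insert_self ξ r.support))
  have hnd : (l₁ ++ ξ :: l₂).Nodup := by
    rw [← hl]
    exact Finset.sort_nodup _ _
  have hpw : (l₁ ++ ξ :: l₂).Pairwise (fun a b => o.le a b) := by
    rw [← hl]
    exact Finset.pairwise_sort _ _
  have hnd' : (l₁ ++ l₂).Nodup := hnd.sublist (by simp)
  have hξl : ξ ∉ l₁ ++ l₂ := by
    rw [List.nodup_middle, List.nodup_cons] at hnd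
    exact hnd.1
  have hfin : (l₁ ++ l₂).toFinset = r.support := by
    have h1 : (l₁ ++ ξ :: l₂).toFinset = insert ξ r.support := by
      rw [← hl, Finset.sort_toFinset]
    ext η
    have h2 := Finset.ext_iff.1 h1 η
    simp only [List.mem_toFinset, List.mem_append, List.mem_cons, Finset.mem_insert] at h2 hξl ⊢
    by_cases hη : η = ξ
    · subst hη
      exact ⟨fun h => absurd h hξl, fun h => absurd h hξ⟩
    · simpa [hη] using h2
  have hsort : r.support.sort (fun a b => o.le a b) = l₁ ++ l₂ := by
    rw [← hfin]
    exact (List.toFinset_sort _ hnd').2 (hpw.sublist (by simp))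
  have hmem : ∀ η ∈ l₁ ++ l₂, η ∈ r.support := fun η hη => by
    rw [← hfin]
    exact List.mem_toFinset.2 hη
  have h0 : pbwMonomial o z r =
      (l₁.map fun η => z η ^ r η).prod * (l₂.map fun η => z η ^ r η).prod := by
    rw [pbwMonomial, hsort, List.map_append, List.prod_append]
  refine ⟨l₁, l₂, fun η h => hmem η (List.mem_append_left _ h),
    fun η h => hmem η (List.mem_append_right _ h), h0, fun n => ?_⟩
  rcases Nat.eq_zero_or_pos n with rfl | hn
  · rw [Finsupp.single_zero, add_zero, pow_zero, mul_one, h0]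
  have hsupp : (r + Finsupp.single ξ n).support = insert ξ r.support := by
    ext η
    by_cases hη : η = ξ
    · subst hη
      simp [hn.ne']
    · simp [hη]
  have hmap : ∀ l : List Ξ, ξ ∉ l →
      (l.map fun η => z η ^ (r + Finsupp.single ξ n) η) = l.map fun η => z η ^ r η :=
    fun l hξl => List.map_congr_left fun η hη => by
      have : ξ ≠ η := by rintro rfl; exact hξl hη
      simp [this]
  rw [pbwMonomial, hsupp, hl, List.map_append, List.prod_append, List.map_cons, List.prod_cons,
    hmap l₁ fun h => hξl (List.mem_append_left _ h),
    hmap l₂ fun h => hξl (List.mem_append_right _ h)]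
  simp [hr, mul_assoc]

theorem pbwMonomial_zero (o : LinearOrder Ξ) (z : Ξ → R) : pbwMonomial o z 0 = 1 := by
  simp [pbwMonomial]

variable {k Γ : Type*} [Field k] [Algebra k R] [AddCommMonoid Γ] [DecidableEq Γ]
  {𝒜 : Γ → Submodule k R} [GradedAlgebra 𝒜]

/-- The degree of a monomial. -/
noncomputable def weight (d : Ξ → Γ) (r : Ξ →₀ ℕ) : Γ := r.sum fun ξ n => n • d ξ

omit [DecidableEq Γ] in
theorem weight_add_single (d : Ξ → Γ) (r : Ξ →₀ ℕ) (ξ : Ξ) (n : ℕ) :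
    weight d (r + Finsupp.single ξ n) = weight d r + n • d ξ := by
  classical
  rw [weight, Finsupp.sum_add_index' (h := fun ξ n => n • d ξ) (fun _ => zero_nsmul _) (fun _ _ _ => add_nsmul _ _ _),
    Finsupp.sum_single_index (h := fun ξ n => n • d ξ) (zero_nsmul _)]
  rfl

theorem pbwMonomial_mem_graded (o : LinearOrder Ξ) {z : Ξ → R} {d : Ξ → Γ}
    (hz : ∀ ξ, z ξ ∈ 𝒜 (d ξ)) (r : Ξ →₀ ℕ) : pbwMonomial o z r ∈ 𝒜 (weight d r) := by
  have h1 : weight d r = ((r.support.sort fun a b => o.le a b).map fun ξ => r ξ • d ξ).sum := by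
    rw [((Finset.sort_perm_toList _ _).map _).sum_eq, Finset.sum_map_toList]
    rfl
  rw [h1]
  exact SetLike.list_prod_map_mem_graded _ _ _ fun ξ _ => SetLike.pow_mem_graded _ (hz ξ)

theorem pbwMonomial_mem (o : LinearOrder Ξ) {z : Ξ → R} {r : Ξ →₀ ℕ} {K : Subalgebra k R}
    (h : ∀ ξ ∈ r.support, z ξ ∈ K) : pbwMonomial o z r ∈ K := by
  refine list_prod_mem fun x hx => ?_
  obtain ⟨ξ, hξ, rfl⟩ := List.mem_map.1 hx
  exact pow_mem (h ξ ((Finset.mem_sort _).1 hξ)) _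

end Monomials

/-! ### Nice steps -/

section Step

variable {k R Γ : Type*} [Field k] [Ring R] [Algebra k R] [AddCommMonoid Γ] [DecidableEq Γ]
  {𝒜 : Γ → Submodule k R} [GradedAlgebra 𝒜] {ψ : Bicharacter k Γ}
  {E D : Subalgebra k R} {z : R} {γ : Γ} {h : ℕ∞}

theorem proj_mem_powSpan [IsCancelAdd Γ] (hE : IsHom 𝒜 E) (hz : z ∈ 𝒜 γ) (n : ℕ) (δ : Γ) {x : R}
    (hx : x ∈ powSpan E z n) : GradedAlgebra.proj 𝒜 δ x ∈ powSpan E z n := by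
  have : powSpan E z n ≤ (powSpan E z n).comap (GradedAlgebra.proj 𝒜 δ) := by
    refine Submodule.span_le.2 ?_
    rintro _ ⟨u, hu, i, hi, rfl⟩
    change GradedAlgebra.proj 𝒜 δ (u * z ^ i) ∈ powSpan E z n
    have hzi : z ^ i ∈ 𝒜 (i • γ) := SetLike.pow_mem_graded i hz
    by_cases hα : ∃ α, α + i • γ = δ
    · obtain ⟨α, rfl⟩ := hα
      rw [proj_mul_right u hzi]
      exact mul_pow_mem_powSpan (hE α u hu) hi
    · push Not at hα
      rw [proj_mul_right_of_ne u hzi hα]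
      exact zero_mem _
  exact this hx

variable (hn : NiceStep 𝒜 ψ E D z γ h) (hE : IsHom 𝒜 E)
include hn hE

theorem NiceStep.exists_mul_sub_mem {u : R} (hu : u ∈ E) : ∃ v ∈ E, z * u - v * z ∈ E := by
  refine hE.induction (p := fun u => ∃ v ∈ E, z * u - v * z ∈ E) ⟨0, zero_mem _, by simp⟩ ?_ ?_ hu
  · rintro x y ⟨v, hv, hx⟩ ⟨v', hv', hy⟩
    refine ⟨v + v', add_mem hv hv', ?_⟩
    rw [mul_add, add_mul, add_sub_add_comm]
    exact add_mem hx hy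
  · intro β e he heβ
    refine ⟨(ψ γ β : k) • e, E.smul_mem he _, ?_⟩
    rw [smul_mul_assoc]
    exact hn.comm β e he heβ

theorem NiceStep.mul_mem_powSpan_succ {n : ℕ} {x : R} (hx : x ∈ powSpan E z n) :
    z * x ∈ powSpan E z (n + 1) := by
  have : powSpan E z n ≤ (powSpan E z (n + 1)).comap (LinearMap.mulLeft k z) := by
    refine Submodule.span_le.2 ?_
    rintro _ ⟨u, hu, i, hi, rfl⟩
    change z * (u * z ^ i) ∈ powSpan E z (n + 1)
    obtain ⟨v, hv, hv'⟩ := hn.exists_mul_sub_mem hE hu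
    have : z * (u * z ^ i) = v * z ^ (i + 1) + (z * u - v * z) * z ^ i := by
      rw [pow_succ']; noncomm_ring
    rw [this]
    exact add_mem (mul_pow_mem_powSpan hv (by omega)) (mul_pow_mem_powSpan hv' (by omega))
  exact this hx

/-- Powers of `z` commute with homogeneous elements of `E` up to scalars and lower powers. -/
theorem NiceStep.pow_mul_sub_mem {β : Γ} {y : R} (hy : y ∈ E) (hyβ : y ∈ 𝒜 β) (n : ℕ) :
    z ^ n * y - (ψ γ β : k) ^ n • (y * z ^ n) ∈ powSpan E z n := by
  induction n with
  | zero => simp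
  | succ n ih =>
    have h1 := hn.mul_mem_powSpan_succ hE ih
    have h2 : ((ψ γ β : k) ^ n • (z * y - (ψ γ β : k) • (y * z))) * z ^ n ∈
        powSpan E z (n + 1) :=
      mul_pow_mem_powSpan (E.smul_mem (hn.comm β y hy hyβ) _) (Nat.lt_succ_self n)
    convert add_mem h1 h2 using 1
    rw [pow_succ' z, pow_succ (ψ γ β : k), mul_sub, mul_smul_comm, smul_mul_assoc, sub_mul,
      smul_mul_assoc, smul_sub, smul_smul]
    simp only [mul_assoc]
    abel

theorem NiceStep.mul_pow_mul_sub_mem {β : Γ} {x y : R} (hx : x ∈ E) (hy : y ∈ E) (hyβ : y ∈ 𝒜 β)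
    (n : ℕ) : x * z ^ n * y - (ψ γ β : k) ^ n • (x * y * z ^ n) ∈ powSpan E z n := by
  have := mul_mem_powSpan hx (hn.pow_mul_sub_mem hE hy hyβ n)
  rwa [mul_sub, mul_smul_comm, ← mul_assoc, ← mul_assoc] at this

/-- The span `W` of the `u * z ^ i` below the height contains `1` and is stable under left
multiplication by `E` and by `z`, hence by `D`. -/
theorem NiceStep.exists_mem_powSpan {x : R} (hx : x ∈ D) :
    ∃ n : ℕ, (n : ℕ∞) ≤ h ∧ x ∈ powSpan E z n := by
  let W : Submodule k R := Submodule.span k {x | ∃ u ∈ E, ∃ i : ℕ, (i : ℕ∞) < h ∧ x = u * z ^ i}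
  have hW : ∀ u ∈ E, ∀ i : ℕ, (i : ℕ∞) < h → u * z ^ i ∈ W := fun u hu i hi =>
    Submodule.subset_span ⟨u, hu, i, hi, rfl⟩
  have h0 : ((0 : ℕ) : ℕ∞) < h := lt_of_lt_of_le (by norm_num) hn.two_le
  have hEW : ∀ u ∈ E, ∀ y ∈ W, u * y ∈ W := fun u hu => by
    have : W ≤ W.comap (LinearMap.mulLeft k u) := Submodule.span_le.2 (by
      rintro _ ⟨v, hv, i, hi, rfl⟩
      change u * (v * z ^ i) ∈ W
      rw [← mul_assoc]
      exact hW _ (mul_mem hu hv) i hi)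
    exact fun y hy => this hy
  have hzW : ∀ y ∈ W, z * y ∈ W := by
    have : W ≤ W.comap (LinearMap.mulLeft k z) := Submodule.span_le.2 (by
      rintro _ ⟨u, hu, i, hi, rfl⟩
      change z * (u * z ^ i) ∈ W
      obtain ⟨v, hv, hv'⟩ := hn.exists_mul_sub_mem hE hu
      have : z * (u * z ^ i) = v * z ^ (i + 1) + (z * u - v * z) * z ^ i := by
        rw [pow_succ']; noncomm_ring
      rw [this]
      refine add_mem ?_ (hW _ hv' i hi)
      -- When `i + 1` reaches the height, `z ^ (i + 1)` lies in `E` and is absorbed into the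
      -- coefficient.
      rcases lt_or_eq_of_le (Order.add_one_le_of_lt hi) with h1 | h1
      · exact hW v hv (i + 1) (by exact_mod_cast h1)
      · have := hn.pow_mem (i + 1) (by rw [← h1]; norm_cast)
        have h2 := hW _ (mul_mem hv this) 0 h0
        rwa [pow_zero, mul_one] at h2)
    exact fun y hy => this hy
  have hDW : ∀ y ∈ W, x * y ∈ W := by
    rw [hn.eq_extend, extend] at hx
    induction hx using Algebra.adjoin_induction with
    | mem x hx =>
      rcases hx with rfl | hx
      exacts [hzW, hEW x hx]
    | algebraMap r => exact hEW _ (E.algebraMap_mem r)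
    | add x y _ _ hx hy => exact fun w hw => by rw [add_mul]; exact add_mem (hx w hw) (hy w hw)
    | mul x y _ _ hx hy => exact fun w hw => by rw [mul_assoc]; exact hx _ (hy w hw)
  have hxW : x ∈ W := by
    have := hDW _ (hW 1 (one_mem E) 0 h0)
    rwa [pow_zero, mul_one, mul_one] at this
  refine Submodule.span_induction ?_ ⟨0, by simp, zero_mem _⟩ ?_ ?_ hxW
  · rintro _ ⟨u, hu, i, hi, rfl⟩
    exact ⟨i + 1, by exact_mod_cast Order.add_one_le_of_lt hi,
      mul_pow_mem_powSpan hu (Nat.lt_succ_self i)⟩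
  · rintro x y _ _ ⟨n, hn, hx⟩ ⟨m, hm, hy⟩
    rcases le_total n m with hnm | hnm
    · exact ⟨m, hm, add_mem (powSpan_mono _ _ hnm hx) hy⟩
    · exact ⟨n, hn, add_mem hx (powSpan_mono _ _ hnm hy)⟩
  · rintro c x _ ⟨n, hn, hx⟩
    exact ⟨n, hn, Submodule.smul_mem _ c hx⟩

end Step

/-! ### PBW bases from chains of nice steps -/

section PBW

/-- A linear order that is not to be found by instance resolution. -/
def OrderOn (Ξ : Type*) := LinearOrder Ξ

variable {k R Γ Ξ : Type*} [Field k] [Ring R] [Algebra k R] [AddCommMonoid Γ] [LinearOrder Γ]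
  [LinearOrder Ξ]

/-- Multiplication by a coefficient from the left or from the right. -/
def Side.term : Side → R → R → R
  | .left, b, m => b * m
  | .right, b, m => m * b

/-- A chain of nice steps `U ξ ≤ T ξ` above `B`, well-founded in each degree. -/
structure IsPBWChain (𝒜 : Γ → Submodule k R) [GradedAlgebra 𝒜] (ψ : Bicharacter k Γ)
    (B : Subalgebra k R) (U T : Ξ → Subalgebra k R) (z : Ξ → R) (d : Ξ → Γ) (h : Ξ → ℕ∞) :
    Prop where
  hom_bot : IsHom 𝒜 B
  hom : ∀ ξ, IsHom 𝒜 (U ξ)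
  hom_top : ∀ ξ, IsHom 𝒜 (T ξ)
  nice : ∀ ξ, NiceStep 𝒜 ψ (U ξ) (T ξ) (z ξ) (d ξ) (h ξ)
  bot_le : ∀ ξ, B ≤ U ξ
  le_of_lt : ∀ η ξ, η < ξ → T η ≤ U ξ
  descend : ∀ γ, ∀ x ∈ 𝒜 γ, ∀ ξ, x ∈ U ξ → x ∉ B → ∃ η < ξ, x ∈ T η ∧ x ∉ U η
  wf : ∀ γ, {ξ | ∃ x ∈ 𝒜 γ, x ∈ T ξ ∧ x ∉ U ξ}.IsWF

variable {𝒜 : Γ → Submodule k R} [GradedAlgebra 𝒜] {ψ : Bicharacter k Γ} {B : Subalgebra k R}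
  {U T : Ξ → Subalgebra k R} {z : Ξ → R} {d : Ξ → Γ} {h : Ξ → ℕ∞}

/-- The exponents `r` with `r ξ < h ξ` for all `ξ` in the support. -/
def ValidExponent (h : Ξ → ℕ∞) (r : Ξ →₀ ℕ) : Prop := ∀ ξ ∈ r.support, (r ξ : ℕ∞) < h ξ

/-- The span of the elements of degree `γ` that are homogeneous multiples of monomials in the
generators with index in `S`. -/
def pbwSpan (𝒜 : Γ → Submodule k R) (s : Side) (o : OrderOn Ξ) (z : Ξ → R) (d : Ξ → Γ)
    (h : Ξ → ℕ∞) (B : Subalgebra k R) (S : Set Ξ) (γ : Γ) : Submodule k R :=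
  Submodule.span k {x | ∃ b ∈ B, ∃ β, b ∈ 𝒜 β ∧ ∃ r : Ξ →₀ ℕ, (r.support : Set Ξ) ⊆ S ∧
    ValidExponent h r ∧ β + weight d r = γ ∧ x = s.term b (pbwMonomial o z r)}

omit [LinearOrder Ξ] [LinearOrder Γ] in
theorem pbwSpan_mono (s : Side) (o : OrderOn Ξ) {S S' : Set Ξ} (hS : S ⊆ S') (γ : Γ) :
    pbwSpan 𝒜 s o z d h B S γ ≤ pbwSpan 𝒜 s o z d h B S' γ := by
  refine Submodule.span_mono ?_
  rintro x ⟨b, hb, β, hβ, r, hr, h⟩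
  exact ⟨b, hb, β, hβ, r, hr.trans hS, h⟩

omit [LinearOrder Ξ] [LinearOrder Γ] [GradedAlgebra 𝒜] in
theorem mem_pbwSpan_of_mem (s : Side) (o : OrderOn Ξ) (S : Set Ξ) {γ : Γ} {b : R} (hb : b ∈ B)
    (hbγ : b ∈ 𝒜 γ) : b ∈ pbwSpan 𝒜 s o z d h B S γ := by
  refine Submodule.subset_span ⟨b, hb, γ, hbγ, 0, by simp, fun ξ hξ => by simp at hξ,
    by simp [weight], ?_⟩
  have h1 : pbwMonomial o z (0 : Ξ →₀ ℕ) = 1 := pbwMonomial_zero o z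
  cases s <;> simp [Side.term, h1]

theorem term_mem_graded {s : Side} {β γ : Γ} {b m : R} (hb : b ∈ 𝒜 β) (hm : m ∈ 𝒜 γ) :
    s.term b m ∈ 𝒜 (β + γ) := by
  cases s
  · exact SetLike.mul_mem_graded hb hm
  · rw [add_comm]
    exact SetLike.mul_mem_graded hm hb

variable (hch : IsPBWChain 𝒜 ψ B U T z d h)
include hch

theorem IsPBWChain.le (ξ : Ξ) : U ξ ≤ T ξ := by
  rw [(hch.nice ξ).eq_extend]
  exact le_extend _ _

theorem IsPBWChain.gen_mem (ξ : Ξ) : z ξ ∈ T ξ := by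
  rw [(hch.nice ξ).eq_extend]
  exact self_mem_extend _ _

theorem IsPBWChain.pbwSpan_le (s : Side) (o : OrderOn Ξ) (S : Set Ξ) (γ : Γ) :
    pbwSpan 𝒜 s o z d h B S γ ≤ 𝒜 γ := by
  refine Submodule.span_le.2 ?_
  rintro _ ⟨b, hb, β, hβ, r, -, -, rfl, rfl⟩
  exact term_mem_graded hβ (pbwMonomial_mem_graded o (fun ξ => (hch.nice ξ).mem_deg) r)

/-- A monomial with top generator `z ξ` is up to a scalar and lower powers of `z ξ` a multiple of
the power of `z ξ`. -/
theorem IsPBWChain.exists_term_sub_mem (s : Side) (o : OrderOn Ξ) {ξ : Ξ} {r : Ξ →₀ ℕ}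
    (hr : ∀ η ∈ r.support, η < ξ) {b : R} (hb : b ∈ B) {β : Γ} (hbβ : b ∈ 𝒜 β) (n : ℕ) :
    ∃ q : k, q ≠ 0 ∧ s.term b (pbwMonomial o z r) ∈ U ξ ∧
      s.term b (pbwMonomial o z (r + Finsupp.single ξ n)) -
        q • (s.term b (pbwMonomial o z r) * z ξ ^ n) ∈ powSpan (U ξ) (z ξ) n := by
  have hrξ : r ξ = 0 := by
    by_contra hne
    exact lt_irrefl ξ (hr ξ (Finsupp.mem_support_iff.2 hne))
  obtain ⟨l₁, l₂, h₁, h₂, h0, hn⟩ := exists_pbwMonomial_eq o z hrξ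
  have hmem : ∀ l : List Ξ, (∀ η ∈ l, η ∈ r.support) → (l.map fun η => z η ^ r η).prod ∈ U ξ := by
    intro l hl
    refine list_prod_mem fun x hx => ?_
    obtain ⟨η, hη, rfl⟩ := List.mem_map.1 hx
    exact pow_mem (hch.le_of_lt η ξ (hr η (hl η hη)) (hch.gen_mem η)) _
  have hgr : ∀ l : List Ξ, (l.map fun η => z η ^ r η).prod ∈
      𝒜 (l.map fun η => r η • d η).sum := fun l =>
    SetLike.list_prod_map_mem_graded _ _ _ fun η _ =>
      SetLike.pow_mem_graded _ (hch.nice η).mem_deg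
  have hbU := hch.bot_le ξ hb
  have hne : ∀ α n, ((ψ (d ξ) α : k)) ^ n ≠ 0 := fun α n => pow_ne_zero _ (Units.ne_zero _)
  rw [h0, hn]
  cases s with
  | left =>
    -- The scalar comes from moving `z ξ ^ n` to the right through the generators that follow it; in
    -- the right-module version it also passes the coefficient `b`.
    refine ⟨_, hne (l₂.map fun η => r η • d η).sum n, mul_mem hbU (mul_mem (hmem l₁ h₁) (hmem l₂ h₂)), ?_⟩
    have := (hch.nice ξ).mul_pow_mul_sub_mem (hch.hom ξ) (mul_mem hbU (hmem l₁ h₁)) (hmem l₂ h₂)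
      (hgr l₂) n
    simpa only [Side.term, mul_assoc] using this
  | right =>
    refine ⟨_, hne ((l₂.map fun η => r η • d η).sum + β) n, mul_mem (mul_mem (hmem l₁ h₁) (hmem l₂ h₂)) hbU, ?_⟩
    have := (hch.nice ξ).mul_pow_mul_sub_mem (hch.hom ξ) (hmem l₁ h₁) (mul_mem (hmem l₂ h₂) hbU)
      (SetLike.mul_mem_graded (hgr l₂) hbβ) n
    simpa only [Side.term, mul_assoc] using this

variable [IsOrderedCancelAddMonoid Γ]

section Spanning

variable [WellFoundedLT Γ] (hpos : ∀ γ : Γ, 0 ≤ γ)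
include hpos

-- Induction on the number of powers: the homogeneous leading coefficient is replaced by PBW
-- monomials in smaller generators, and the correction involves only lower powers of `z ξ`.
omit [WellFoundedLT Γ] in
theorem IsPBWChain.mem_pbwSpan_of_powSpan (s : Side) (o : OrderOn Ξ) {γ : Γ} {ξ : Ξ}
    (hU : ∀ α ≤ γ, ∀ x ∈ 𝒜 α, x ∈ U ξ → x ∈ pbwSpan 𝒜 s o z d h B {η | η < ξ} α) {n : ℕ}
    (hn : (n : ℕ∞) ≤ h ξ) {x : R} (hx : x ∈ 𝒜 γ) (hxn : x ∈ powSpan (U ξ) (z ξ) n) :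
    x ∈ pbwSpan 𝒜 s o z d h B {η | η ≤ ξ} γ := by
  induction n generalizing x with
  | zero =>
    rw [powSpan_zero, Submodule.mem_bot] at hxn
    rw [hxn]
    exact zero_mem _
  | succ n ih =>
    have hnice := hch.nice ξ
    have hlt : (n : ℕ∞) < h ξ := lt_of_lt_of_le (by exact_mod_cast Nat.lt_succ_self n) hn
    obtain ⟨u, hu, hxu⟩ := exists_of_mem_powSpan_succ hxn
    have hzn : z ξ ^ n ∈ 𝒜 (n • d ξ) := SetLike.pow_mem_graded n hnice.mem_deg
    have hproj := proj_mem_powSpan (hch.hom ξ) hnice.mem_deg n γ hxu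
    rw [map_sub, proj_same hx] at hproj
    by_cases hα : ∃ α, α + n • d ξ = γ
    swap
    · push Not at hα
      rw [proj_mul_right_of_ne u hzn hα, sub_zero] at hproj
      exact ih hlt.le hx hproj
    obtain ⟨α, rfl⟩ := hα
    rw [proj_mul_right u hzn] at hproj
    have hv := hU α (le_add_of_nonneg_right (hpos _)) _ (proj_mem 𝒜 α u) (hch.hom ξ α u hu)
    -- A monomial times `z ξ ^ n` is exchanged for the correctly ordered monomial with exponent `n`
    -- at `ξ`, divided by the scalar `q`.
    have key : ∀ v ∈ pbwSpan 𝒜 s o z d h B {η | η < ξ} α,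
        ∃ t ∈ pbwSpan 𝒜 s o z d h B {η | η ≤ ξ} (α + n • d ξ),
          v * z ξ ^ n - t ∈ powSpan (U ξ) (z ξ) n := by
      intro v hv
      refine Submodule.span_induction ?_ ⟨0, zero_mem _, by simp⟩ ?_ ?_ hv
      · rintro _ ⟨b, hb, β, hβ, r, hr, hrh, rfl, rfl⟩
        obtain ⟨q, hq, -, h2⟩ := hch.exists_term_sub_mem s o (fun η hη => hr hη) hb hβ n
        refine ⟨q⁻¹ • s.term b (pbwMonomial o z (r + Finsupp.single ξ n)),
          Submodule.smul_mem _ _ (Submodule.subset_span ⟨b, hb, β, hβ, _, ?_, ?_, ?_, rfl⟩), ?_⟩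
        · intro η hη
          by_cases hηξ : η = ξ
          · exact hηξ.le
          · have hηr : η ∈ r.support := by
              simpa [Finsupp.single_apply, Ne.symm hηξ] using hη
            exact (hr hηr).le
        · intro η hη
          by_cases hηξ : η = ξ
          · subst hηξ
            have : r η = 0 := by
              by_contra hne
              exact lt_irrefl η (hr (Finsupp.mem_support_iff.2 hne))
            simpa [this] using hlt
          · have hηr : η ∈ r.support := by
              simpa [Finsupp.single_apply, Ne.symm hηξ] using hη
            simpa [Finsupp.single_apply, Ne.symm hηξ] using hrh η hηr
        · rw [weight_add_single, add_assoc]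
        · have := Submodule.smul_mem _ (-q⁻¹) h2
          rwa [smul_sub, smul_smul, neg_mul, inv_mul_cancel₀ hq, neg_smul, neg_smul, one_smul,
            sub_neg_eq_add, neg_add_eq_sub] at this
      · rintro v v' _ _ ⟨t, ht, hvt⟩ ⟨t', ht', hvt'⟩
        refine ⟨t + t', add_mem ht ht', ?_⟩
        rw [add_mul, add_sub_add_comm]
        exact add_mem hvt hvt'
      · rintro c v _ ⟨t, ht, hvt⟩
        refine ⟨c • t, Submodule.smul_mem _ c ht, ?_⟩
        rw [smul_mul_assoc, ← smul_sub]
        exact Submodule.smul_mem _ c hvt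
    obtain ⟨t, ht, htv⟩ := key _ hv
    have h3 := add_mem hproj htv
    rw [sub_add_sub_cancel] at h3
    rw [← sub_add_cancel x t]
    exact add_mem (ih hlt.le (sub_mem hx (hch.pbwSpan_le s o _ _ ht)) h3) ht

/-- The index order as a whole need not be a well-order, so the outer induction is on the degree.
Coefficients of smaller degree are covered for all indices at once; the degree `γ` itself uses
well-foundedness on the steps where degree `γ` grows. -/
theorem IsPBWChain.mem_pbwSpan (s : Side) (o : OrderOn Ξ) (γ : Γ) :
    ∀ ξ, ∀ x ∈ 𝒜 γ, x ∈ T ξ → x ∈ pbwSpan 𝒜 s o z d h B {η | η ≤ ξ} γ := by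
  induction γ using WellFoundedLT.induction with
  | ind γ ih =>
    have hlow : ∀ α ξ, (∀ η < ξ, ∀ x ∈ 𝒜 α, x ∈ T η → x ∉ U η →
        x ∈ pbwSpan 𝒜 s o z d h B {ζ | ζ ≤ η} α) →
        ∀ x ∈ 𝒜 α, x ∈ U ξ → x ∈ pbwSpan 𝒜 s o z d h B {η | η < ξ} α := by
      intro α ξ H x hx hxU
      by_cases hxB : x ∈ B
      · exact mem_pbwSpan_of_mem s o _ hxB hx
      · obtain ⟨η, hη, h1, h2⟩ := hch.descend α x hx ξ hxU hxB
        exact pbwSpan_mono s o (fun ζ hζ => lt_of_le_of_lt hζ hη) α (H η hη x hx h1 h2)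
    have hstep : ∀ ξ, (∀ η < ξ, ∀ x ∈ 𝒜 γ, x ∈ T η → x ∉ U η →
        x ∈ pbwSpan 𝒜 s o z d h B {ζ | ζ ≤ η} γ) →
        ∀ x ∈ 𝒜 γ, x ∈ T ξ → x ∈ pbwSpan 𝒜 s o z d h B {η | η ≤ ξ} γ := by
      intro ξ H x hx hxT
      obtain ⟨n, hn, hxn⟩ := (hch.nice ξ).exists_mem_powSpan (hch.hom ξ) hxT
      refine hch.mem_pbwSpan_of_powSpan hpos s o (fun α hα => ?_) hn hx hxn
      rcases hα.eq_or_lt with rfl | hα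
      · exact hlow α ξ H
      · exact hlow α ξ fun η _ x hx hxT _ => ih α hα η x hx hxT
    -- A least failing index exists because every failure lies in the well-founded set for degree
    -- `γ`.
    have hwf : ∀ ξ, ∀ x ∈ 𝒜 γ, x ∈ T ξ → x ∉ U ξ →
        x ∈ pbwSpan 𝒜 s o z d h B {η | η ≤ ξ} γ := by
      by_contra hne
      push Not at hne
      obtain ⟨ξ₀, x₀, hx₀, hxT₀, hxU₀, hx₀'⟩ := hne
      let S : Set Ξ := {ξ | ∃ x ∈ 𝒜 γ, x ∈ T ξ ∧ x ∉ U ξ ∧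
        x ∉ pbwSpan 𝒜 s o z d h B {η | η ≤ ξ} γ}
      have hS : S.IsWF := (hch.wf γ).mono fun ξ ⟨x, h1, h2, h3, _⟩ => ⟨x, h1, h2, h3⟩
      have hSne : S.Nonempty := ⟨ξ₀, x₀, hx₀, hxT₀, hxU₀, hx₀'⟩
      obtain ⟨x, hx, hxT, hxU, hx'⟩ := hS.min_mem hSne
      refine hx' (hstep _ (fun η hη y hy hyT hyU => ?_) x hx hxT)
      by_contra hy'
      exact hS.not_lt_min hSne (a := η) ⟨y, hy, hyT, hyU, hy'⟩ hη
    exact fun ξ => hstep ξ fun η _ => hwf η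

end Spanning

/-! ### Linear independence -/

/-- Induction on the generators involved, removing the largest `ξ`, and then on a bound for its
exponent. Modulo lower powers the relation is `u * z ξ ^ n` with `u ∈ U ξ`, so `u = 0` by freeness,
and that is a relation without `ξ`. -/
theorem IsPBWChain.coeff_eq_zero_of_graded (s : Side) (o : OrderOn Ξ) (S : Finset Ξ) :
    ∀ (E : Finset (Ξ →₀ ℕ)) (c : (Ξ →₀ ℕ) → R) (γ : Γ),
      (∀ r ∈ E, r.support ⊆ S ∧ ValidExponent h r ∧ c r ∈ B ∧
        ∃ β, c r ∈ 𝒜 β ∧ β + weight d r = γ) →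
      ∑ r ∈ E, s.term (c r) (pbwMonomial o z r) = 0 → ∀ r ∈ E, c r = 0 := by
  classical
  induction S using Finset.induction_on_max with
  | empty =>
    intro E c γ hE hsum r hr
    have h0 : ∀ r ∈ E, r = 0 := fun r hr => by
      simpa using (hE r hr).1
    rw [Finset.sum_eq_single r (fun r' hr' hne => absurd ((h0 r' hr').trans (h0 r hr).symm) hne)
      (fun h => absurd hr h), h0 r hr, show pbwMonomial o z (0 : Ξ →₀ ℕ) = 1 from pbwMonomial_zero o z] at hsum
    rw [h0 r hr]
    cases s <;> simpa [Side.term] using hsum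
  | insert ξ S hξ ih =>
    have main : ∀ n : ℕ, ∀ (E : Finset (Ξ →₀ ℕ)) (c : (Ξ →₀ ℕ) → R) (γ : Γ),
        (∀ r ∈ E, r.support ⊆ insert ξ S ∧ ValidExponent h r ∧ c r ∈ B ∧
          ∃ β, c r ∈ 𝒜 β ∧ β + weight d r = γ) → (∀ r ∈ E, r ξ < n) →
        ∑ r ∈ E, s.term (c r) (pbwMonomial o z r) = 0 → ∀ r ∈ E, c r = 0 := by
      intro n
      induction n with
      | zero => exact fun E c γ _ h1 _ r hr => absurd (h1 r hr) (Nat.not_lt_zero _)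
      | succ n ihn =>
        intro E c γ hE hlt hsum
        have hdec : ∀ r : Ξ →₀ ℕ, r = r.erase ξ + Finsupp.single ξ (r ξ) := fun r =>
          (Finsupp.erase_add_single ξ r).symm
        have hsupp : ∀ r ∈ E, (r.erase ξ).support ⊆ S := fun r hr η hη => by
          rw [Finsupp.support_erase, Finset.mem_erase] at hη
          exact (Finset.mem_insert.1 ((hE r hr).1 hη.2)).resolve_left hη.1
        have hterm : ∀ r ∈ E, ∃ q : k, q ≠ 0 ∧
            s.term (c r) (pbwMonomial o z (r.erase ξ)) ∈ U ξ ∧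
            s.term (c r) (pbwMonomial o z r) -
              q • (s.term (c r) (pbwMonomial o z (r.erase ξ)) * z ξ ^ r ξ) ∈
                powSpan (U ξ) (z ξ) (r ξ) := fun r hr => by
          obtain ⟨-, -, hc, β, hβ, -⟩ := hE r hr
          have := hch.exists_term_sub_mem s o (fun η hη => hξ η (hsupp r hr hη)) hc hβ (r ξ)
          rwa [← hdec r] at this
        choose! q hq hqU hqr using hterm
        let E₁ := E.filter fun r => r ξ = n
        have hE₁ : ∀ r ∈ E₁, r ∈ E ∧ r ξ = n := fun r hr => Finset.mem_filter.1 hr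
        have hinj : Set.InjOn (fun r : Ξ →₀ ℕ => r.erase ξ) E₁ := by
          intro r hr r' hr' heq
          rw [hdec r, hdec r', (hE₁ r hr).2, (hE₁ r' hr').2]
          exact congrArg (· + Finsupp.single ξ n) heq
        have hzero₁ : ∀ r ∈ E₁, c r = 0 := by
          intro r₀ hr₀
          have hnh : (n : ℕ∞) < h ξ := by
            obtain ⟨hr, hn⟩ := hE₁ r₀ hr₀
            by_cases hn0 : n = 0
            · subst hn0
              exact lt_of_lt_of_le (by norm_num) (hch.nice ξ).two_le
            · have := (hE r₀ hr).2.1 ξ (Finsupp.mem_support_iff.2 (by omega))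
              rwa [hn] at this
          -- The leading coefficient at `z ξ ^ n`, with the scalars from reordering included.
          let u : R := ∑ r ∈ E₁, q r • s.term (c r) (pbwMonomial o z (r.erase ξ))
          have huU : u ∈ U ξ := sum_mem fun r hr =>
            (U ξ).smul_mem (hqU r (hE₁ r hr).1) _
          have hun : u * z ξ ^ n ∈ powSpan (U ξ) (z ξ) n := by
            have h1 : ∑ r ∈ E₁, (s.term (c r) (pbwMonomial o z r) -
                q r • (s.term (c r) (pbwMonomial o z (r.erase ξ)) * z ξ ^ r ξ)) ∈
                powSpan (U ξ) (z ξ) n := sum_mem fun r hr => by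
              have := hqr r (hE₁ r hr).1
              rwa [(hE₁ r hr).2] at this ⊢
            have h2 : ∑ r ∈ E.filter (fun r => ¬ r ξ = n), s.term (c r) (pbwMonomial o z r) ∈
                powSpan (U ξ) (z ξ) n := sum_mem fun r hr => by
              obtain ⟨hr, hrn⟩ := Finset.mem_filter.1 hr
              have hlt' : r ξ < n := lt_of_le_of_ne (Nat.lt_succ_iff.1 (hlt r hr)) hrn
              have h3 := powSpan_mono (U ξ) (z ξ) hlt'.le (hqr r hr)
              have h4 := Submodule.smul_mem _ (q r)
                (mul_pow_mem_powSpan (z := z ξ) (hqU r hr) hlt')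
              have := add_mem h3 h4
              rwa [sub_add_cancel] at this
            have h5 := add_mem h1 h2
            rw [Finset.sum_sub_distrib, sub_add_eq_add_sub,
              Finset.sum_filter_add_sum_filter_not, hsum, zero_sub] at h5
            have h6 := neg_mem h5
            rw [neg_neg] at h6
            convert h6 using 1
            rw [Finset.sum_mul]
            refine Finset.sum_congr rfl fun r hr => ?_
            rw [smul_mul_assoc, (hE₁ r hr).2]
          have hu0 := (hch.nice ξ).eq_zero n hnh u huU hun
          obtain ⟨-, -, -, β₀, -, hβ₀⟩ := hE r₀ (hE₁ r₀ hr₀).1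
          have hwt : ∀ r ∈ E₁, weight d r = weight d (r.erase ξ) + n • d ξ := fun r hr => by
            conv_lhs => rw [hdec r, weight_add_single, (hE₁ r hr).2]
          have hsm : ∀ r ∈ E₁, q r • s.term (c r) (pbwMonomial o z (r.erase ξ)) =
              s.term (q r • c r) (pbwMonomial o z (r.erase ξ)) := fun r _ => by
            cases s
            · exact (smul_mul_assoc _ _ _).symm
            · exact (mul_smul_comm _ _ _).symm
          -- Erasing `ξ` is injective on the exponents with value `n` at `ξ`, so the coefficients
          -- can be reindexed; adding `n` at `ξ` undoes the erasure.
          have hfin := ih (E₁.image fun r => r.erase ξ)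
            (fun r' => q (r' + Finsupp.single ξ n) • c (r' + Finsupp.single ξ n))
            (β₀ + weight d (r₀.erase ξ)) (by
              intro r' hr'
              obtain ⟨r, hr, rfl⟩ := Finset.mem_image.1 hr'
              obtain ⟨hr1, hr2⟩ := hE₁ r hr
              have hrr : r.erase ξ + Finsupp.single ξ n = r := by rw [← hr2, ← hdec r]
              obtain ⟨-, hv, hc, β, hβ, hβγ⟩ := hE r hr1
              rw [hrr]
              refine ⟨hsupp r hr1, fun η hη => ?_, B.smul_mem hc _, β,
                Submodule.smul_mem _ _ hβ, ?_⟩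
              · rw [Finsupp.support_erase, Finset.mem_erase] at hη
                rw [Finsupp.erase_ne hη.1]
                exact hv η hη.2
              · rw [← hβ₀, hwt r hr, hwt r₀ hr₀, ← add_assoc, ← add_assoc] at hβγ
                exact add_right_cancel hβγ) (by
              rw [Finset.sum_image hinj, ← hu0]
              refine Finset.sum_congr rfl fun r hr => ?_
              have hrr : r.erase ξ + Finsupp.single ξ n = r := by rw [← (hE₁ r hr).2, ← hdec r]
              rw [hrr, hsm r hr])
            (r₀.erase ξ) (Finset.mem_image_of_mem _ hr₀)
          have hrr : r₀.erase ξ + Finsupp.single ξ n = r₀ := by rw [← (hE₁ r₀ hr₀).2, ← hdec r₀]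
          rw [hrr] at hfin
          exact (smul_eq_zero.1 hfin).resolve_left (hq r₀ (hE₁ r₀ hr₀).1)
        have hsum₂ : ∑ r ∈ E.filter (fun r => ¬ r ξ = n), s.term (c r) (pbwMonomial o z r) = 0 := by
          rw [← Finset.sum_filter_add_sum_filter_not E (fun r => r ξ = n)] at hsum
          rwa [Finset.sum_eq_zero, zero_add] at hsum
          intro r hr
          rw [hzero₁ r hr]
          cases s <;> simp [Side.term]
        have hzero₂ := ihn (E.filter fun r => ¬ r ξ = n) c γ
          (fun r hr => hE r (Finset.mem_filter.1 hr).1)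
          (fun r hr => lt_of_le_of_ne (Nat.lt_succ_iff.1 (hlt r (Finset.mem_filter.1 hr).1))
            (Finset.mem_filter.1 hr).2) hsum₂
        intro r hr
        by_cases hrn : r ξ = n
        · exact hzero₁ r (Finset.mem_filter.2 ⟨hr, hrn⟩)
        · exact hzero₂ r (Finset.mem_filter.2 ⟨hr, hrn⟩)
    intro E c γ hE
    exact main (E.sup (fun r => r ξ) + 1) E c γ hE fun r hr =>
      Nat.lt_succ_of_le (Finset.le_sup (f := fun r : Ξ →₀ ℕ => r ξ) hr)

/-- To kill the component of degree `β₀` of one coefficient, the relation is projected to the degree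
of that term. By cancellation each coefficient contributes at most one homogeneous component. -/
theorem IsPBWChain.coeff_eq_zero (s : Side) (o : OrderOn Ξ)
    (E : Finset (Ξ →₀ ℕ)) (c : (Ξ →₀ ℕ) → R) (hE : ∀ r ∈ E, ValidExponent h r ∧ c r ∈ B)
    (hsum : ∑ r ∈ E, s.term (c r) (pbwMonomial o z r) = 0) : ∀ r ∈ E, c r = 0 := by
  classical
  intro r₀ hr₀
  refine eq_zero_of_proj (𝒜 := 𝒜) fun β₀ => ?_
  let γ := β₀ + weight d r₀
  have hmon : ∀ r, pbwMonomial o z r ∈ 𝒜 (weight d r) :=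
    pbwMonomial_mem_graded o fun ξ => (hch.nice ξ).mem_deg
  let E' := E.filter fun r => ∃ β, β + weight d r = γ
  have hβ : ∀ r, ∃ β, r ∈ E' → β + weight d r = γ := fun r => by
    by_cases hr : r ∈ E'
    · obtain ⟨β, hβ⟩ := (Finset.mem_filter.1 hr).2
      exact ⟨β, fun _ => hβ⟩
    · exact ⟨0, fun h => absurd h hr⟩
  choose β hβ using hβ
  have hr₀' : r₀ ∈ E' := Finset.mem_filter.2 ⟨hr₀, β₀, rfl⟩
  have hβr₀ : β r₀ = β₀ := add_right_cancel (hβ r₀ hr₀')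
  have hproj : ∀ r ∈ E', GradedAlgebra.proj 𝒜 γ (s.term (c r) (pbwMonomial o z r)) =
      s.term (GradedAlgebra.proj 𝒜 (β r) (c r)) (pbwMonomial o z r) := fun r hr => by
    rw [← hβ r hr]
    cases s
    · exact proj_mul_right _ (hmon r)
    · exact proj_mul_left (hmon r) _
  have hproj' : ∀ r ∈ E, r ∉ E' →
      GradedAlgebra.proj 𝒜 γ (s.term (c r) (pbwMonomial o z r)) = 0 := fun r hr hr' => by
    have hne : ∀ α, α + weight d r ≠ γ := fun α hα =>
      hr' (Finset.mem_filter.2 ⟨hr, α, hα⟩)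
    cases s
    · exact proj_mul_right_of_ne _ (hmon r) hne
    · exact proj_mul_left_of_ne (hmon r) _ hne
  have := hch.coeff_eq_zero_of_graded s o (E'.biUnion fun r => r.support) E'
    (fun r => GradedAlgebra.proj 𝒜 (β r) (c r)) γ
    (fun r hr => ⟨Finset.subset_biUnion_of_mem (fun r : Ξ →₀ ℕ => r.support) hr,
      (hE r (Finset.mem_filter.1 hr).1).1,
      hch.hom_bot _ _ (hE r (Finset.mem_filter.1 hr).1).2, β r, proj_mem 𝒜 _ _, hβ r hr⟩) (by
      have h1 := congrArg (GradedAlgebra.proj 𝒜 γ) hsum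
      rw [map_sum, map_zero, ← Finset.sum_subset (Finset.filter_subset _ E) hproj'] at h1
      rw [← h1]
      exact Finset.sum_congr rfl fun r hr => (hproj r hr).symm) r₀ hr₀'
  rwa [hβr₀] at this

end PBW

/-! ### Bases over `B` on both sides, and identification of the truncations -/

section Basis

variable {k R Γ Ξ : Type*} [Field k] [Ring R] [Algebra k R] [AddCommMonoid Γ] [LinearOrder Γ]
  [oΞ : LinearOrder Ξ] {𝒜 : Γ → Submodule k R} [GradedAlgebra 𝒜] {ψ : Bicharacter k Γ}
  {B : Subalgebra k R} {U T : Ξ → Subalgebra k R} {z : Ξ → R} {d : Ξ → Γ} {h : Ξ → ℕ∞}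
  [IsOrderedCancelAddMonoid Γ] (hch : IsPBWChain 𝒜 ψ B U T z d h)
include hch

theorem IsPBWChain.coeff_eq_zero_of_exponent (s : Side) (o : OrderOn Ξ) (S : Set Ξ)
    (E : Finset (PBWExponent h S)) (c : PBWExponent h S → R) (hc : ∀ r, c r ∈ B)
    (hsum : ∑ r ∈ E, s.term (c r) (pbwMonomial o z r.1) = 0) : ∀ r ∈ E, c r = 0 := by
  classical
  intro r hr
  let emb : PBWExponent h S ↪ (Ξ →₀ ℕ) := ⟨Subtype.val, Subtype.val_injective⟩
  let c' : (Ξ →₀ ℕ) → R := fun r => if hr : (r.support : Set Ξ) ⊆ S ∧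
    ∀ ξ ∈ r.support, (r ξ : ℕ∞) < h ξ then c ⟨r, hr⟩ else 0
  have hc' : ∀ r : PBWExponent h S, c' r.1 = c r := fun r => dif_pos r.2
  have h1 := hch.coeff_eq_zero s o (E.map emb) c' (fun r' hr' => by
    obtain ⟨r, hr, rfl⟩ := Finset.mem_map.1 hr'
    refine ⟨r.2.2, ?_⟩
    change c' r.1 ∈ B
    rw [hc']
    exact hc r) (by
      rw [Finset.sum_map, ← hsum]
      refine Finset.sum_congr rfl fun r _ => ?_
      change s.term (c' r.1) _ = _
      rw [hc']
      rfl) r.1 (Finset.mem_map_of_mem emb hr)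
  rwa [hc'] at h1

omit oΞ hch [IsOrderedCancelAddMonoid Γ] in
theorem proj_induction {p : R → Prop} (hadd : ∀ x y, p x → p y → p (x + y)) (h0 : p 0)
    (x : R) (hx : ∀ γ, p (GradedAlgebra.proj 𝒜 γ x)) : p x := by
  classical
  rw [← DirectSum.sum_support_decompose 𝒜 x]
  exact Finset.sum_induction _ p hadd h0 fun γ _ => hx γ

theorem IsPBWChain.hasPBWBasis (o : OrderOn Ξ) (S : Set Ξ) {A : Subalgebra k R} (hBA : B ≤ A)
    (hzA : ∀ ξ ∈ S, z ξ ∈ A) (hA : IsHom 𝒜 A)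
    (hspan : ∀ s γ, ∀ x ∈ 𝒜 γ, x ∈ A → x ∈ pbwSpan 𝒜 s o z d h B S γ) :
    HasPBWBasis o z h S B A := by
  have hmon : ∀ r : PBWExponent h S, pbwMonomial o z r.1 ∈ A := fun r =>
    pbwMonomial_mem o fun ξ hξ => hzA ξ (r.2.1 hξ)
  refine ⟨⟨?_, ?_⟩, ⟨?_, ?_⟩⟩
  · rw [linearIndependent_iff']
    intro E g hg r hr
    have := hch.coeff_eq_zero_of_exponent .left o S E (fun r => (g r : R)) (fun r => (g r).2) hg r hr
    exact Subtype.ext this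
  · apply Set.Subset.antisymm
    · intro x hx
      refine Submodule.span_induction ?_ (zero_mem A) (fun _ _ _ _ => add_mem) ?_ hx
      · rintro _ ⟨r, rfl⟩
        exact hmon r
      · intro b y _ hy
        exact mul_mem (hBA b.2) hy
    · intro x hx
      refine proj_induction (𝒜 := 𝒜)
        (p := fun x => x ∈ Submodule.span B (Set.range fun r : PBWExponent h S =>
          pbwMonomial o z r.1)) (fun _ _ => add_mem) (zero_mem _) x fun γ => ?_
      refine Submodule.span_induction ?_ (zero_mem _) (fun _ _ _ _ => add_mem) ?_
        (hspan .left γ _ (proj_mem 𝒜 γ x) (hA γ x hx))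
      · rintro _ ⟨b, hb, β, -, r, hr, hrh, -, rfl⟩
        exact Submodule.smul_mem _ (⟨b, hb⟩ : B) (Submodule.subset_span ⟨⟨r, hr, hrh⟩, rfl⟩)
      · intro a y _ hy
        have := Submodule.smul_mem _ (algebraMap k B a) hy
        rwa [algebraMap_smul] at this
  · rw [linearIndependent_iff']
    intro E g hg r hr
    have := hch.coeff_eq_zero_of_exponent .right o S E (fun r => (g r : Rᵐᵒᵖ).unop)
      (fun r => (g r).2) hg r hr
    exact Subtype.ext (MulOpposite.unop_injective this)
  · apply Set.Subset.antisymm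
    · intro x hx
      refine Submodule.span_induction ?_ (zero_mem A) (fun _ _ _ _ => add_mem) ?_ hx
      · rintro _ ⟨r, rfl⟩
        exact hmon r
      · intro b y _ hy
        exact mul_mem hy (hBA b.2)
    · intro x hx
      refine proj_induction (𝒜 := 𝒜)
        (p := fun x => x ∈ Submodule.span B.op (Set.range fun r : PBWExponent h S =>
          pbwMonomial o z r.1)) (fun _ _ => add_mem) (zero_mem _) x fun γ => ?_
      refine Submodule.span_induction ?_ (zero_mem _) (fun _ _ _ _ => add_mem) ?_
        (hspan .right γ _ (proj_mem 𝒜 γ x) (hA γ x hx))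
      · rintro _ ⟨b, hb, β, -, r, hr, hrh, -, rfl⟩
        exact Submodule.smul_mem _ (⟨MulOpposite.op b, hb⟩ : B.op)
          (Submodule.subset_span ⟨⟨r, hr, hrh⟩, rfl⟩)
      · intro a y _ hy
        have := Submodule.smul_mem _ (algebraMap k B.op a) hy
        have h2 : (algebraMap k B.op a) • y = a • y := by
          change y * (algebraMap k R a) = a • y
          rw [← Algebra.commutes, Algebra.smul_def]
        rwa [h2] at this

variable [WellFoundedLT Γ] (hpos : ∀ γ : Γ, 0 ≤ γ)
include hpos

theorem IsPBWChain.hasPBWBasis_top (o : OrderOn Ξ) {A : Subalgebra k R} (hBA : B ≤ A)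
    (hTA : ∀ ξ, T ξ ≤ A) (hA : IsHom 𝒜 A)
    (hex : ∀ γ, ∀ x ∈ 𝒜 γ, x ∈ A → x ∈ B ∨ ∃ ξ, x ∈ T ξ) :
    HasPBWBasis o z h Set.univ B A := by
  refine hch.hasPBWBasis o _ hBA (fun ξ _ => hTA ξ (hch.gen_mem ξ)) hA fun s γ x hx hxA => ?_
  rcases hex γ x hx hxA with hxB | ⟨ξ, hxT⟩
  · exact mem_pbwSpan_of_mem s o _ hxB hx
  · exact pbwSpan_mono s o (Set.subset_univ _) γ (hch.mem_pbwSpan hpos s o γ ξ x hx hxT)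

omit [IsOrderedCancelAddMonoid Γ] [WellFoundedLT Γ] hpos in
theorem IsPBWChain.gen_mem_of_le {η ξ : Ξ} (hηξ : η ≤ ξ) : z η ∈ T ξ := by
  rcases hηξ.eq_or_lt with rfl | hlt
  · exact hch.gen_mem η
  · exact hch.le ξ (hch.le_of_lt η ξ hlt (hch.gen_mem η))

theorem IsPBWChain.hasPBWBasis_Iic (o : OrderOn Ξ) (ξ : Ξ) :
    HasPBWBasis o z h {η | η ≤ ξ} B (T ξ) :=
  hch.hasPBWBasis o _ ((hch.bot_le ξ).trans (hch.le ξ)) (fun _ hη => hch.gen_mem_of_le hη)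
    (hch.hom_top ξ) fun s γ x hx hxT => hch.mem_pbwSpan hpos s o γ ξ x hx hxT

/-- `T ξ` is spanned by PBW monomials in the `z η` with `η ≤ ξ`, hence generated by these together
with `B`. -/
theorem IsPBWChain.truncation_eq (ξ : Ξ) :
    truncation oΞ z B ξ = T ξ := by
  apply le_antisymm
  · refine Algebra.adjoin_le ?_
    rintro x (hx | ⟨η, hη, rfl⟩)
    · exact hch.le ξ (hch.bot_le ξ hx)
    · exact hch.gen_mem_of_le hη
  · intro x hx
    have key : ∀ γ, pbwSpan 𝒜 .left oΞ z d h B {η | η ≤ ξ} γ ≤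
        Subalgebra.toSubmodule (truncation oΞ z B ξ) := by
      intro γ
      refine Submodule.span_le.2 ?_
      rintro _ ⟨b, hb, β, -, r, hr, -, -, rfl⟩
      exact mul_mem (S := Subalgebra k R) (Algebra.subset_adjoin (Or.inl hb))
        (pbwMonomial_mem _ fun η hη =>
          Algebra.subset_adjoin (Or.inr ⟨η, hr hη, rfl⟩))
    refine proj_induction (𝒜 := 𝒜) (p := fun x => x ∈ truncation oΞ z B ξ)
      (fun _ _ => add_mem) (zero_mem _) x fun γ => ?_
    exact key γ (hch.mem_pbwSpan hpos .left oΞ γ ξ _ (proj_mem 𝒜 γ x) (hch.hom_top ξ γ x hx))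

end Basis

/-! ### Orders -/

theorem HasAdmissibleWellOrder.exists_linearOrder {Γ : Type*} [AddCommMonoid Γ]
    [inst : DecidableEq Γ] (hΓ : HasAdmissibleWellOrder Γ) :
    ∃ L : LinearOrder Γ, L.toDecidableEq = inst ∧ IsOrderedCancelAddMonoid Γ ∧ WellFoundedLT Γ ∧
      ∀ γ : Γ, 0 ≤ γ := by
  classical
  obtain ⟨r, hr, hadd⟩ := hΓ
  let L : LinearOrder Γ := linearOrderOfSTO r
  have hlt : ∀ a b : Γ, a < b ↔ r a b := fun _ _ => Iff.rfl
  have hadd' : ∀ γ a b : Γ, a < b → γ + a < γ + b := hadd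
  have hwf : WellFoundedLT Γ := ⟨hr.wf⟩
  refine ⟨L, Subsingleton.elim _ _, ?_, hwf, fun γ => ?_⟩
  · exact
      { add_le_add_left := fun a b hab c => by
          rcases hab.eq_or_lt with rfl | hab
          · exact le_rfl
          · rw [add_comm a, add_comm b]
            exact (hadd' c a b hab).le
        le_of_add_le_add_left := fun c a b hab => by
          by_contra hne
          exact absurd hab (not_le.2 (hadd' c b a (not_le.1 hne))) }
  · by_contra hne
    have hγ : γ < 0 := not_le.1 hne
    -- If `γ` were negative, its multiples would form an infinite strictly descending sequence.
    obtain ⟨n, hn⟩ := hwf.wf.has_min (Set.range fun n : ℕ => n • γ) ⟨_, 0, rfl⟩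
    obtain ⟨⟨n, rfl⟩, hmin⟩ := hn
    refine hmin ((n + 1) • γ) ⟨n + 1, rfl⟩ ?_
    have := hadd' (n • γ) γ 0 hγ
    rwa [add_zero, ← succ_nsmul] at this

/-- Pairs (degree, element) are ordered lexicographically, with any well-order on `R` in the second
place. Pairs are needed because `0` has every degree. -/
theorem exists_enumeration {k : Type*} {R : Type v} {Γ : Type w} [Field k] [AddCommGroup R] [Module k R] [LinearOrder Γ]
    [WellFoundedLT Γ] (𝒜 : Γ → Submodule k R) :
    ∃ (ι : Type (max w v)) (_ : LinearOrder ι) (_ : WellFoundedLT ι) (wd : ι → Γ) (w : ι → R),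
      (∀ i, w i ∈ 𝒜 (wd i)) ∧ (∀ i j, wd i < wd j → i < j) ∧
      ∀ γ, ∀ x ∈ 𝒜 γ, ∃ i, wd i = γ ∧ w i = x := by
  obtain ⟨L, hL⟩ : ∃ L : LinearOrder R, WellFoundedLT R := by
    classical
    exact ⟨linearOrderOfSTO (WellOrderingRel : R → R → Prop), ⟨WellOrderingRel.isWellOrder.wf⟩⟩
  refine ⟨{p : Γ ×ₗ R // (ofLex p).2 ∈ 𝒜 (ofLex p).1}, inferInstance, inferInstance,
    fun p => (ofLex p.1).1, fun p => (ofLex p.1).2, fun p => p.2, fun i j hij => ?_,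
    fun γ x hx => ⟨⟨toLex (γ, x), hx⟩, rfl, rfl⟩⟩
  exact Subtype.coe_lt_coe.1 (Prod.Lex.lt_iff.2 (Or.inl hij))

/-! ### Existence of the chain -/

section Existence

variable {R : Type v} {k : Type*} {Γ : Type w} [Field k] [Ring R] [Algebra k R] [AddCommMonoid Γ]
  [LinearOrder Γ] [WellFoundedLT Γ] [IsOrderedCancelAddMonoid Γ]

/-- The index set consists of the distinct elementary intervals, ordered by `T ξ ≤ U η`. Different
elements may give the same interval, so pairs of algebras and not elements serve as indices. -/
theorem exists_pbwChain_of_isRefinable {ι : Type*} [LinearOrder ι] [WellFoundedLT ι]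
    {𝒜 : Γ → Submodule k R} [GradedAlgebra 𝒜] {ψ : Bicharacter k Γ}
    {P : Subalgebra k R → Prop} {wd : ι → Γ} {w : ι → R} (hP : IsRefinable 𝒜 ψ P wd w)
    {A B : Subalgebra k R} (hA : P A) (hB : P B) (hBA : B ≤ A)
    (hpos : ∀ γ : Γ, 0 ≤ γ) (hzero : ∀ x ∈ 𝒜 0, x ∈ B) :
    ∃ (Ξ : Type v) (_ : LinearOrder Ξ) (U T : Ξ → Subalgebra k R) (z : Ξ → R) (d : Ξ → Γ)
      (h : Ξ → ℕ∞), IsPBWChain 𝒜 ψ B U T z d h ∧ (∀ ξ, P (T ξ)) ∧ (∀ ξ, T ξ ≤ A) ∧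
      ∀ γ, ∀ x ∈ 𝒜 γ, x ∈ A → x ∈ B ∨ ∃ ξ, x ∈ T ξ := by
  classical
  obtain ⟨U, T, hUT, htri, hmin⟩ := exists_chain hP hA hB hBA hpos hzero
  let Ξ : Type v := {p : Subalgebra k R × Subalgebra k R //
    ∃ a, (∃ γ, a ∈ 𝒜 γ) ∧ a ∈ A ∧ a ∉ B ∧ p = (U a, T a)}
  let mk : ∀ γ, ∀ a ∈ 𝒜 γ, a ∈ A → a ∉ B → Ξ := fun γ a h1 h2 h3 =>
    ⟨(U a, T a), a, ⟨γ, h1⟩, h2, h3, rfl⟩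
  have hex : ∀ ξ : Ξ, P ξ.1.1 ∧ P ξ.1.2 ∧ B ≤ ξ.1.1 ∧ ξ.1.2 ≤ A ∧
      ∃ z d h, NiceStep 𝒜 ψ ξ.1.1 ξ.1.2 z d h := by
    rintro ⟨_, a, ⟨γ, ha⟩, haA, haB, rfl⟩
    obtain ⟨h1, h2, h3, h4, -, -, h5⟩ := hUT γ a ha haA haB
    exact ⟨h1, h2, h3, h4, h5⟩
  choose hPU hPT hBU hTA z d h hnice using hex
  have hle : ∀ ξ : Ξ, ξ.1.1 ≤ ξ.1.2 := fun ξ => by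
    rw [(hnice ξ).eq_extend]
    exact le_extend _ _
  have hnle : ∀ ξ : Ξ, ¬ ξ.1.2 ≤ ξ.1.1 := by
    rintro ⟨_, a, ⟨γ, ha⟩, haA, haB, rfl⟩ hle
    obtain ⟨-, -, -, -, h1, h2, -⟩ := hUT γ a ha haA haB
    exact h2 (hle h1)
  have htri' : ∀ ξ η : Ξ, ξ = η ∨ ξ.1.2 ≤ η.1.1 ∨ η.1.2 ≤ ξ.1.1 := by
    rintro ⟨_, a, ⟨γ, ha⟩, haA, haB, rfl⟩ ⟨_, b, ⟨δ, hb⟩, hbA, hbB, rfl⟩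
    refine (htri a b haA haB hbA hbB).imp_left fun h => ?_
    exact Subtype.ext (Prod.ext h.1 h.2)
  let lt : Ξ → Ξ → Prop := fun ξ η => ξ.1.2 ≤ η.1.1
  have hlt : IsStrictTotalOrder Ξ lt :=
    { irrefl := hnle
      trans := fun ξ η ζ h1 h2 => (h1.trans (hle η)).trans h2
      trichotomous := fun ξ η h1 h2 => (htri' ξ η).resolve_right (not_or.2 ⟨h1, h2⟩) }
  let L : LinearOrder Ξ := linearOrderOfSTO lt
  have hself : ∀ γ x (h1 : x ∈ 𝒜 γ) (h2 : x ∈ A) (h3 : x ∉ B), x ∈ (mk γ x h1 h2 h3).1.2 ∧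
      x ∉ (mk γ x h1 h2 h3).1.1 := fun γ x h1 h2 h3 => by
    obtain ⟨-, -, -, -, h4, h5, -⟩ := hUT γ x h1 h2 h3
    exact ⟨h4, h5⟩
  refine ⟨Ξ, L, fun ξ => ξ.1.1, fun ξ => ξ.1.2, z, d, h,
    { hom_bot := hP.hom _ hB
      hom := fun ξ => hP.hom _ (hPU ξ)
      hom_top := fun ξ => hP.hom _ (hPT ξ)
      nice := hnice
      bot_le := hBU
      le_of_lt := fun η ξ hηξ => hηξ
      descend := fun γ x hx ξ hxU hxB => ?_
      wf := fun γ => ?_ }, hPT, hTA, fun γ x hx hxA => ?_⟩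
  · have hxA := hTA ξ (hle ξ hxU)
    obtain ⟨h1, h2⟩ := hself γ x hx hxA hxB
    refine ⟨mk γ x hx hxA hxB, ?_, h1, h2⟩
    rcases htri' (mk γ x hx hxA hxB) ξ with h3 | h3 | h3
    · rw [h3] at h2
      exact absurd hxU h2
    · exact h3
    · exact absurd (h3 (hle ξ hxU)) h2
  · refine WellFounded.wellFounded_iff_has_min.2 fun S hS => ?_
    -- An interval is recovered from any homogeneous element in its gap, so minimality among
    -- elements of degree `γ` becomes minimality among intervals.
    have key : ∀ ξ : Ξ, ∀ x (h1 : x ∈ 𝒜 γ) (h2 : x ∈ ξ.1.2) (h3 : x ∉ ξ.1.1),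
        ξ = mk γ x h1 (hTA ξ h2) fun hB => h3 (hBU ξ hB) := fun ξ x h1 h2 h3 => by
      obtain ⟨h4, h5⟩ := hself γ x h1 (hTA ξ h2) fun hB => h3 (hBU ξ hB)
      exact (htri' ξ _).resolve_right
        (not_or.2 ⟨fun h => h5 (h h2), fun h => h3 (h h4)⟩)
    obtain ⟨a, ⟨ξ, hξ, ha, haT, haU⟩, hmin'⟩ := hmin γ
      {x | ∃ ξ ∈ S, x ∈ 𝒜 γ ∧ x ∈ ξ.1.1.2 ∧ x ∉ ξ.1.1.1} (by
        obtain ⟨ξ, hξ⟩ := hS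
        obtain ⟨x, h1, h2, h3⟩ := ξ.2
        exact ⟨x, ξ, hξ, h1, h2, h3⟩)
      (fun x ⟨ξ, _, h1, h2, h3⟩ => ⟨hTA _ h2, fun hB => h3 (hBU _ hB), h1⟩)
    refine ⟨ξ, hξ, fun η hη hlt => ?_⟩
    obtain ⟨b, hb, hbT, hbU⟩ := η.2
    refine hmin' b ⟨η, hη, hb, hbT, hbU⟩ ?_
    have h1 := congrArg (fun ξ : Ξ => ξ.1.1) (key ξ.1 a ha haT haU)
    have h2 := congrArg (fun ξ : Ξ => ξ.1.2) (key η.1 b hb hbT hbU)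
    change ξ.1.1.1 = U a at h1
    change η.1.1.2 = T b at h2
    rw [← h1, ← h2]
    exact hlt
  · by_cases hxB : x ∈ B
    · exact Or.inl hxB
    · exact Or.inr ⟨mk γ x hx hxA hxB, (hself γ x hx hxA hxB).1⟩

variable [Coalgebra k R] {𝒜 : Γ → Submodule k R} [GradedAlgebra 𝒜]

theorem exists_pbwChain (hpos : ∀ γ : Γ, 0 ≤ γ) {τ : R ⊗[k] R ≃ₗ[k] R ⊗[k] R}
    {χ : Bicharacter k Γ} (hR : IsGradedBraidedBialgebra 𝒜 τ) (hconn : IsConnectedGrading 𝒜)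
    (hχ : IsInducedBraiding χ 𝒜 τ) {pL pR : Prop} (s : Side)
    (hs : match s with | .left => pL | .right => pR) (hτ : pL → pR → ∀ t, τ (τ t) = t)
    {A B : Subalgebra k R} (hA : IsGood 𝒜 pL pR A) (hB : IsGood 𝒜 pL pR B) (hBA : B ≤ A) :
    ∃ (Ξ : Type v) (_ : LinearOrder Ξ) (U T : Ξ → Subalgebra k R) (z : Ξ → R) (d : Ξ → Γ)
      (h : Ξ → ℕ∞), IsPBWChain 𝒜 (s.bichar χ) B U T z d h ∧ (∀ ξ, IsGood 𝒜 pL pR (T ξ)) ∧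
      (∀ ξ, T ξ ≤ A) ∧ ∀ γ, ∀ x ∈ 𝒜 γ, x ∈ A → x ∈ B ∨ ∃ ξ, x ∈ T ξ := by
  obtain ⟨ι, _, _, wd, w, hmem, hlt, hw⟩ := exists_enumeration 𝒜
  refine exists_pbwChain_of_isRefinable (wd := wd) (w := w)
    { mem := hmem
      lt_of_lt := hlt
      exists_eq := hw
      hom := fun K hK => hK.hom
      sInf := fun S hS => isGood_sInf hS
      sSup := fun S hne hc hS => isGood_sSup hne hc hS
      extend := fun C D i hC hD hCD hi => isGood_extend hpos hR hconn hχ hC hD hCD (hmem i) hi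
      mid := fun C i hC hD hi hCD =>
        exists_mid hpos hR hconn hχ s hs hτ hC hD rfl (hmem i) hi hCD
      mem_of_ne := fun C i γ hC x hx hxγ hγ =>
        mem_of_mem_extend_of_ne hpos hR hconn hC (hmem i) hx hxγ hγ
      smul_sub_mem := fun C i hC x hx hxγ =>
        exists_smul_sub_mem hpos hR hconn hC (hmem i) hx hxγ } hA hB hBA hpos fun x hx => ?_
  rw [eq_counit_smul_one hR.braidedBialgebra hconn hx]
  exact B.smul_mem (one_mem B) _

end Existence

theorem braidedCommutator_eq {k : Type*} {R : Type*} [Field k] [Ring R] [Algebra k R]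
    {Γ : Type*} [AddCommMonoid Γ] {𝒜 : Γ → Submodule k R} {τ : R ⊗[k] R ≃ₗ[k] R ⊗[k] R}
    {χ : Bicharacter k Γ} (hχ : IsInducedBraiding χ 𝒜 τ) (s : Side) {α β : Γ} {x y : R}
    (hx : x ∈ 𝒜 α) (hy : y ∈ 𝒜 β) :
    braidedCommutator (s.braiding τ) x y = x * y - (s.bichar χ α β : k) • (y * x) := by
  cases s with
  | left =>
    change LinearMap.mul' k R (x ⊗ₜ[k] y) - LinearMap.mul' k R (τ (x ⊗ₜ[k] y)) = _
    rw [hχ α β x hx y hy, map_smul]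
    rfl
  | right =>
    have h : τ.symm (x ⊗ₜ[k] y) = (((χ β α)⁻¹ : kˣ) : k) • (y ⊗ₜ[k] x) := by
      rw [LinearEquiv.symm_apply_eq, map_smul, hχ β α y hy x hx, smul_smul, Units.inv_mul, one_smul]
    change LinearMap.mul' k R (x ⊗ₜ[k] y) - LinearMap.mul' k R (τ.symm (x ⊗ₜ[k] y)) = _
    rw [h, map_smul]
    rfl

theorem heightCondition_bichar {k : Type*} [Field k] {Γ : Type*} [AddCommMonoid Γ]
    {χ : Bicharacter k Γ} {s : Side} {γ : Γ} {n : ℕ} (h : HeightCondition (s.bichar χ γ γ) n) :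
    HeightCondition (χ γ γ) n := by
  cases s with
  | left => exact h
  | right =>
    have h' : HeightCondition ((χ γ γ)⁻¹) n := h
    simpa only [HeightCondition, orderOf_inv, isOfFinOrder_inv_iff, ne_eq, inv_eq_one] using h'

section

variable {k R Γ Ξ : Type*} [Field k] [Ring R] [Algebra k R] [AddCommMonoid Γ] [LinearOrder Γ]
  [LinearOrder Ξ] {𝒜 : Γ → Submodule k R} [GradedAlgebra 𝒜] {ψ : Bicharacter k Γ}
  {B : Subalgebra k R} {U T : Ξ → Subalgebra k R} {z : Ξ → R} {d : Ξ → Γ} {h : Ξ → ℕ∞}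

theorem IsPBWChain.mem_bot_or_exists (hch : IsPBWChain 𝒜 ψ B U T z d h) {γ : Γ} {x : R}
    (hx : x ∈ 𝒜 γ) {ξ : Ξ} (hxU : x ∈ U ξ) : x ∈ B ∨ ∃ η < ξ, x ∈ T η := by
  by_cases hxB : x ∈ B
  · exact Or.inl hxB
  · obtain ⟨η, hη, h, -⟩ := hch.descend γ x hx ξ hxU hxB
    exact Or.inr ⟨η, hη, h⟩

end

end BraidedPBW

/-! ### Assembly of the theorem -/

theorem theoremC {k : Type u} [Field k] {R : Type v} [Ring R] [Algebra k R] [Coalgebra k R]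
    {Γ : Type w} [AddCommMonoid Γ] [DecidableEq Γ] [Nontrivial Γ]
    (hΓ : BraidedPBW.HasAdmissibleWellOrder Γ)
    (𝒜 : Γ → Submodule k R) [GradedAlgebra 𝒜]
    (τ : TensorProduct k R R ≃ₗ[k] TensorProduct k R R)
    (hR : BraidedPBW.IsGradedBraidedBialgebra 𝒜 τ)
    (hconn : BraidedPBW.IsConnectedGrading 𝒜)
    (χ : BraidedPBW.Bicharacter k Γ)
    (hχ : BraidedPBW.IsInducedBraiding χ 𝒜 τ)
    (s : BraidedPBW.Side)
    (A B : Subalgebra k R) (hBA : B ≤ A)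
    (hAhom : (Subalgebra.toSubmodule A).IsHomogeneous 𝒜)
    (hBhom : (Subalgebra.toSubmodule B).IsHomogeneous 𝒜)
    (hA : BraidedPBW.IsCoideal s (Subalgebra.toSubmodule A))
    (hB : BraidedPBW.IsCoideal s (Subalgebra.toSubmodule B)) :
    ∃ (Ξ : Type v) (z : Ξ → R) (d : Ξ → Γ) (h : Ξ → ℕ∞) (o : LinearOrder Ξ),
      -- each `z ξ` is a homogeneous element of `A` of nonzero degree `d ξ`
      (∀ ξ, z ξ ∈ A ∧ z ξ ∈ 𝒜 (d ξ) ∧ d ξ ≠ 0) ∧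
      -- PBW generators of `A` over `B`, for every total order
      (∀ o' : LinearOrder Ξ, BraidedPBW.IsPBWSystem o' z h B A) ∧
      -- PBW bases of the truncated subalgebras, for the special order
      (∀ ξ, BraidedPBW.HasPBWBasis o z h {η | o.le η ξ} B (BraidedPBW.truncation o z B ξ)) ∧
      -- the truncated subalgebras are coideals, or subcoalgebras
      (∀ ξ, BraidedPBW.IsCoideal s (Subalgebra.toSubmodule (BraidedPBW.truncation o z B ξ))) ∧
      (BraidedPBW.IsSubcoalgebra (Subalgebra.toSubmodule A) →
        BraidedPBW.IsSubcoalgebra (Subalgebra.toSubmodule B) →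
        (∀ t, τ (τ t) = t) →
        ∀ ξ, BraidedPBW.IsSubcoalgebra
          (Subalgebra.toSubmodule (BraidedPBW.truncation o z B ξ))) ∧
      -- powers
      (∀ ξ, ∀ n : ℕ, h ξ = n →
        z ξ ^ n ∈ (B : Set R) ∪
          ⋃ δ ∈ {δ | o.lt δ ξ}, (BraidedPBW.truncation o z B δ : Set R)) ∧
      -- braided commutators
      (∀ ξ η, o.lt η ξ →
        BraidedPBW.braidedCommutator (BraidedPBW.Side.braiding τ s) (z ξ) (z η) ∈
          ⋃ δ ∈ {δ | o.lt δ ξ}, (BraidedPBW.truncation o z B δ : Set R)) ∧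
      -- heights and orders of roots of unity
      (∀ ξ, ∀ n : ℕ, h ξ = n →
        IsOfFinOrder (χ (d ξ) (d ξ)) ∧
        (CharZero k → orderOf (χ (d ξ) (d ξ)) = n ∧ χ (d ξ) (d ξ) ≠ 1) ∧
        (∀ p : ℕ, p.Prime → CharP k p →
          ∃ e : ℕ, orderOf (χ (d ξ) (d ξ)) * p ^ e = n)) := by
  obtain ⟨L, rfl, hΓ₁, hΓ₂, hpos⟩ := hΓ.exists_linearOrder
  -- The generators are chosen before the subcoalgebra hypotheses are introduced, so these are
  -- folded into the properties `pL` and `pR`: the side `s` is always requested, the other side only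
  -- if `flag` holds.
  let flag : Prop := BraidedPBW.IsSubcoalgebra (Subalgebra.toSubmodule A) ∧
    BraidedPBW.IsSubcoalgebra (Subalgebra.toSubmodule B) ∧ ∀ t, τ (τ t) = t
  let pL : Prop := (match s with | .left => True | .right => False) ∨ flag
  let pR : Prop := (match s with | .left => False | .right => True) ∨ flag
  have hgood : ∀ K : Subalgebra k R, (Subalgebra.toSubmodule K).IsHomogeneous 𝒜 →
      BraidedPBW.IsCoideal s (Subalgebra.toSubmodule K) →
      (flag → BraidedPBW.IsSubcoalgebra (Subalgebra.toSubmodule K)) →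
      BraidedPBW.IsGood 𝒜 pL pR K := fun K h1 h2 h3 => by
    refine ⟨fun γ x hx => ?_, fun h => ?_, fun h => ?_⟩
    · rw [GradedAlgebra.proj_apply]
      exact h1 γ hx
    · rcases h with h | h
      · cases s
        · exact h2
        · exact h.elim
      · exact (BraidedPBW.isSubcoalgebra_iff.1 (h3 h)).1
    · rcases h with h | h
      · cases s
        · exact h.elim
        · exact h2
      · exact (BraidedPBW.isSubcoalgebra_iff.1 (h3 h)).2
  have hτ : pL → pR → ∀ t, τ (τ t) = t := by
    rintro (h | h) (h' | h')
    · cases s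
      · exact h'.elim
      · exact h.elim
    · exact h'.2.2
    · exact h.2.2
    · exact h.2.2
  obtain ⟨Ξ, o, U, T, z, d, h, hch, hT, hTA, hex⟩ := BraidedPBW.exists_pbwChain (pL := pL) (pR := pR) hpos hR
    hconn hχ s (by cases s <;> exact Or.inl trivial) hτ (hgood A hAhom hA fun h => h.1) (hgood B hBhom hB fun h => h.2.1) hBA
  have htr : ∀ ξ, BraidedPBW.truncation o z B ξ = T ξ := hch.truncation_eq hpos
  have hmem : ∀ ξ γ, ∀ x ∈ 𝒜 γ, x ∈ U ξ → x ∈ (B : Set R) ∪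
      ⋃ δ ∈ {δ | o.lt δ ξ}, (BraidedPBW.truncation o z B δ : Set R) := fun ξ γ x hx hxU => by
    refine (hch.mem_bot_or_exists hx hxU).imp_right ?_
    rintro ⟨η, hη, hxη⟩
    refine Set.mem_biUnion (show η ∈ {δ | o.lt δ ξ} from hη) ?_
    rw [htr]
    exact hxη
  refine ⟨Ξ, z, d, h, o, fun ξ => ⟨hTA ξ (hch.gen_mem ξ), (hch.nice ξ).mem_deg,
    (hch.nice ξ).deg_ne⟩, fun (o' : BraidedPBW.OrderOn Ξ) => ⟨fun ξ => hTA ξ (hch.gen_mem ξ), fun ξ => (hch.nice ξ).two_le,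
      hch.hasPBWBasis_top hpos o' hBA hTA (hgood A hAhom hA fun h => h.1).hom hex⟩,
    fun ξ => ?_, fun ξ => ?_, fun h1 h2 h3 ξ => ?_, fun ξ n hn => ?_, fun ξ η hη => ?_,
    fun ξ n hn => BraidedPBW.heightCondition_bichar ((hch.nice ξ).height n hn)⟩
  · rw [htr]
    exact hch.hasPBWBasis_Iic hpos o ξ
  · rw [htr]
    cases s
    · exact (hT ξ).left (Or.inl trivial)
    · exact (hT ξ).right (Or.inl trivial)
  · rw [htr]
    have hf : flag := ⟨h1, h2, h3⟩
    exact BraidedPBW.isSubcoalgebra_iff.2 ⟨(hT ξ).left (Or.inr hf), (hT ξ).right (Or.inr hf)⟩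
  · exact hmem ξ _ _ (SetLike.pow_mem_graded n (hch.nice ξ).mem_deg) ((hch.nice ξ).pow_mem n hn)
  · have hzξ := (hch.nice ξ).mem_deg
    have hzη := (hch.nice η).mem_deg
    have hdeg : BraidedPBW.braidedCommutator (s.braiding τ) (z ξ) (z η) ∈ 𝒜 (d ξ + d η) := by
      rw [BraidedPBW.braidedCommutator_eq hχ s hzξ hzη]
      refine sub_mem (SetLike.mul_mem_graded hzξ hzη) (Submodule.smul_mem _ _ ?_)
      rw [add_comm]
      exact SetLike.mul_mem_graded hzη hzξ
    have hU : BraidedPBW.braidedCommutator (s.braiding τ) (z ξ) (z η) ∈ U ξ := by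
      rw [BraidedPBW.braidedCommutator_eq hχ s hzξ hzη]
      exact (hch.nice ξ).comm (d η) (z η) (hch.le_of_lt η ξ hη (hch.gen_mem η)) hzη
    -- A commutator that already lies in `B` belongs to every truncation, and `η` supplies one below
    -- `ξ`.
    rcases hmem ξ _ _ hdeg hU with hB' | h'
    · refine Set.mem_biUnion (show η ∈ {δ | o.lt δ ξ} from hη) ?_
      exact Algebra.subset_adjoin (Or.inl hB')
    · exact h'
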